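/- **Setting.** Let $M$ be a smooth ($C^\infty$, Hausdorff, second countable) manifold of dimension $n$, $\psi:M\to M$ a diffeomorphism, $A=C^\infty(M)$ and $\varphi=\psi^*:A\to A$, $\varphi(f)=f\circ\psi$. The space $\Gamma(\psi^!TM)$ of sections of the pull-back bundle is the $A$-module of $\varphi$-derivations, i.e. of $\mathbb R$-linear maps $X:A\to A$ with $X[fg]=\varphi(f)X[g]+\varphi(g)X[f]$. Write $\Omega^k=\Gamma(\wedge^k\psi^!T^*M)$ for the alternating $A$-multilinear maps $\Gamma(\psi^!TM)^k\to A$, with the usual wedge product (sum over shuffles) on $\Omega=\bigoplus_k\Omega^k$. Put - $[X,Y]=\varphi X\varphi^{-1}Y\varphi^{-1}-\varphi Y\varphi^{-1}X\varphi^{-1}$ and $\mathrm{Ad}(X)=\varphi X\varphi^{-1}$ on $\Gamma(\psi^!TM)$; $\mathrm{Ad}^\dagger(\Xi)(X_1,\dots,X_k)=\varphi\big(\Xi(\mathrm{Ad}^{-1}X_1,\dots,\mathrm{Ad}^{-1}X_k)\big)$ on $\Omega^k$; - $(d\Xi)(X_0,\dots,X_k)=\sum_p(-1)^pX_p\big[\Xi(\mathrm{Ad}^{-1}X_0,\dots,\widehat{X_p},\dots,\mathrm{Ad}^{-1}X_k)\big]+\sum_{p<q}(-1)^{p+q}\varphi\big(\Xi(\mathrm{Ad}^{-2}[X_p,X_q],\mathrm{Ad}^{-1}X_0,\dots,\widehat{X_p},\dots,\widehat{X_q},\dots,\mathrm{Ad}^{-1}X_k)\big)$;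 - $i_X\Xi=(\mathrm{Ad}^\dagger\Xi)(\mathrm{Ad}X,-,\dots,-)$, and $L_X$ is given by $L_X\circ\mathrm{Ad}^\dagger=i_X\circ d+d\circ i_{\mathrm{Ad}^{-1}X}$. For $\pi\in\Gamma(\wedge^2\psi^!TM)$ let $i_\pi\Xi=(\mathrm{Ad}^\dagger\Xi)(\mathrm{Ad}\,\pi,-,\dots,-)$, where $\Xi(X\wedge Y,-)=\Xi(X,Y,-)$ ($i_\pi=0$ on $\Omega^0,\Omega^1$), let $\pi(\Theta)\in A$ be the value on $\Theta\in\Omega^2$ with $(X\wedge Y)(\Theta)=\Theta(X,Y)$, $\pi(\xi,\eta)=\pi(\xi\wedge\eta)$, and let $\pi^\#:\Omega^1\to\Gamma(\psi^!TM)$ be given by $\eta(\pi^\#\xi)=\pi(\xi,\eta)$. A *hom-Lie algebra* $(\mathfrak g,[-,-],\alpha)$ is a real vector space with a skew-symmetric bilinear bracket and a linear map $\alpha$ such that $\alpha[x,y]=[\alpha x,\alpha y]$ and $[\alpha x,[y,z]]+[\alpha y,[z,x]]+[\alpha z,[x,y]]=0$; a *representation* of it on $V$ with respect to $\beta\in\mathrm{End}(V)$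 is a bilinear map $\rho:\mathfrak g\times V\to V$ with $\rho(\alpha x,\beta v)=\beta\rho(x,v)$ and $\rho([x,y],\beta v)=\rho(\alpha x,\rho(y,v))-\rho(\alpha y,\rho(x,v))$. Let $(M,\psi,\pi)$ be a *hom-Poisson manifold*: $\psi$ is a diffeomorphism, $\pi\in\Gamma(\wedge^2\psi^!TM)$, and $(C^\infty(M),\{-,-\},\psi^*)$ with $\{f,g\}=\pi(df,dg)$ is a hom-Lie algebra. **Proposition.** 1. Put $[\xi,\eta]_{\pi^\#}=L_{\pi^\#\xi}\eta-L_{\pi^\#\eta}\xi-d(\pi(\xi,\eta))$ and $\rho=\pi^\#\circ\mathrm{Ad}^\dagger$ on $\Omega^1=\Gamma(\psi^!T^*M)$. Then $\mathcal T^*=(\psi^!T^*M,\psi,[-,-]_{\pi^\#},\rho,\mathrm{Ad}^\dagger)$ is a hom-Lie algebroid: $(\Omega^1,[-,-]_{\pi^\#},\mathrm{Ad}^\dagger)$ is a hom-Lie algebra, $\mathrm{Ad}^\dagger(f\xi)=\psi^*(f)\mathrm{Ad}^\dagger\xi$, $[\xi,f\eta]_{\pi^\#}=\psi^*(f)[\xi,\eta]_{\pi^\#}+\rho(\xi)[f]\,\mathrm{Ad}^\dagger\eta$,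 $\rho(f\xi)=\psi^*(f)\rho(\xi)$, and $(\xi,f)\mapsto\rho(\xi)[f]$ is a representation on $C^\infty(M)$ with respect to $\psi^*$. Moreover $[-,-]_{\pi^\#}$ extends to exactly one bracket on $\Omega$, again denoted $[-,-]_{\pi^\#}$, of degree $-1$, such that $[\xi,f]_{\pi^\#}=\rho(\xi)[f]$ for $\xi\in\Omega^1$, $f\in\Omega^0$, and $(\Omega,\wedge,[-,-]_{\pi^\#},\mathrm{Ad}^\dagger)$ is a hom-Gerstenhaber algebra; that is, $\Omega$ is a graded commutative associative algebra, $\mathrm{Ad}^\dagger$ is a degree $0$ endomorphism for $\wedge$ and the bracket, and for $X,Y,Z$ of degrees $i,j,k$: $[X,Y]=-(-1)^{(i-1)(j-1)}[Y,X]$; $(-1)^{(i-1)(k-1)}[\mathrm{Ad}^\dagger X,[Y,Z]]+(-1)^{(j-1)(i-1)}[\mathrm{Ad}^\dagger Y,[Z,X]]+(-1)^{(k-1)(j-1)}[\mathrm{Ad}^\dagger Z,[X,Y]]=0$; $[X,Y\wedge Z]=[X,Y]\wedge\mathrm{Ad}^\dagger Z+(-1)^{(i-1)j}\mathrm{Ad}^\dagger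 Y\wedge[X,Z]$. 2. The map $\bar D:\Gamma(\psi^!T^*M)\otimes\Gamma(\wedge^{n}\psi^!T^*M)\to\Gamma(\wedge^{n}\psi^!T^*M)$, $$\bar D(\xi,\mu)=[\xi,\mu]_{\pi^\#}-\pi(d\xi)\,\mathrm{Ad}^\dagger(\mu),$$ is a representation of $\mathcal T^*$ on the hom-bundle $(\wedge^{n}\psi^!T^*M,\psi,\mathrm{Ad}^\dagger)$ (where $n=\dim M$ is the top degree): $\mathrm{Ad}^\dagger(f\mu)=\psi^*(f)\mathrm{Ad}^\dagger\mu$, $\bar D(f\xi,\mu)=\psi^*(f)\bar D(\xi,\mu)$, $\bar D(\xi,f\mu)=\psi^*(f)\bar D(\xi,\mu)+\rho(\xi)[f]\,\mathrm{Ad}^\dagger\mu$, and $\bar D$ is a representation of the hom-Lie algebra $(\Omega^1,[-,-]_{\pi^\#},\mathrm{Ad}^\dagger)$ with respect to $\mathrm{Ad}^\dagger$. 3. The operator $$[i_\pi,d]_{\mathrm{Ad}^\dagger}=\mathrm{Ad}^\dagger\, i_\pi\,(\mathrm{Ad}^\dagger)^{-1}d\,(\mathrm{Ad}^\dagger)^{-1}-\mathrm{Ad}^\dagger\,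 d\,(\mathrm{Ad}^\dagger)^{-1}i_\pi\,(\mathrm{Ad}^\dagger)^{-1}$$ is an exact generator of the hom-Gerstenhaber algebra $(\Omega,\wedge,[-,-]_{\pi^\#},\mathrm{Ad}^\dagger)$: it is an $\mathbb R$-linear map $D:\Omega\to\Omega$ of degree $-1$ that commutes with $\mathrm{Ad}^\dagger$ and satisfies $D^2=0$ and, for $X\in\Omega^i$, $Y\in\Omega^j$, $$[X,Y]_{\pi^\#}=(-1)^{i}\big(D(X\wedge Y)-D(X)\wedge\mathrm{Ad}^\dagger(Y)-(-1)^{i}\mathrm{Ad}^\dagger(X)\wedge D(Y)\big).$$ It is the exact generator that corresponds to $\bar D$: an exact generator $D$ satisfies $\bar D(\xi,\mu)=[\xi,\mu]_{\pi^\#}-D(\xi)\,\mathrm{Ad}^\dagger(\mu)$ for all $\xi\in\Omega^1$, $\mu\in\Omega^n$ if and only if $D=[i_\pi,d]_{\mathrm{Ad}^\dagger}$. (In particular $(\Omega,[i_\pi,d]_{\mathrm{Ad}^\dagger})$ is a chain complex; its homology is the hom-Poisson homology of $(M,\psi,\pi)$.) -/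

import Mathlib

open scoped Manifold ContDiff DirectSum

noncomputable section

namespace HomPoisson

/-! ### Hom-Lie algebras, representations, hom-Lie algebroids -/

section Abstract

/-- A hom-Lie algebra `(g, [-,-], α)` over `ℝ`. -/
structure IsHomLieAlgebra {g : Type*} [AddCommGroup g] [Module ℝ g]
    (br : g →ₗ[ℝ] g →ₗ[ℝ] g) (α : g →ₗ[ℝ] g) : Prop where
  skew : ∀ x y, br x y = -br y x
  map_bracket : ∀ x y, α (br x y) = br (α x) (α y)
  hom_jacobi : ∀ x y z, br (α x) (br y z) + br (α y) (br z x) + br (α z) (br x y) = 0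

/-- A representation `(ρ, β)` of the hom-Lie algebra `(g, [-,-], α)` on `V`. -/
structure IsHomLieRep {g V : Type*} [AddCommGroup g] [Module ℝ g] [AddCommGroup V] [Module ℝ V]
    (br : g →ₗ[ℝ] g →ₗ[ℝ] g) (α : g →ₗ[ℝ] g)
    (ρ : g →ₗ[ℝ] V →ₗ[ℝ] V) (β : V →ₗ[ℝ] V) : Prop where
  equivariant : ∀ x v, ρ (α x) (β v) = β (ρ x v)
  bracket : ∀ x y v, ρ (br x y) (β v) = ρ (α x) (ρ y v) - ρ (α y) (ρ x v)

end Abstract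

variable {A : Type*} [CommRing A] [Algebra ℝ A] (φ : A ≃ₐ[ℝ] A)

/-- The `φ`-derivations of `A`, as a submodule of the `A`-module of `ℝ`-linear maps `A → A`. -/
def derivations : Submodule A (A →ₗ[ℝ] A) where
  carrier := {X | ∀ a b, X (a * b) = φ a * X b + φ b * X a}
  add_mem' := by
    intro X Y hX hY a b
    simp only [LinearMap.add_apply, hX a b, hY a b]; ring
  zero_mem' := by intro a b; simp
  smul_mem' := by
    intro c X hX a b
    simp only [LinearMap.smul_apply, hX a b, smul_eq_mul]; ring

/-- The `A`-module of `φ`-derivations of `A`, i.e. of the `ℝ`-linear maps `X : A → A` with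
`X[a b] = φ a * X[b] + φ b * X[a]`.  For `A = C^∞(M)` and `φ = ψ^*` this is the module
`Γ(ψ^! TM)` of sections of the pull-back bundle, acting on functions by
`X[f](m) = ⟨d_{ψ m} f, X_m⟩`. -/
def Vec : Type _ := derivations φ

instance : AddCommGroup (Vec φ) := inferInstanceAs (AddCommGroup (derivations φ))
instance : Module A (Vec φ) := inferInstanceAs (Module A (derivations φ))
instance : Module ℝ (Vec φ) := inferInstanceAs (Module ℝ (derivations φ))
instance : IsScalarTower ℝ A (Vec φ) := inferInstanceAs (IsScalarTower ℝ A (derivations φ))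

variable {φ}

/-- The action `X ↦ (f ↦ X[f])` of `φ`-derivations on functions. -/
def act : Vec φ →ₗ[A] A →ₗ[ℝ] A := (derivations φ).subtype

theorem vec_leibniz (X : Vec φ) (a b : A) :
    act X (a * b) = φ a * act X b + φ b * act X a := X.2 a b

@[ext] theorem Vec.ext {X Y : Vec φ} (h : ∀ a, act X a = act Y a) : X = Y :=
  Subtype.ext (LinearMap.ext h)

@[simp] theorem act_smul_real (c : ℝ) (X : Vec φ) : act (c • X) = c • act X := rfl

/-- A linear map satisfying the twisted Leibniz rule, as a `φ`-derivation. -/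
def mkVec (X : A →ₗ[ℝ] A) (h : ∀ a b, X (a * b) = φ a * X b + φ b * X a) : Vec φ := ⟨X, h⟩

@[simp] theorem act_mkVec (X : A →ₗ[ℝ] A) (h : ∀ a b, X (a * b) = φ a * X b + φ b * X a) :
    act (mkVec X h) = X := rfl

variable (φ)

/-- A hom-Lie algebroid `(L, φ, [-,-], ρ, α)` in terms of its module of sections `L` over the
algebra `A` of functions; the anchor is given by its action on sections. -/
structure IsHomLieAlgebroid {L : Type*} [AddCommGroup L] [Module A L] [Module ℝ L]
    (br : L →ₗ[ℝ] L →ₗ[ℝ] L) (ρ : L →ₗ[ℝ] Vec φ) (α : L →ₗ[ℝ] L) : Prop where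
  map_smul : ∀ (f : A) (x : L), α (f • x) = φ f • α x
  homLie : IsHomLieAlgebra br α
  leibniz : ∀ (x : L) (f : A) (y : L), br x (f • y) = φ f • br x y + act (ρ x) f • α y
  anchor_smul : ∀ (f : A) (x : L), ρ (f • x) = φ f • ρ x
  anchor_rep : IsHomLieRep br α (act.restrictScalars ℝ ∘ₗ ρ) φ.toLinearMap

/-- A hom-bundle structure `β` on the module of sections `E`. -/
def IsHomBundle {E : Type*} [AddCommGroup E] [Module A E] [Module ℝ E] (β : E →ₗ[ℝ] E) : Prop :=
  ∀ (f : A) (s : E), β (f • s) = φ f • β s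

/-- A representation `∇` of the hom-Lie algebroid `(L, φ, [-,-], ρ, α)` on the hom-bundle
`(E, φ, β)`. -/
structure IsRepresentation {L E : Type*} [AddCommGroup L] [Module A L] [Module ℝ L]
    [AddCommGroup E] [Module A E] [Module ℝ E]
    (br : L →ₗ[ℝ] L →ₗ[ℝ] L) (ρ : L →ₗ[ℝ] Vec φ) (α : L →ₗ[ℝ] L)
    (β : E →ₗ[ℝ] E) (nabla : L →ₗ[ℝ] E →ₗ[ℝ] E) : Prop where
  homBundle : IsHomBundle φ β
  smul_left : ∀ (f : A) (x : L) (s : E), nabla (f • x) s = φ f • nabla x s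
  smul_right : ∀ (x : L) (f : A) (s : E),
    nabla x (f • s) = φ f • nabla x s + act (ρ x) f • β s
  rep : IsHomLieRep br α nabla β

/-! ### Hom-Gerstenhaber algebras and exact generators -/

section Graded

variable {G : ℕ → Type*} [∀ k, AddCommGroup (G k)] [∀ k, Module ℝ (G k)]

/-- The homogeneous element of degree `k` of `⨁ G` given by `x : G k`. -/
abbrev inDeg (k : ℕ) (x : G k) : ⨁ k, G k := DirectSum.lof ℝ ℕ G k x

/-- A graded commutative associative unital `ℝ`-algebra structure on `⨁ G`. -/
structure IsGradedCommAlgebra (one : ⨁ k, G k)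
    (mul : (⨁ k, G k) →ₗ[ℝ] (⨁ k, G k) →ₗ[ℝ] (⨁ k, G k)) : Prop where
  one_mem : ∀ k, k ≠ 0 → one k = 0
  one_mul : ∀ a, mul one a = a
  mul_one : ∀ a, mul a one = a
  assoc : ∀ a b c, mul (mul a b) c = mul a (mul b c)
  degree : ∀ i j (x : G i) (y : G j) k, k ≠ i + j → mul (inDeg i x) (inDeg j y) k = 0
  comm : ∀ i j (x : G i) (y : G j),
    mul (inDeg i x) (inDeg j y) = (-1 : ℝ) ^ (i * j) • mul (inDeg j y) (inDeg i x)

/-- A hom-Gerstenhaber algebra `(⨁ G, ∧, [-,-], α)`.  The signs `(-1)^{(i-1)(j-1)}` are written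
`(-1)^{(i+1)(j+1)}`, in order to avoid subtraction of natural numbers. -/
structure IsHomGerstenhaber (one : ⨁ k, G k)
    (mul : (⨁ k, G k) →ₗ[ℝ] (⨁ k, G k) →ₗ[ℝ] (⨁ k, G k))
    (br : (⨁ k, G k) →ₗ[ℝ] (⨁ k, G k) →ₗ[ℝ] (⨁ k, G k))
    (α : (⨁ k, G k) →ₗ[ℝ] (⨁ k, G k)) : Prop where
  algebra : IsGradedCommAlgebra one mul
  map_degree : ∀ i (x : G i) k, k ≠ i → α (inDeg i x) k = 0
  map_one : α one = one
  map_mul : ∀ a b, α (mul a b) = mul (α a) (α b)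
  map_bracket : ∀ a b, α (br a b) = br (α a) (α b)
  degree : ∀ i j (x : G i) (y : G j) k, k + 1 ≠ i + j → br (inDeg i x) (inDeg j y) k = 0
  skew : ∀ i j (x : G i) (y : G j),
    br (inDeg i x) (inDeg j y) = -((-1 : ℝ) ^ ((i + 1) * (j + 1)) • br (inDeg j y) (inDeg i x))
  hom_jacobi : ∀ i j k (x : G i) (y : G j) (z : G k),
    (-1 : ℝ) ^ ((i + 1) * (k + 1)) • br (α (inDeg i x)) (br (inDeg j y) (inDeg k z)) +
    (-1 : ℝ) ^ ((j + 1) * (i + 1)) • br (α (inDeg j y)) (br (inDeg k z) (inDeg i x)) +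
    (-1 : ℝ) ^ ((k + 1) * (j + 1)) • br (α (inDeg k z)) (br (inDeg i x) (inDeg j y)) = 0
  hom_leibniz : ∀ i j k (x : G i) (y : G j) (z : G k),
    br (inDeg i x) (mul (inDeg j y) (inDeg k z)) =
      mul (br (inDeg i x) (inDeg j y)) (α (inDeg k z)) +
      (-1 : ℝ) ^ ((i + 1) * j) • mul (α (inDeg j y)) (br (inDeg i x) (inDeg k z))

/-- `D` is an exact generator of the hom-Gerstenhaber algebra `(⨁ G, ∧, [-,-], α)`. -/
structure IsExactGenerator
    (mul : (⨁ k, G k) →ₗ[ℝ] (⨁ k, G k) →ₗ[ℝ] (⨁ k, G k))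
    (br : (⨁ k, G k) →ₗ[ℝ] (⨁ k, G k) →ₗ[ℝ] (⨁ k, G k))
    (α : (⨁ k, G k) →ₗ[ℝ] (⨁ k, G k)) (D : (⨁ k, G k) →ₗ[ℝ] (⨁ k, G k)) : Prop where
  degree : ∀ i (x : G i) k, k + 1 ≠ i → D (inDeg i x) k = 0
  comm : ∀ a, D (α a) = α (D a)
  generates : ∀ i j (x : G i) (y : G j),
    br (inDeg i x) (inDeg j y) = (-1 : ℝ) ^ i •
      (D (mul (inDeg i x) (inDeg j y)) - mul (D (inDeg i x)) (α (inDeg j y)) -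
        (-1 : ℝ) ^ i • mul (α (inDeg i x)) (D (inDeg j y)))
  sq_zero : ∀ a, D (D a) = 0

end Graded

/-! ### The tangent hom-Lie algebroid and the calculus of forms -/

/-- Conjugation `X ↦ σ ∘ X ∘ σ⁻¹` on `φ`-derivations, for `σ` commuting with `φ`. -/
def conj (σ : A ≃ₐ[ℝ] A) (hσ : ∀ a, σ (φ a) = φ (σ a)) : Vec φ →ₗ[ℝ] Vec φ where
  toFun X := mkVec (σ.toLinearMap ∘ₗ act X ∘ₗ σ.symm.toLinearMap) (by
    intro a b
    have h : ∀ c, σ (φ (σ.symm c)) = φ c := fun c => by rw [hσ, σ.apply_symm_apply]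
    simp [vec_leibniz, h])
  map_add' X Y := by
    ext a
    change σ (act (X + Y) (σ.symm a)) = σ (act X (σ.symm a)) + σ (act Y (σ.symm a))
    simp
  map_smul' c X := by
    ext a
    change σ (act (c • X) (σ.symm a)) = c • σ (act X (σ.symm a))
    simp

/-- `Ad(X) = φ ∘ X ∘ φ⁻¹`. -/
def Ad : Vec φ ≃ₗ[ℝ] Vec φ :=
  LinearEquiv.ofLinearMap (conj φ φ (fun _ => rfl)) (conj φ φ.symm (fun a => by simp))
    (by
      ext X a
      change φ (φ.symm (act X (φ (φ.symm a)))) = act X a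
      simp)
    (by
      ext X a
      change φ.symm (φ (act X (φ.symm (φ a)))) = act X a
      simp)

variable {φ}

@[simp] theorem Ad_apply (X : Vec φ) (a : A) : act (Ad φ X) a = φ (act X (φ.symm a)) := rfl

@[simp] theorem Ad_symm_apply (X : Vec φ) (a : A) :
    act ((Ad φ).symm X) a = φ.symm (act X (φ a)) := rfl

theorem Ad_smul (f : A) (X : Vec φ) : Ad φ (f • X) = φ f • Ad φ X := by
  ext a; simp

theorem Ad_symm_smul (f : A) (X : Vec φ) :
    (Ad φ).symm (f • X) = φ.symm f • (Ad φ).symm X := by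
  ext a; simp

/-- The bracket `[X, Y] = φ X φ⁻¹ Y φ⁻¹ - φ Y φ⁻¹ X φ⁻¹` of the tangent hom-Lie algebroid. -/
def tbr (X Y : Vec φ) : Vec φ :=
  mkVec (φ.toLinearMap ∘ₗ act X ∘ₗ φ.symm.toLinearMap ∘ₗ act Y ∘ₗ φ.symm.toLinearMap -
    φ.toLinearMap ∘ₗ act Y ∘ₗ φ.symm.toLinearMap ∘ₗ act X ∘ₗ φ.symm.toLinearMap) (by
    intro a b
    simp [vec_leibniz]
    ring)

theorem tbr_apply (X Y : Vec φ) (a : A) :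
    act (tbr X Y) a =
      φ (act X (φ.symm (act Y (φ.symm a)))) - φ (act Y (φ.symm (act X (φ.symm a)))) := rfl

theorem tbr_smul_left (f : A) (X Y : Vec φ) :
    tbr (f • X) Y = φ f • tbr X Y - act (Ad φ Y) f • Ad φ X := by
  ext a
  simp [tbr_apply, vec_leibniz]
  ring

variable (φ)

/-- `k`-forms: the `A`-module `Γ(∧^k ψ^! T^*M)` of alternating `A`-multilinear maps on
`Γ(ψ^! TM)`. -/
abbrev Form (k : ℕ) : Type _ := Vec φ [⋀^Fin k]→ₗ[A] A

instance (k : ℕ) : IsScalarTower ℝ A (Form φ k) :=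
  ⟨fun r a Ξ => AlternatingMap.ext fun x => by simp⟩

/-- Functions as `0`-forms. -/
def fn : A →ₗ[A] Form φ 0 := AlternatingMap.constLinearEquivOfIsEmpty.toLinearMap

@[simp] theorem fn_apply (f : A) (x : Fin 0 → Vec φ) : fn φ f x = f := rfl

/-- `Ξ ↦ σ ∘ Ξ ∘ (T × ⋯ × T)` for a `σ⁻¹`-semilinear `T`. -/
def twist (k : ℕ) (σ : A ≃ₐ[ℝ] A) (T : Vec φ →ₗ[ℝ] Vec φ)
    (hT : ∀ (f : A) X, T (f • X) = σ.symm f • T X) : Form φ k →ₗ[ℝ] Form φ k where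
  toFun Ξ :=
    { toFun := fun x => σ (Ξ (fun i => T (x i)))
      map_update_add' := by
        intro _ x i X Y
        have h : ∀ Z, (fun j => T (Function.update x i Z j)) =
            Function.update (fun j => T (x j)) i (T Z) := fun Z => by
          ext1 j; by_cases hj : j = i
          · subst hj; simp
          · simp [hj]
        simp only [h, map_add, AlternatingMap.map_update_add]
      map_update_smul' := by
        intro _ x i c X
        have h : ∀ Z, (fun j => T (Function.update x i Z j)) =
            Function.update (fun j => T (x j)) i (T Z) := fun Z => by
          ext1 j; by_cases hj : j = i
          · subst hj; simp
          · simp [hj]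
        simp only [h, hT, AlternatingMap.map_update_smul, smul_eq_mul, map_mul,
          AlgEquiv.apply_symm_apply]
      map_eq_zero_of_eq' := by
        intro x i j hij hne
        have := Ξ.map_eq_zero_of_eq (fun l => T (x l)) (i := i) (j := j) (by simp [hij]) hne
        simpa using this }
  map_add' Ξ Θ := by ext x; simp
  map_smul' c Ξ := by ext x; simp

/-- `Ad^†(Ξ)(x₁, …, x_k) = φ (Ξ (Ad⁻¹ x₁, …, Ad⁻¹ x_k))`. -/
def Adt (k : ℕ) : Form φ k ≃ₗ[ℝ] Form φ k :=
  LinearEquiv.ofLinearMap (twist φ k φ (Ad φ).symm.toLinearMap Ad_symm_smul)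
    (twist φ k φ.symm (Ad φ).toLinearMap Ad_smul)
    (by ext Ξ x; simp [twist]) (by ext Ξ x; simp [twist])

variable {φ}

@[simp] theorem Adt_apply {k : ℕ} (Ξ : Form φ k) (x : Fin k → Vec φ) :
    Adt φ k Ξ x = φ (Ξ (fun i => (Ad φ).symm (x i))) := rfl

@[simp] theorem Adt_symm_apply {k : ℕ} (Ξ : Form φ k) (x : Fin k → Vec φ) :
    (Adt φ k).symm Ξ x = φ.symm (Ξ (fun i => Ad φ (x i))) := rfl

/-- The wedge product of forms, as a sum over shuffles. -/
def wedge (p q : ℕ) : Form φ p →ₗ[A] Form φ q →ₗ[A] Form φ (p + q) :=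
  (TensorProduct.mk A (Form φ p) (Form φ q)).compr₂
    ((AlternatingMap.domDomCongrₗ A finSumFinEquiv).toLinearMap ∘ₗ
      (LinearMap.mul' A A).compAlternatingMapₗ A ∘ₗ AlternatingMap.domCoprod')

/-- The part of `dΞ` that involves brackets:
`∑_{p < q} (-1)^{p+q} φ (Ξ (Ad⁻² [x_p, x_q], Ad⁻¹ x₀, …, x̂_p, …, x̂_q, …))`.
The pairs `p < q` are those of the form `p = i`, `q = j + 1` with `i ≤ j`. -/
def bracketSum : {k : ℕ} → Form φ k → (Fin (k + 1) → Vec φ) → A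
  | 0, _, _ => 0
  | m + 1, Ξ, x => ∑ i : Fin (m + 1), ∑ j ∈ Finset.Ici i, (-1 : A) ^ (i.val + (j.val + 1)) *
      φ (Ξ (Fin.cons ((Ad φ).symm ((Ad φ).symm (tbr (x i.castSucc) (x j.succ))))
        (fun l => (Ad φ).symm (j.removeNth (i.castSucc.removeNth x) l))))

/-- The value of `dΞ` on `x₀, …, x_k`. -/
def extDFun {k : ℕ} (Ξ : Form φ k) (x : Fin (k + 1) → Vec φ) : A :=
  (∑ i : Fin (k + 1), (-1 : A) ^ i.val * act (x i) (Ξ (fun l => (Ad φ).symm (i.removeNth x l)))) +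
    bracketSum Ξ x

/-- `tbr` as an `ℝ`-bilinear map. -/
def tbrL : Vec φ →ₗ[ℝ] Vec φ →ₗ[ℝ] Vec φ :=
  LinearMap.mk₂ ℝ tbr
    (by intro X Y Z; ext a; simp [tbr_apply]; ring)
    (by intro c X Y; ext a; simp [tbr_apply, smul_sub])
    (by intro X Y Z; ext a; simp [tbr_apply]; ring)
    (by intro c X Y; ext a; simp [tbr_apply, smul_sub])

theorem tbr_skew (X Y : Vec φ) : tbr X Y = (-1 : A) • tbr Y X := by
  ext a; simp [tbr_apply]

/-- `x ↦ Ξ(Ad⁻¹ x₁, …, Ad⁻¹ x_k)` as an `ℝ`-multilinear map. -/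
def formR {k : ℕ} : Form φ k →ₗ[ℝ] Vec φ [⋀^Fin k]→ₗ[ℝ] A where
  toFun Ξ :=
    { (Ξ.toMultilinearMap.restrictScalars ℝ).compLinearMap
        (fun _ => (Ad φ).symm.toLinearMap) with
      map_eq_zero_of_eq' := by
        intro x i j hij hne
        exact Ξ.map_eq_zero_of_eq (fun l => (Ad φ).symm (x l)) (i := i) (j := j)
          (by simp [hij]) hne }
  map_add' _ _ := rfl
  map_smul' _ _ := rfl

theorem formR_apply {k : ℕ} (Ξ : Form φ k) (x : Fin k → Vec φ) :
    formR Ξ x = Ξ (fun l => (Ad φ).symm (x l)) := rfl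

/-- `X ↦ (x ↦ X[Ξ(Ad⁻¹ x)])`. -/
def anchorPart {k : ℕ} (Ξ : Form φ k) : Vec φ →ₗ[ℝ] Vec φ [⋀^Fin k]→ₗ[ℝ] A where
  toFun X := (act X).compAlternatingMap (formR Ξ)
  map_add' X Y := by ext x; simp
  map_smul' c X := by ext x; simp

/-- `(X, Y) ↦ (x ↦ φ (Ξ(Ad⁻² [X, Y], Ad⁻¹ x)))`. -/
def bracketPart {m : ℕ} (Ξ : Form φ (m + 1)) :
    Vec φ →ₗ[ℝ] Vec φ →ₗ[ℝ] Vec φ [⋀^Fin m]→ₗ[ℝ] A :=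
  LinearMap.mk₂ ℝ (fun X Y => φ.toLinearMap.compAlternatingMap
      (formR (Ξ.curryLeft ((Ad φ).symm ((Ad φ).symm (tbrL X Y))))))
    (by intro X Y Z; ext x; simp [formR_apply])
    (by intro c X Y; ext x; simp [formR_apply])
    (by intro X Y Z; ext x; simp [formR_apply])
    (by intro c X Y; ext x; simp [formR_apply])

theorem bracketPart_apply {m : ℕ} (Ξ : Form φ (m + 1)) (X Y : Vec φ) (x : Fin m → Vec φ) :
    bracketPart Ξ X Y x = φ (Ξ (Matrix.vecCons ((Ad φ).symm ((Ad φ).symm (tbr X Y)))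
      (fun l => (Ad φ).symm (x l)))) := rfl

/-- `bracketSum` as an `ℝ`-multilinear alternating map. -/
def bracketAlt : {k : ℕ} → Form φ k → Vec φ [⋀^Fin (k + 1)]→ₗ[ℝ] A
  | 0, _ => 0
  | _ + 1, Ξ => (-(1 / 2) : ℝ) • AlternatingMap.alternatizeUncurryFin (R := ℝ) (M := Vec φ) (N := A)
      (AlternatingMap.alternatizeUncurryFinLM (R := ℝ) (M := Vec φ) (N := A) ∘ₗ bracketPart Ξ)

theorem bracketAlt_apply {k : ℕ} (Ξ : Form φ k) (x : Fin (k + 1) → Vec φ) :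
    bracketAlt Ξ x = bracketSum Ξ x := by
  cases k with
  | zero => rfl
  | succ m =>
    simp only [bracketAlt, bracketSum, AlternatingMap.smul_apply,
      AlternatingMap.alternatizeUncurryFin_alternatizeUncurryFinLM_comp_apply, Finset.smul_sum]
    refine Finset.sum_congr rfl fun i _ => Finset.sum_congr rfl fun j _ => ?_
    have h : ∀ (X Y : Vec φ) v, bracketPart Ξ X Y v - bracketPart Ξ Y X v =
        (2 : ℝ) • bracketPart Ξ X Y v := by
      intro X Y v
      have : bracketPart Ξ Y X v = - bracketPart Ξ X Y v := by
        rw [bracketPart_apply, bracketPart_apply, tbr_skew Y X, Ad_symm_smul, Ad_symm_smul,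
          AlternatingMap.map_vecCons_smul]
        simp
      rw [this, two_smul]; abel
    rw [h, bracketPart_apply, smul_comm, smul_smul, ← add_assoc, pow_succ]
    norm_num
    rfl

/-- `extDFun` as an `ℝ`-multilinear alternating map. -/
def extDAlt {k : ℕ} (Ξ : Form φ k) : Vec φ [⋀^Fin (k + 1)]→ₗ[ℝ] A :=
  AlternatingMap.alternatizeUncurryFin (R := ℝ) (M := Vec φ) (N := A) (anchorPart Ξ) +
    bracketAlt Ξ

theorem extDAlt_apply {k : ℕ} (Ξ : Form φ k) (x : Fin (k + 1) → Vec φ) :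
    extDAlt Ξ x = extDFun Ξ x := by
  simp only [extDAlt, extDFun, AlternatingMap.add_apply, bracketAlt_apply,
    AlternatingMap.alternatizeUncurryFin_apply]
  congr 1
  refine Finset.sum_congr rfl fun i _ => ?_
  simp [anchorPart, formR_apply]

theorem formR_cons_smul {k : ℕ} (Ξ : Form φ (k + 1)) (f : A) (X : Vec φ) (x : Fin k → Vec φ) :
    formR Ξ (Fin.cons (f • X) x) = φ.symm f * formR Ξ (Fin.cons X x) := by
  have h : ∀ Z : Vec φ, (fun l => (Ad φ).symm ((Fin.cons Z x : Fin (k + 1) → Vec φ) l)) =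
      Matrix.vecCons ((Ad φ).symm Z) (fun l => (Ad φ).symm (x l)) := by
    intro Z; ext1 l; refine Fin.cases ?_ (fun _ => ?_) l <;> rfl
  rw [formR_apply, formR_apply, h, h, Ad_symm_smul, AlternatingMap.map_vecCons_smul, smul_eq_mul]

theorem bracketPart_smul {m : ℕ} (Ξ : Form φ (m + 1)) (f : A) (X Y : Vec φ)
    (x : Fin m → Vec φ) :
    bracketPart Ξ (f • X) Y x =
      f * bracketPart Ξ X Y x - act Y (φ.symm f) * φ (formR Ξ (Fin.cons X x)) := by
  have h : ((Ad φ).symm ((Ad φ).symm (tbr (f • X) Y))) =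
      φ.symm f • ((Ad φ).symm ((Ad φ).symm (tbr X Y))) +
        (-φ.symm (act Y (φ.symm f))) • (Ad φ).symm X := by
    ext a
    simp [tbr_smul_left]
    ring
  have h2 : formR Ξ (Fin.cons X x) =
      Ξ (Matrix.vecCons ((Ad φ).symm X) (fun l => (Ad φ).symm (x l))) := by
    rw [formR_apply]; congr 1
    ext1 l; refine Fin.cases ?_ (fun _ => ?_) l <;> rfl
  rw [bracketPart_apply, bracketPart_apply, h, AlternatingMap.map_vecCons_add,
    AlternatingMap.map_vecCons_smul, AlternatingMap.map_vecCons_smul, h2]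
  simp
  ring

theorem bracketPart_skew {m : ℕ} (Ξ : Form φ (m + 1)) (X Y : Vec φ) (x : Fin m → Vec φ) :
    bracketPart Ξ Y X x = -bracketPart Ξ X Y x := by
  rw [bracketPart_apply, bracketPart_apply, tbr_skew Y X, Ad_symm_smul, Ad_symm_smul,
    AlternatingMap.map_vecCons_smul]
  simp

theorem removeNth_succ_cons {k : ℕ} (i : Fin (k + 1)) (X : Vec φ) (x : Fin (k + 1) → Vec φ) :
    i.succ.removeNth (Fin.cons X x : Fin (k + 2) → Vec φ) = Fin.cons X (i.removeNth x) := by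
  ext1 l
  refine Fin.cases ?_ (fun l => ?_) l
  · simp [Fin.removeNth]
  · simp [Fin.removeNth]

theorem removeNth_zero_cons {k : ℕ} (X : Vec φ) (x : Fin k → Vec φ) :
    (0 : Fin (k + 1)).removeNth (Fin.cons X x : Fin (k + 1) → Vec φ) = x := by
  ext1 l; simp [Fin.removeNth]

theorem bracketPart_alt_cons_smul {m : ℕ} (Ξ : Form φ (m + 1)) (f : A) (X Y : Vec φ)
    (x : Fin m → Vec φ) :
    AlternatingMap.alternatizeUncurryFin (R := ℝ) (M := Vec φ) (N := A) (bracketPart Ξ Y)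
        (Fin.cons (f • X) x) =
      f * AlternatingMap.alternatizeUncurryFin (R := ℝ) (M := Vec φ) (N := A) (bracketPart Ξ Y)
        (Fin.cons X x) + act Y (φ.symm f) * φ (formR Ξ (Fin.cons X x)) := by
  have key : ∀ n (Θ : Form φ (n + 2)) (Z : Vec φ) (w : Fin n → Vec φ),
      bracketPart Θ Y Z (Fin.cons (f • X) w) = f * bracketPart Θ Y Z (Fin.cons X w) := by
    intro n Θ Z w
    have := formR_cons_smul (Θ.curryLeft ((Ad φ).symm ((Ad φ).symm (tbr Y Z)))) f X w
    have h2 := congrArg φ this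
    rw [map_mul, AlgEquiv.apply_symm_apply] at h2
    exact h2
  cases m with
  | zero =>
    simp only [AlternatingMap.alternatizeUncurryFin_apply, Fin.sum_univ_succ,
      removeNth_zero_cons, Fin.cons_zero]
    rw [bracketPart_skew, bracketPart_smul, bracketPart_skew Ξ X Y]
    simp
    ring
  | succ n =>
    simp only [AlternatingMap.alternatizeUncurryFin_apply, Fin.sum_univ_succ (n := n + 1),
      removeNth_zero_cons, removeNth_succ_cons, Fin.cons_zero, Fin.cons_succ, key]
    rw [bracketPart_skew, bracketPart_smul, bracketPart_skew Ξ X Y]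
    simp only [mul_add, Finset.mul_sum, mul_smul_comm]
    simp
    ring

theorem alternatizeUncurryFin_cons {m : ℕ}
    (F : Vec φ →ₗ[ℝ] Vec φ [⋀^Fin (m + 1)]→ₗ[ℝ] A) (X : Vec φ) (x : Fin (m + 1) → Vec φ) :
    AlternatingMap.alternatizeUncurryFin (R := ℝ) (M := Vec φ) (N := A) F (Fin.cons X x) =
      F X x - ∑ i : Fin (m + 1), (-1 : A) ^ i.val * F (x i) (Fin.cons X (i.removeNth x)) := by
  simp [AlternatingMap.alternatizeUncurryFin_apply, Fin.sum_univ_succ (n := m + 1),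
    removeNth_succ_cons, pow_succ, sub_eq_add_neg]

theorem extDAlt_cons_smul {k : ℕ} (Ξ : Form φ k) (f : A) (X : Vec φ) (x : Fin k → Vec φ) :
    extDAlt Ξ (Fin.cons (f • X) x) = f * extDAlt Ξ (Fin.cons X x) := by
  cases k with
  | zero =>
    simp [extDAlt, bracketAlt, AlternatingMap.alternatizeUncurryFin_apply, anchorPart,
      formR_apply]
  | succ m =>
    have h1 : ∀ i : Fin (m + 1), anchorPart Ξ (x i) (Fin.cons (f • X) (i.removeNth x)) =
        f * anchorPart Ξ (x i) (Fin.cons X (i.removeNth x)) +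
          act (x i) (φ.symm f) * φ (formR Ξ (Fin.cons X (i.removeNth x))) := by
      intro i
      change act (x i) (formR Ξ _) = f * act (x i) (formR Ξ _) + _
      rw [formR_cons_smul, vec_leibniz]
      simp
      ring
    have h2 : ∀ w, anchorPart Ξ (f • X) w = f * anchorPart Ξ X w := fun _ => rfl
    have h3 : AlternatingMap.alternatizeUncurryFin (R := ℝ) (M := Vec φ) (N := A)
        (bracketPart Ξ (f • X)) x =
        f * AlternatingMap.alternatizeUncurryFin (R := ℝ) (M := Vec φ) (N := A)
          (bracketPart Ξ X) x -
        ∑ i : Fin (m + 1), (-1 : A) ^ i.val *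
          (act (x i) (φ.symm f) * φ (formR Ξ (Fin.cons X (i.removeNth x)))) := by
      simp only [AlternatingMap.alternatizeUncurryFin_apply, bracketPart_smul, Finset.mul_sum,
        ← Finset.sum_sub_distrib]
      refine Finset.sum_congr rfl fun i _ => ?_
      simp
      ring
    simp only [extDAlt, bracketAlt, AlternatingMap.add_apply, AlternatingMap.smul_apply,
      alternatizeUncurryFin_cons, LinearMap.comp_apply,
      AlternatingMap.alternatizeUncurryFinLM_apply, h1, h2, h3, bracketPart_alt_cons_smul]
    simp only [mul_add, Finset.sum_add_distrib]
    have h4 : ∀ g : Fin (m + 1) → A, ∑ i : Fin (m + 1), (-1 : A) ^ i.val * (f * g i) =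
        f * ∑ i : Fin (m + 1), (-1 : A) ^ i.val * g i := by
      intro g; rw [Finset.mul_sum]; exact Finset.sum_congr rfl fun i _ => by ring
    simp only [h4]
    generalize (∑ i : Fin (m + 1), (-1 : A) ^ i.val *
          (act (x i) (φ.symm f) * φ (formR Ξ (Fin.cons X (i.removeNth x))))) = S
    generalize AlternatingMap.alternatizeUncurryFin (R := ℝ) (M := Vec φ) (N := A)
          (bracketPart Ξ X) x = B
    generalize (∑ i : Fin (m + 1), (-1 : A) ^ i.val * anchorPart Ξ (x i)
      (Fin.cons X (i.removeNth x))) = P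
    generalize (∑ i : Fin (m + 1), (-1 : A) ^ i.val * _) = Q
    have h6 : ∀ a : A, (-(1 / 2) : ℝ) • a = algebraMap ℝ A (-(1 / 2)) * a :=
      fun a => Algebra.smul_def _ _
    have h7 : (algebraMap ℝ A (-(1 / 2))) * 2 = -1 := by
      rw [← map_ofNat (algebraMap ℝ A) 2, ← map_mul]; norm_num
    simp only [h6]
    linear_combination (-S) * h7

theorem extDAlt_update_smul {k : ℕ} (Ξ : Form φ k) (f : A) (x : Fin (k + 1) → Vec φ)
    (i : Fin (k + 1)) (X : Vec φ) :
    extDAlt Ξ (Function.update x i (f • X)) = f * extDAlt Ξ (Function.update x i X) := by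
  have h : ∀ Z, extDAlt Ξ (Function.update x i Z) =
      (-1 : A) ^ i.val * extDAlt Ξ (Fin.cons Z (i.removeNth x)) := by
    intro Z
    rw [← Fin.insertNth_removeNth]
    refine (AlternatingMap.map_insertNth (R := ℝ) (M := Vec φ) (N := A) (extDAlt Ξ) i Z
      (i.removeNth x)).trans ?_
    simp [Matrix.vecCons]
  rw [h, h, extDAlt_cons_smul]
  ring

variable (φ)

/-- The differential `d` of the tangent hom-Lie algebroid, with trivial coefficients:
`(dΞ)(x₀, …, x_k) = ∑_p (-1)^p ρ(Ad⁻¹ x_p)[Ξ(Ad⁻¹ x₀, …, x̂_p, …, Ad⁻¹ x_k)]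
  + ∑_{p < q} (-1)^{p+q} φ (Ξ (Ad⁻² [x_p, x_q], Ad⁻¹ x₀, …, x̂_p, …, x̂_q, …, Ad⁻¹ x_k))`.
As the anchor is `ρ = Ad`, the vector field `ρ(Ad⁻¹ x_p)` is `x_p`. -/
def extD (k : ℕ) : Form φ k →ₗ[ℝ] Form φ (k + 1) where
  toFun Ξ :=
    { toFun := extDFun Ξ
      map_update_add' := by
        intro inst x i X Y
        rw [Subsingleton.elim inst (instDecidableEqFin _)]
        simp only [← extDAlt_apply, AlternatingMap.map_update_add]
      map_update_smul' := by
        intro inst x i f X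
        rw [Subsingleton.elim inst (instDecidableEqFin _)]
        simp only [← extDAlt_apply, extDAlt_update_smul, smul_eq_mul]
      map_eq_zero_of_eq' := by
        intro x i j hij hne
        rw [← extDAlt_apply]
        exact (extDAlt Ξ).map_eq_zero_of_eq x hij hne }
  map_add' Ξ Θ := by
    ext x
    cases k with
    | zero => simp [extDFun, bracketSum]
    | succ m => simp [extDFun, bracketSum, mul_add, Finset.sum_add_distrib]; ring
  map_smul' c Ξ := by
    ext x
    cases k with
    | zero => simp [extDFun, bracketSum]
    | succ m => simp [extDFun, bracketSum, Finset.smul_sum]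

/-- Contraction with a vector field, `i_X Ξ = Ad^†(Ξ)(Ad X, -, …, -)`. -/
def inner (k : ℕ) : Vec φ →ₗ[ℝ] Form φ (k + 1) →ₗ[ℝ] Form φ k :=
  LinearMap.mk₂ ℝ (fun X Ξ => (Adt φ (k + 1) Ξ).curryLeft (Ad φ X))
    (by intro X Y Ξ; rw [map_add, map_add])
    (by intro c X Ξ; ext x; simp)
    (by intro X Ξ Θ; ext x; simp)
    (by intro c X Ξ; ext x; simp)

/-- The Lie derivative along a vector field, `L_X ∘ Ad^† = i_X ∘ d + d ∘ i_{Ad⁻¹ X}`, on forms of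
positive degree. -/
def lieD (k : ℕ) : Vec φ →ₗ[ℝ] Form φ (k + 1) →ₗ[ℝ] Form φ (k + 1) :=
  LinearMap.mk₂ ℝ
    (fun X Ξ => inner φ (k + 1) X (extD φ (k + 1) ((Adt φ (k + 1)).symm Ξ)) +
      extD φ k (inner φ k ((Ad φ).symm X) ((Adt φ (k + 1)).symm Ξ)))
    (by intro X Y Ξ; simp only [map_add, LinearMap.add_apply]; abel)
    (by intro c X Ξ; simp only [map_smul, LinearMap.smul_apply, smul_add])
    (by intro X Ξ Θ; simp only [map_add]; abel)
    (by intro c X Ξ; simp only [map_smul, smul_add])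

/-! ### Bivectors and the cotangent hom-Lie algebroid -/

/-- Bivectors: the `A`-module `Γ(∧² ψ^! TM) = ∧²_A Γ(ψ^! TM)`. -/
abbrev Bivec : Type _ := ⋀[A]^2 (Vec φ)

/-- `Ξ ↦ Ξ(π, -, …, -)`, determined by
`Ξ(X ∧ Y, x₁, …, x_k) = Ξ(X, Y, x₁, …, x_k)`. -/
def contr (k : ℕ) : Bivec φ →ₗ[A] Form φ (k + 2) →ₗ[A] Form φ k :=
  exteriorPower.alternatingMapLinearEquiv (R := A) (n := 2) (M := Vec φ)
    (N := Form φ (k + 2) →ₗ[A] Form φ k)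
    { toFun := fun v =>
        { toFun := fun Ξ => (Ξ.curryLeft (v 0)).curryLeft (v 1)
          map_add' := fun _ _ => rfl
          map_smul' := fun _ _ => rfl }
      map_update_add' := by
        intro _ v i X Y
        refine LinearMap.ext fun Ξ => ?_
        fin_cases i <;> simp
      map_update_smul' := by
        intro _ v i c X
        refine LinearMap.ext fun Ξ => ?_
        fin_cases i <;> simp
      map_eq_zero_of_eq' := by
        intro v i j hij hne
        have h : v 0 = v 1 := by
          fin_cases i <;> fin_cases j <;> simp_all
        refine LinearMap.ext fun Ξ => ?_
        simp [h] }

/-- Contraction with a bivector, `i_π Ξ = Ad^†(Ξ)(Ad π, -, …, -)`, where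
`Ad (X ∧ Y) = Ad X ∧ Ad Y`; equivalently `i_π = Ad^† ∘ (Ξ ↦ Ξ(π, -, …, -))`. -/
def innerBi (π : Bivec φ) (k : ℕ) : Form φ (k + 2) →ₗ[ℝ] Form φ k :=
  (Adt φ k).toLinearMap ∘ₗ (contr φ k π).restrictScalars ℝ

theorem innerBi_decomposable (k : ℕ) (X Y : Vec φ) (Ξ : Form φ (k + 2)) (x : Fin k → Vec φ) :
    innerBi φ (exteriorPower.ιMulti A 2 ![X, Y]) k Ξ x =
      Adt φ (k + 2) Ξ (Fin.cons (Ad φ X) (Fin.cons (Ad φ Y) x)) := by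
  simp [innerBi, contr]
  congr 1
  ext1 l
  refine Fin.cases ?_ (fun l => ?_) l
  · simp
  · refine Fin.cases ?_ (fun l => ?_) l <;> simp

/-- The pairing `π(Θ)` of a bivector with a `2`-form; `(X ∧ Y)(Θ) = Θ(X, Y)`. -/
def pairing (π : Bivec φ) : Form φ 2 →ₗ[A] A :=
  (exteriorPower.alternatingMapLinearEquiv (R := A) (n := 2) (M := Vec φ) (N := A)).toLinearMap.flip π

theorem pairing_decomposable (X Y : Vec φ) (Θ : Form φ 2) :
    pairing φ (exteriorPower.ιMulti A 2 ![X, Y]) Θ = Θ ![X, Y] := by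
  simp [pairing]

/-- `π^♯(ξ)`, with `(X ∧ Y)^♯(ξ) = ξ(X) Y - ξ(Y) X`, i.e. `⟨η, π^♯(ξ)⟩ = π(ξ ∧ η)`. -/
def sharp (π : Bivec φ) : Form φ 1 →ₗ[A] Vec φ :=
  exteriorPower.alternatingMapLinearEquiv (R := A) (n := 2) (M := Vec φ)
    (N := Form φ 1 →ₗ[A] Vec φ)
    { toFun := fun v =>
        { toFun := fun ξ => ξ (fun _ => v 0) • v 1 - ξ (fun _ => v 1) • v 0
          map_add' := fun ξ η => by simp only [AlternatingMap.add_apply, add_smul]; abel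
          map_smul' := fun c ξ => by
            simp only [AlternatingMap.smul_apply, smul_assoc, smul_sub, RingHom.id_apply] }
      map_update_add' := by
        intro _ v i X Y
        refine LinearMap.ext fun ξ => ?_
        have h0 : ∀ X Z : Vec φ, Function.update (fun _ : Fin 1 => X) 0 Z = fun _ => Z :=
          fun X Z => funext fun j => by rw [Subsingleton.elim j 0]; simp
        have h : ∀ X Y : Vec φ, ξ (fun _ => X + Y) = ξ (fun _ => X) + ξ (fun _ => Y) :=
          fun X Y => by simpa only [h0] using ξ.map_update_add (fun _ => X) 0 X Y
        fin_cases i <;> simp [h, add_smul] <;> abel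
      map_update_smul' := by
        intro _ v i c X
        refine LinearMap.ext fun ξ => ?_
        have h0 : ∀ X Z : Vec φ, Function.update (fun _ : Fin 1 => X) 0 Z = fun _ => Z :=
          fun X Z => funext fun j => by rw [Subsingleton.elim j 0]; simp
        have h : ∀ (c : A) (X : Vec φ), ξ (fun _ => c • X) = c • ξ (fun _ => X) :=
          fun c X => by simpa only [h0] using ξ.map_update_smul (fun _ => X) 0 c X
        fin_cases i <;> simp [h, smul_sub, mul_smul, smul_comm c]
      map_eq_zero_of_eq' := by
        intro v i j hij hne
        have h : v 0 = v 1 := by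
          fin_cases i <;> fin_cases j <;> simp_all
        refine LinearMap.ext fun Ξ => ?_
        simp [h] } π

theorem wedge_one_one (ξ η : Form φ 1) (X Y : Vec φ) :
    wedge 1 1 ξ η ![X, Y] =
      ξ (fun _ => X) * η (fun _ => Y) - ξ (fun _ => Y) * η (fun _ => X) := by
  have h := MultilinearMap.domCoprod_alternization_eq ξ η
  simp only [Fintype.card_fin, Nat.factorial_one, mul_one, one_smul] at h
  have hu : (Finset.univ : Finset (Equiv.Perm (Fin 1 ⊕ Fin 1))) =
      {1, Equiv.swap (Sum.inl 0) (Sum.inr 0)} := by decide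
  have hne : (1 : Equiv.Perm (Fin 1 ⊕ Fin 1)) ≠ Equiv.swap (Sum.inl 0) (Sum.inr 0) := by decide
  change LinearMap.mul' A A (ξ.domCoprod η (![X, Y] ∘ finSumFinEquiv)) = _
  rw [← h, MultilinearMap.alternatization_apply, hu, Finset.sum_pair hne]
  have e1 : (finSumFinEquiv (Sum.inl 0) : Fin (1 + 1)) = 0 := rfl
  have e2 : (finSumFinEquiv (Sum.inr 0) : Fin (1 + 1)) = 1 := rfl
  simp [Units.smul_def, Subsingleton.elim _ (0 : Fin 1), e1, e2, sub_eq_add_neg]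

theorem sharp_spec (π : Bivec φ) (ξ η : Form φ 1) :
    η (fun _ => sharp φ π ξ) = pairing φ π (wedge 1 1 ξ η) := by
  have hs : π ∈ Submodule.span A (Set.range (exteriorPower.ιMulti A 2 (M := Vec φ))) := by
    rw [exteriorPower.ιMulti_span]; trivial
  have hadd : ∀ X Y : Vec φ, η (fun _ => X + Y) = η (fun _ => X) + η (fun _ => Y) := fun X Y => by
    have h0 : ∀ Z : Vec φ, Function.update (fun _ : Fin 1 => X) 0 Z = fun _ => Z :=
      fun Z => funext fun j => by rw [Subsingleton.elim j 0]; simp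
    simpa only [h0] using η.map_update_add (fun _ => X) 0 X Y
  have hsmul : ∀ (c : A) (X : Vec φ), η (fun _ => c • X) = c * η (fun _ => X) := fun c X => by
    have h0 : ∀ Z : Vec φ, Function.update (fun _ : Fin 1 => X) 0 Z = fun _ => Z :=
      fun Z => funext fun j => by rw [Subsingleton.elim j 0]; simp
    simpa only [h0, smul_eq_mul] using η.map_update_smul (fun _ => X) 0 c X
  induction hs using Submodule.span_induction with
  | mem x hx =>
    obtain ⟨v, rfl⟩ := hx
    have hv : v = ![v 0, v 1] := by ext1 i; fin_cases i <;> rfl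
    have h1 : sharp φ (exteriorPower.ιMulti A 2 v) ξ =
        ξ (fun _ => v 0) • v 1 + (-ξ (fun _ => v 1)) • v 0 := by
      simp [sharp, sub_eq_add_neg]
    have h2 := pairing_decomposable φ (v 0) (v 1) (wedge 1 1 ξ η)
    rw [← hv] at h2
    rw [h1, h2, hv, wedge_one_one, hadd, hsmul, hsmul]
    simp
    ring
  | zero => 
    have h1 : sharp φ 0 ξ = (0 : A) • 0 := by simp [sharp]
    rw [h1, hsmul]
    simp [pairing]
  | add x y _ _ hx hy =>
    have h1 : sharp φ (x + y) ξ = sharp φ x ξ + sharp φ y ξ := by simp [sharp]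
    rw [h1, hadd, hx, hy]
    simp [pairing]
  | smul c x _ hx =>
    have h1 : sharp φ (c • x) ξ = c • sharp φ x ξ := by simp [sharp]
    rw [h1, hsmul, hx]
    simp [pairing]

/-- The bracket `{f, g} = π(df, dg)` on functions, where `π(ξ, η) = π(ξ ∧ η)`. -/
def poissonBr (π : Bivec φ) : A →ₗ[ℝ] A →ₗ[ℝ] A :=
  LinearMap.mk₂ ℝ
    (fun f g => pairing φ π (wedge 1 1 (extD φ 0 (fn φ f)) (extD φ 0 (fn φ g))))
    (by intro f g h; simp only [map_add, LinearMap.add_apply])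
    (by intro c f g; simp only [LinearMap.map_smul_of_tower, map_smul, LinearMap.smul_apply])
    (by intro f g h; simp only [map_add])
    (by intro c f g; simp only [LinearMap.map_smul_of_tower, map_smul])

/-- `π` is a hom-Poisson bivector: `(A, {-,-}, φ)` is a hom-Lie algebra.  (The hom-Leibniz rule
`{f, g h} = φ(g) {f, h} + φ(h) {f, g}` holds for every bivector.) -/
def IsHomPoisson (π : Bivec φ) : Prop := IsHomLieAlgebra (poissonBr φ π) φ.toLinearMap

/-- The bracket `[ξ, η]_{π^♯} = L_{π^♯ ξ} η - L_{π^♯ η} ξ - d(π(ξ, η))` on `1`-forms. -/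
def cotBr (π : Bivec φ) : Form φ 1 →ₗ[ℝ] Form φ 1 →ₗ[ℝ] Form φ 1 :=
  LinearMap.mk₂ ℝ
    (fun ξ η => lieD φ 0 (sharp φ π ξ) η - lieD φ 0 (sharp φ π η) ξ -
      extD φ 0 (fn φ (pairing φ π (wedge 1 1 ξ η))))
    (by intro ξ η ζ; simp only [map_add, LinearMap.add_apply]; abel)
    (by intro c ξ η
        simp only [LinearMap.map_smul_of_tower, map_smul, LinearMap.smul_apply, smul_sub])
    (by intro ξ η ζ; simp only [map_add, LinearMap.add_apply]; abel)
    (by intro c ξ η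
        simp only [LinearMap.map_smul_of_tower, map_smul, LinearMap.smul_apply, smul_sub])

/-- The anchor `π^♯ ∘ Ad^†` of the cotangent hom-Lie algebroid. -/
def cotAnchor (π : Bivec φ) : Form φ 1 →ₗ[ℝ] Vec φ :=
  (sharp φ π).restrictScalars ℝ ∘ₗ (Adt φ 1).toLinearMap

/-! ### The graded algebra of forms -/

/-- All forms: `⨁_k Γ(∧^k ψ^! T^*M)`. -/
abbrev Forms : Type _ := ⨁ k, Form φ k

/-- The unit of the algebra of forms. -/
def oneForm : Forms φ := inDeg 0 (fn φ 1)

/-- The wedge product on all forms. -/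
def wedgeF : Forms φ →ₗ[ℝ] Forms φ →ₗ[ℝ] Forms φ :=
  DirectSum.toModule ℝ ℕ _ fun p =>
    (DirectSum.toModule ℝ ℕ _ fun q => 
      (LinearMap.mk₂ ℝ (fun (ξ : Form φ p) (η : Form φ q) =>
          (inDeg (p + q) (wedge p q ξ η) : Forms φ))
        (by intro ξ η ζ; simp only [map_add, LinearMap.add_apply])
        (by intro c ξ η
            simp only [LinearMap.map_smul_of_tower, map_smul, LinearMap.smul_apply])
        (by intro ξ η ζ; simp only [map_add])
        (by intro c ξ η; simp only [LinearMap.map_smul_of_tower, map_smul])).flip).flip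

/-- `Ad^†` on all forms. -/
def AdtF : Forms φ →ₗ[ℝ] Forms φ := DirectSum.lmap fun k => (Adt φ k).toLinearMap

/-- `(Ad^†)⁻¹` on all forms. -/
def AdtInvF : Forms φ →ₗ[ℝ] Forms φ := DirectSum.lmap fun k => (Adt φ k).symm.toLinearMap

/-- `d` on all forms. -/
def extDF : Forms φ →ₗ[ℝ] Forms φ :=
  DirectSum.toModule ℝ ℕ _ fun k => DirectSum.lof ℝ ℕ (Form φ) (k + 1) ∘ₗ extD φ k

/-- `i_π` on all forms (zero on forms of degree `0` and `1`). -/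
def innerF (π : Bivec φ) : Forms φ →ₗ[ℝ] Forms φ :=
  DirectSum.toModule ℝ ℕ _ fun k =>
    match k with
    | 0 => 0
    | 1 => 0
    | k + 2 => DirectSum.lof ℝ ℕ (Form φ) k ∘ₗ innerBi φ π k

/-- The operator
`[i_π, d]_{Ad^†} = Ad^† i_π (Ad^†)⁻¹ d (Ad^†)⁻¹ - Ad^† d (Ad^†)⁻¹ i_π (Ad^†)⁻¹`. -/
def homPoissonOp (π : Bivec φ) : Forms φ →ₗ[ℝ] Forms φ where
  toFun a :=
    AdtF φ (innerF φ π (AdtInvF φ (extDF φ (AdtInvF φ a)))) -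
      AdtF φ (extDF φ (AdtInvF φ (innerF φ π (AdtInvF φ a))))
  map_add' a b := by simp only [map_add]; abel
  map_smul' c a := by simp only [map_smul, smul_sub, RingHom.id_apply]

/-- `br` is a hom-Gerstenhaber bracket on the algebra of forms (with the endomorphism `Ad^†`) which
extends the bracket and the anchor of the cotangent hom-Lie algebroid of `π`. -/
structure IsCotangentGerstenhaber (π : Bivec φ) (br : Forms φ →ₗ[ℝ] Forms φ →ₗ[ℝ] Forms φ) :
    Prop where
  gerstenhaber : IsHomGerstenhaber (oneForm φ) (wedgeF φ) br (AdtF φ)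
  extends_bracket : ∀ ξ η : Form φ 1, br (inDeg 1 ξ) (inDeg 1 η) = inDeg 1 (cotBr φ π ξ η)
  extends_anchor : ∀ (ξ : Form φ 1) (f : A),
    br (inDeg 1 ξ) (inDeg 0 (fn φ f)) = inDeg 0 (fn φ (act (cotAnchor φ π ξ) f))

/-- `D̄(ξ, μ) = [ξ, μ] - π(dξ) Ad^†(μ)` for a `1`-form `ξ` and an `n`-form `μ`, where `[-,-]` is the
extension `br` of the cotangent bracket to all forms. -/
def Dbar (π : Bivec φ) (br : Forms φ →ₗ[ℝ] Forms φ →ₗ[ℝ] Forms φ) (n : ℕ) :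
    Form φ 1 →ₗ[ℝ] Form φ n →ₗ[ℝ] Form φ n :=
  LinearMap.mk₂ ℝ
    (fun ξ μ => br (inDeg 1 ξ) (inDeg n μ) n - pairing φ π (extD φ 1 ξ) • Adt φ n μ)
    (by intro ξ η μ
        simp only [map_add, LinearMap.add_apply, DirectSum.add_apply, add_smul]; abel)
    (by intro c ξ μ
        simp only [LinearMap.map_smul_of_tower, map_smul, LinearMap.smul_apply,
          DirectSum.smul_apply, smul_sub, smul_assoc])
    (by intro ξ μ ν
        simp only [map_add, DirectSum.add_apply, smul_add]; abel)
    (by intro c ξ μ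
        simp only [map_smul, DirectSum.smul_apply, smul_sub]
        rw [smul_comm])

/-! ### Manifolds -/

section Manifold

variable {n : ℕ} {M : Type*} [TopologicalSpace M] [ChartedSpace (EuclideanSpace ℝ (Fin n)) M]

/-- The automorphism `ψ^* : f ↦ f ∘ ψ` of `C^∞(M)` given by a diffeomorphism `ψ : M → M`. -/
def pullback (ψ : M ≃ₘ^∞⟮𝓡 n, 𝓡 n⟯ M) : C^∞⟮𝓡 n, M; ℝ⟯ ≃ₐ[ℝ] C^∞⟮𝓡 n, M; ℝ⟯ :=
  AlgEquiv.ofAlgHom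
    { toFun := fun f => ⟨f ∘ ψ, f.contMDiff.comp ψ.contMDiff⟩
      map_one' := rfl
      map_mul' := fun _ _ => rfl
      map_zero' := rfl
      map_add' := fun _ _ => rfl
      commutes' := fun _ => rfl }
    { toFun := fun f => ⟨f ∘ ψ.symm, f.contMDiff.comp ψ.symm.contMDiff⟩
      map_one' := rfl
      map_mul' := fun _ _ => rfl
      map_zero' := rfl
      map_add' := fun _ _ => rfl
      commutes' := fun _ => rfl }
    (by
      ext f m
      change f (ψ.symm (ψ m)) = f m
      rw [ψ.symm_apply_apply])
    (by
      ext f m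
      change f (ψ (ψ.symm m)) = f m
      rw [ψ.apply_symm_apply])

theorem pullback_apply (ψ : M ≃ₘ^∞⟮𝓡 n, 𝓡 n⟯ M) (f : C^∞⟮𝓡 n, M; ℝ⟯) (m : M) :
    pullback ψ f m = f (ψ m) := rfl

end Manifold

end HomPoisson
end

noncomputable section

namespace HomPoisson

/-! ### Contraction of wedge products -/

section Alternatization

variable {R V N : Type*} [CommRing R] [AddCommGroup V] [Module R V] [AddCommGroup N] [Module R N]

/-! The twisted calculus is the classical Koszul picture of a Poisson structure composed with the
automorphism `Ad^†`. A `φ`-derivation `X` gives the ordinary derivation `X ∘ φ⁻¹` (`der`). In these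
terms `d` is `dF ∘ Ad^†` (`extDF_eq`), `i_π` is `Ad^† ∘ contractBi π` (`innerF_eq`), the Lie
derivative is `Ad^† ∘ lie X` (`lieD_eq`), and `{f, g} = {φ f, φ g}₀` for the untwisted bracket `{f,
g}₀ = π^♯(df)[g]` (`poissonBr_eq`). As `φ` is bijective, the hom-Lie axioms say that `φ` preserves
`{-,-}₀` and that `{-,-}₀` satisfies the ordinary Jacobi identity.

On the untwisted side let `Δ = [i_π, d]` (`koszul`), and let `koszulBr` be its failure to be a
derivation. For `π = X ∧ Y` one has `Δ = i_Y L_X - L_Y i_X`, from which the Leibniz rule of the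
bracket can be read off (`koszulBr_mul`). The operator `[Δ, i_π]` is linear over functions,
anticommutes with contractions and lowers degrees by three, so it is determined by its values on `df
∧ dg ∧ dh`; there it is twice a Jacobiator up to sign, hence zero (`koszul_contractBi`). Since `Δ`
also anticommutes with `d`, it follows that `Δ² = -Δ²`, so `Δ² = 0` (`koszul_koszul`). The
Batalin-Vilkovisky argument concludes: `Δ² = 0` makes `Δ` a derivation of its bracket, and applying
`Δ` to the Leibniz rule gives the graded Jacobi identity (`koszulBr_jacobi`). The same testing
argument in degree two shows that `Ad^†` commutes with `i_π` (`AdtF_contractBi`), hence with `Δ` and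
the bracket; applying `Ad^†` to the untwisted identities produces the hom-identities.

Uniqueness of the bracket, and of the generator belonging to `D̄`, holds because the differences in
question are twisted derivations, which vanish once they vanish on functions and `1`-forms
(`HasLocalFrames.derivation_eq_zero`). In top degree `ξ ∧ μ = 0`, so `D̄(ξ, μ) = -Ad^†(ξ ∧ Δμ)`,
which is semilinear in `ξ`; flatness comes from the Jacobi identity (`koszulConn_koszulBr`).

The manifold enters only through `HasLocalFrames`: cut-off coordinates `xᵢ` and fields `eᵢ` with `χ
X = ∑ X(xᵢ) eᵢ`, obtained from Hadamard's lemma. Euler's identity then makes `χ^k Ξ` a combination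
of products of exact `1`-forms. The general rules of exterior and Cartan calculus are proved by
contraction (`eq_zero_of_closed`): a family of forms that vanishes in degree zero and is stable
under contraction vanishes. -/

theorem alternatization_eq_alternatizeUncurryFin {n : ℕ}
    (m : MultilinearMap R (fun _ : Fin (n + 1) => V) N) (F : V →ₗ[R] V [⋀^Fin n]→ₗ[R] N)
    (hF : ∀ Y, F Y = MultilinearMap.alternatization (m.curryLeft Y)) :
    MultilinearMap.alternatization m = AlternatingMap.alternatizeUncurryFin F := by
  ext v
  -- Permutations are sorted by the image `i` of `0`; the permutations of the remaining `n` indices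
  -- are absorbed into `F (v i)`.
  rw [MultilinearMap.alternatization_apply, AlternatingMap.alternatizeUncurryFin_apply,
    ← Equiv.Perm.decomposeFin.symm.sum_comp, Fintype.sum_prod_type]
  refine Finset.sum_congr rfl fun i _ => ?_
  have key : F (v i) (i.removeNth v) = ∑ e : Equiv.Perm (Fin n),
      Equiv.Perm.sign e • m (Fin.cons (v i) (i.removeNth v ∘ e)) := by
    rw [hF, MultilinearMap.alternatization_apply]
    rfl
  rw [key, Finset.smul_sum]
  refine Fin.cases ?_ (fun i => ?_) i
  · refine Finset.sum_congr rfl fun e _ => ?_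
    simp only [Equiv.Perm.decomposeFin.symm_sign, MultilinearMap.domDomCongr_apply]
    simp
    congr 2
    ext1 l
    refine Fin.cases ?_ (fun l => ?_) l
    · simp
    · simp [Fin.tail]
  -- `decomposeFin` brings the chosen index to the front by a transposition, whereas `removeNth`
  -- keeps the others in increasing order. The two orderings differ by the cycle `i.cycleRange`, of
  -- sign `(-1)^i`.
  · rw [← Equiv.sum_comp (Equiv.mulLeft i.cycleRange) (fun e => (-1 : ℤ) ^ (i.succ : ℕ) •
      Equiv.Perm.sign e • m (Fin.cons (v i.succ) (i.succ.removeNth v ∘ e)))]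
    refine Finset.sum_congr rfl fun e _ => ?_
    have hv : (fun l => v ((Equiv.Perm.decomposeFin.symm (i.succ, e)) l)) =
        Fin.cons (v i.succ) (i.succ.removeNth v ∘ (Equiv.mulLeft i.cycleRange e)) := by
      ext1 l
      refine Fin.cases ?_ (fun l => ?_) l
      · simp
      · simp [Fin.removeNth, Fin.succAbove_cycleRange]
    simp only [Equiv.Perm.decomposeFin.symm_sign, MultilinearMap.domDomCongr_apply, hv]
    simp [Fin.sign_cycleRange, Units.smul_def, smul_smul, pow_succ, ← mul_assoc, ← mul_pow]

end Alternatization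

variable {A : Type*} [CommRing A] [Algebra ℝ A] {φ : A ≃ₐ[ℝ] A}

/-- The multilinear map `x ↦ ξ(x₁, …, x_p) η(x_{p+1}, …, x_n)`, `n = p + q`. -/
def prodForm {p q n : ℕ} (h : p + q = n) (ξ : Form φ p) (η : Form φ q) :
    MultilinearMap A (fun _ : Fin n => Vec φ) A :=
  (LinearMap.mul' A A).compMultilinearMap
    ((MultilinearMap.domCoprod (ξ : MultilinearMap A (fun _ : Fin p => Vec φ) A)
      (η : MultilinearMap A (fun _ : Fin q => Vec φ) A)).domDomCongr
        (finSumFinEquiv.trans (finCongr h)))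

theorem prodForm_apply {p q n : ℕ} (h : p + q = n) (ξ : Form φ p) (η : Form φ q)
    (x : Fin n → Vec φ) :
    prodForm h ξ η x = ξ (fun i => x (Fin.cast h (Fin.castAdd q i))) *
      η (fun i => x (Fin.cast h (Fin.natAdd p i))) := rfl

/-- The full alternatization runs over all permutations and so meets each shuffle `p! q!` times. -/
theorem alternatization_prodForm {p q : ℕ} (ξ : Form φ p) (η : Form φ q) :
    MultilinearMap.alternatization (prodForm rfl ξ η) =
      (p.factorial * q.factorial) • wedge p q ξ η := by
  have h := MultilinearMap.domCoprod_alternization_eq ξ η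
  simp only [Fintype.card_fin] at h
  ext x
  have h2 := congrArg (fun m => LinearMap.mul' A A (m (x ∘ finSumFinEquiv))) h
  simp only [AlternatingMap.smul_apply, map_nsmul] at h2
  refine Eq.trans ?_ h2
  rw [MultilinearMap.alternatization_apply, MultilinearMap.alternatization_apply, map_sum,
    ← (Equiv.permCongr finSumFinEquiv).sum_comp]
  refine Finset.sum_congr rfl fun σ _ => ?_
  rw [Equiv.Perm.sign_permCongr]
  simp only [Units.smul_def, map_zsmul]
  congr 1
  simp [prodForm, MultilinearMap.domDomCongr_apply]

/-- The wedge product with a prescribed name for the total degree. -/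
def wedgeN {p q n : ℕ} (h : p + q = n) (ξ : Form φ p) (η : Form φ q) : Form φ n :=
  (p.factorial * q.factorial : ℝ)⁻¹ • MultilinearMap.alternatization (prodForm h ξ η)

theorem wedgeN_rfl {p q : ℕ} (ξ : Form φ p) (η : Form φ q) :
    wedgeN rfl ξ η = wedge p q ξ η := by
  have h : (p.factorial * q.factorial : ℝ) ≠ 0 := by positivity
  rw [wedgeN, alternatization_prodForm, ← Nat.cast_smul_eq_nsmul ℝ, smul_smul]
  push_cast
  rw [inv_mul_cancel₀ h, one_smul]

theorem alternatization_coe_form {k : ℕ} (Ξ : Form φ k) :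
    MultilinearMap.alternatization (Ξ : MultilinearMap A (fun _ : Fin k => Vec φ) A) =
      k.factorial • Ξ := by
  rw [AlternatingMap.coe_alternatization, Fintype.card_fin]

theorem wedgeN_zero_left {q : ℕ} (h : 0 + q = q) (ξ : Form φ 0) (η : Form φ q) :
    wedgeN h ξ η = ξ ![] • η := by
  have h1 : prodForm h ξ η =
      ((ξ ![] • η : Form φ q) : MultilinearMap A (fun _ : Fin q => Vec φ) A) := by
    ext x
    rw [prodForm_apply]
    refine congrArg₂ (· * ·) (congrArg ξ (Subsingleton.elim _ _)) (congrArg η ?_)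
    ext1 i
    congr 1
    ext
    simp
  have h2 : (q.factorial : ℝ) ≠ 0 := by positivity
  rw [wedgeN, h1, alternatization_coe_form, ← Nat.cast_smul_eq_nsmul ℝ, smul_smul]
  simp [inv_mul_cancel₀ h2]

theorem wedgeN_zero_right {p : ℕ} (h : p + 0 = p) (ξ : Form φ p) (η : Form φ 0) :
    wedgeN h ξ η = η ![] • ξ := by
  have h1 : prodForm h ξ η =
      ((η ![] • ξ : Form φ p) : MultilinearMap A (fun _ : Fin p => Vec φ) A) := by
    ext x
    rw [prodForm_apply, mul_comm]
    refine congrArg₂ (· * ·) (congrArg η (Subsingleton.elim _ _)) (congrArg ξ ?_)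
    ext1 i
    congr 1
  have h2 : (p.factorial : ℝ) ≠ 0 := by positivity
  rw [wedgeN, h1, alternatization_coe_form, ← Nat.cast_smul_eq_nsmul ℝ, smul_smul]
  simp [inv_mul_cancel₀ h2]

theorem prodForm_curryLeft {p q n : ℕ} (h : p + 1 + q = n + 1) (h' : p + q = n)
    (ξ : Form φ (p + 1)) (η : Form φ q) (Y : Vec φ) :
    (prodForm h ξ η).curryLeft Y = prodForm h' (ξ.curryLeft Y) η := by
  ext x
  rw [MultilinearMap.curryLeft_apply, prodForm_apply, prodForm_apply,
    AlternatingMap.curryLeft_apply_apply]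
  refine congrArg₂ (· * ·) (congrArg ξ ?_) (congrArg η ?_)
  · ext1 i
    refine Fin.cases rfl (fun i => ?_) i
    have : Fin.cast h (Fin.castAdd q i.succ) = (Fin.cast h' (Fin.castAdd q i)).succ := by
      ext; simp
    rw [this]
    simp
  · ext1 i
    have : Fin.cast h (Fin.natAdd (p + 1) i) = (Fin.cast h' (Fin.natAdd p i)).succ := by
      ext; simp; omega
    rw [this]
    simp

/-- The first argument of the product always goes into `ξ`, so splitting the alternatization along
it leaves a product with `ξ` contracted. The factor `p + 1` is the quotient of `(p + 1)!` by `p!` in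
the two normalizations. -/
theorem wedgeN_apply_eq_sum {p q n : ℕ} (h : p + 1 + q = n + 1) (h' : p + q = n)
    (ξ : Form φ (p + 1)) (η : Form φ q) (x : Fin (n + 1) → Vec φ) :
    ((p + 1 : ℕ) : A) * wedgeN h ξ η x =
      ∑ i : Fin (n + 1), (-1 : A) ^ i.val * wedgeN h' (ξ.curryLeft (x i)) η (i.removeNth x) := by
  subst h'
  have h1 := alternatization_eq_alternatizeUncurryFin (prodForm h ξ η)
    ((p.factorial * q.factorial) • ((wedge p q).flip η ∘ₗ ξ.curryLeft)) (by
      intro Y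
      rw [prodForm_curryLeft h rfl, alternatization_prodForm]
      rfl)
  rw [AlternatingMap.alternatizeUncurryFin_smul] at h1
  have h2 : ((p + 1).factorial * q.factorial : ℝ)⁻¹ =
      (p.factorial * q.factorial : ℝ)⁻¹ * (p + 1 : ℝ)⁻¹ := by
    rw [Nat.factorial_succ]; push_cast; rw [← mul_inv]; ring
  have h3 : (p.factorial * q.factorial : ℝ) ≠ 0 := by positivity
  have h4 : (p + 1 : ℝ) ≠ 0 := by positivity
  have h5 : ((p + 1 : ℕ) : ℝ) • wedgeN h ξ η =
      AlternatingMap.alternatizeUncurryFin ((wedge p q).flip η ∘ₗ ξ.curryLeft) := by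
    rw [wedgeN, h1, h2, ← Nat.cast_smul_eq_nsmul ℝ, smul_smul, smul_smul]
    push_cast
    rw [show (p + 1 : ℝ) * ((p.factorial * q.factorial : ℝ)⁻¹ * (p + 1 : ℝ)⁻¹) *
      (p.factorial * q.factorial) = 1 by field_simp, one_smul]
  have h6 := congrArg (fun m : Form φ (p + q + 1) => m x) h5
  simp only [AlternatingMap.smul_apply, AlternatingMap.alternatizeUncurryFin_apply] at h6
  rw [Algebra.smul_def, map_natCast] at h6
  rw [h6]
  refine Finset.sum_congr rfl fun i _ => ?_
  rw [wedgeN_rfl]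
  simp

theorem wedgeN_curryLeft_zero {q n : ℕ} (h : 0 + (q + 1) = n + 1) (h' : 0 + q = n)
    (ξ : Form φ 0) (η : Form φ (q + 1)) (X : Vec φ) :
    (wedgeN h ξ η).curryLeft X = wedgeN h' ξ (η.curryLeft X) := by
  obtain rfl : q = n := by omega
  rw [wedgeN_zero_left, wedgeN_zero_left]
  rfl

theorem neg_curryLeft_curryLeft {k : ℕ} (ξ : Form φ (k + 2)) (X Y : Vec φ) :
    (ξ.curryLeft X).curryLeft Y = -(ξ.curryLeft Y).curryLeft X := by
  have h := AlternatingMap.curryLeft_same ξ (X + Y)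
  simp only [map_add, AlternatingMap.curryLeft_add, LinearMap.add_apply,
    AlternatingMap.curryLeft_same] at h
  rw [eq_neg_iff_add_eq_zero]
  simpa [add_comm] using h

theorem wedgeN_neg_left {p q n : ℕ} (h : p + q = n) (ξ : Form φ p) (η : Form φ q) :
    wedgeN h (-ξ) η = -wedgeN h ξ η := by
  subst h; simp [wedgeN_rfl]

theorem wedgeN_smul_left {p q n : ℕ} (h : p + q = n) (c : A) (ξ : Form φ p) (η : Form φ q) :
    wedgeN h (c • ξ) η = c • wedgeN h ξ η := by
  subst h; simp [wedgeN_rfl]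

/-- Induction on the degree of the first factor, comparing the expansions given by
`wedgeN_apply_eq_sum`. With `X` as first argument, the term of index `0` supplies one copy of the
first summand; in the others `X` is contracted by the induction hypothesis, and moving it past `x i`
inside `ξ` costs a sign. -/
theorem wedgeN_curryLeft {p q n : ℕ} (h : p + 1 + (q + 1) = n + 2) (h₁ : p + (q + 1) = n + 1)
    (h₂ : p + 1 + q = n + 1) (ξ : Form φ (p + 1)) (η : Form φ (q + 1)) (X : Vec φ) :
    (wedgeN h ξ η).curryLeft X = wedgeN h₁ (ξ.curryLeft X) η +
      (-1 : A) ^ (p + 1) • wedgeN h₂ ξ (η.curryLeft X) := by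
  -- The expansion determines the value only up to a positive integer factor, which is invertible
  -- because `A` is an `ℝ`-algebra.
  have hinv : ∀ (m : ℕ) (a b : A), ((m + 1 : ℕ) : A) * a = ((m + 1 : ℕ) : A) * b → a = b := by
    intro m a b hab
    have h0 : (algebraMap ℝ A ((m + 1 : ℕ) : ℝ)⁻¹) * ((m + 1 : ℕ) : A) = 1 := by
      rw [← map_natCast (algebraMap ℝ A), ← map_mul, inv_mul_cancel₀ (by positivity), map_one]
    calc a = (algebraMap ℝ A ((m + 1 : ℕ) : ℝ)⁻¹) * (((m + 1 : ℕ) : A) * a) := by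
          rw [← mul_assoc, h0, one_mul]
      _ = b := by rw [hab, ← mul_assoc, h0, one_mul]
  induction p generalizing n with
  | zero =>
    ext x
    apply hinv 0
    rw [AlternatingMap.curryLeft_apply_apply, wedgeN_apply_eq_sum h h₁, Fin.sum_univ_succ]
    have h3 : ∀ i : Fin (n + 1), wedgeN h₁ (ξ.curryLeft (x i)) η
        (i.succ.removeNth (Matrix.vecCons X x)) =
        wedgeN (by omega : 0 + q = n) (ξ.curryLeft (x i)) (η.curryLeft X) (i.removeNth x) := by
      intro i
      rw [show i.succ.removeNth (Matrix.vecCons X x) = Matrix.vecCons X (i.removeNth x) from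
        removeNth_succ_cons i X x, ← AlternatingMap.curryLeft_apply_apply,
        wedgeN_curryLeft_zero]
    have h4 := wedgeN_apply_eq_sum h₂ (by omega : 0 + q = n) ξ (η.curryLeft X) x
    simp only [Matrix.cons_val_succ, h3, Matrix.cons_val_zero]
    rw [show (0 : Fin (n + 2)).removeNth (Matrix.vecCons X x) = x from removeNth_zero_cons X x]
    simp only [AlternatingMap.add_apply, AlternatingMap.smul_apply, smul_eq_mul]
    simp only [Fin.val_succ, pow_succ, mul_neg_one, neg_mul, Finset.sum_neg_distrib, ← h4]
    simp
  | succ p ih =>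
    obtain ⟨n, rfl⟩ : ∃ k, n = k + 1 := ⟨p + q, by omega⟩
    ext x
    apply hinv (p + 1)
    rw [AlternatingMap.curryLeft_apply_apply, wedgeN_apply_eq_sum h h₁, Fin.sum_univ_succ]
    have h3 : ∀ i : Fin (n + 2), wedgeN h₁ (ξ.curryLeft (x i)) η
        (i.succ.removeNth (Matrix.vecCons X x)) =
        -wedgeN (by omega : p + (q + 1) = n + 1) ((ξ.curryLeft X).curryLeft (x i)) η
          (i.removeNth x) +
        (-1 : A) ^ (p + 1) * wedgeN (by omega : p + 1 + q = n + 1) (ξ.curryLeft (x i))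
          (η.curryLeft X) (i.removeNth x) := by
      intro i
      rw [show i.succ.removeNth (Matrix.vecCons X x) = Matrix.vecCons X (i.removeNth x) from
        removeNth_succ_cons i X x, ← AlternatingMap.curryLeft_apply_apply,
        ih h₁ (by omega) (by omega), neg_curryLeft_curryLeft, wedgeN_neg_left]
      rfl
    have h4 := wedgeN_apply_eq_sum h₂ (by omega : p + 1 + q = n + 1) ξ (η.curryLeft X) x
    have h5 := wedgeN_apply_eq_sum h₁ (by omega : p + (q + 1) = n + 1) (ξ.curryLeft X) η x
    simp only [Matrix.cons_val_succ, h3, Matrix.cons_val_zero]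
    rw [show (0 : Fin (n + 3)).removeNth (Matrix.vecCons X x) = x from removeNth_zero_cons X x]
    simp only [AlternatingMap.add_apply, AlternatingMap.smul_apply, smul_eq_mul]
    have h6 : ∀ f g : Fin (n + 2) → A, ∑ i : Fin (n + 2), (-1 : A) ^ (i.succ : ℕ) *
        (-f i + (-1) ^ (p + 1) * g i) = (∑ i : Fin (n + 2), (-1 : A) ^ i.val * f i) +
          (-1) ^ (p + 2) * ∑ i : Fin (n + 2), (-1 : A) ^ i.val * g i := by
      intro f g
      rw [Finset.mul_sum, ← Finset.sum_add_distrib]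
      refine Finset.sum_congr rfl fun i _ => ?_
      rw [Fin.val_succ]
      ring
    rw [h6, ← h4, ← h5]
    push_cast
    simp
    ring

/-! ### The algebra of forms -/

section FormAlgebra

variable {A : Type*} [CommRing A] [Algebra ℝ A] {φ : A ≃ₐ[ℝ] A}

scoped instance : IsScalarTower ℝ A (Forms φ) :=
  ⟨fun r a x => by
    refine DFinsupp.ext fun k => ?_
    exact smul_assoc r a (x k)⟩

theorem smul_inDeg (f : A) (k : ℕ) (Ξ : Form φ k) :
    f • (inDeg k Ξ : Forms φ) = inDeg k (f • Ξ) :=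
  ((DirectSum.lof A ℕ (Form φ) k).map_smul f Ξ).symm

theorem forms_induction {P : Forms φ → Prop} (a : Forms φ) (zero : P 0)
    (hdeg : ∀ k (Ξ : Form φ k), P (inDeg k Ξ)) (add : ∀ a b, P a → P b → P (a + b)) : P a :=
  DirectSum.induction_on a zero hdeg add

theorem inDeg_apply_self (k : ℕ) (Ξ : Form φ k) : (inDeg k Ξ : Forms φ) k = Ξ :=
  DirectSum.lof_apply ℝ k Ξ

theorem inDeg_apply_ne {k l : ℕ} (h : l ≠ k) (Ξ : Form φ k) : (inDeg k Ξ : Forms φ) l = 0 :=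
  DirectSum.of_eq_of_ne _ _ _ h

/-- The value of the component of degree `0` of a form. -/
def value : Forms φ →ₗ[A] A where
  toFun a := a 0 ![]
  map_add' _ _ := rfl
  map_smul' _ _ := rfl

/-- Contraction `Ξ ↦ Ξ(X, -, …, -)` on all forms. -/
def contract (X : Vec φ) : Forms φ →ₗ[A] Forms φ :=
  DirectSum.toModule A ℕ _ fun k =>
    match k with
    | 0 => 0
    | k + 1 => DirectSum.lof A ℕ (Form φ) k ∘ₗ (AlternatingMap.curryLeftLinearMap).flip X

@[simp] theorem contract_inDeg_zero (X : Vec φ) (Ξ : Form φ 0) : contract X (inDeg 0 Ξ) = 0 :=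
  DirectSum.toModule_lof A 0 Ξ

@[simp] theorem contract_inDeg_succ (X : Vec φ) (k : ℕ) (Ξ : Form φ (k + 1)) :
    contract X (inDeg (k + 1) Ξ) = inDeg k (Ξ.curryLeft X) :=
  DirectSum.toModule_lof A (k + 1) Ξ

theorem contract_apply (X : Vec φ) (a : Forms φ) (k : ℕ) :
    contract X a k = (a (k + 1)).curryLeft X := by
  induction a using forms_induction with
  | zero => simp
  | add a b ha hb => rw [map_add, DirectSum.add_apply, ha, hb]; rfl
  | hdeg l Ξ =>
    rcases l with _ | l
    · rw [contract_inDeg_zero, inDeg_apply_ne (by omega)]; rfl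
    · rw [contract_inDeg_succ]
      by_cases h : k = l
      · subst h; rw [inDeg_apply_self, inDeg_apply_self]
      · rw [inDeg_apply_ne h, inDeg_apply_ne (by omega)]; rfl

theorem contract_add (X Y : Vec φ) (a : Forms φ) :
    contract (X + Y) a = contract X a + contract Y a := by
  refine DFinsupp.ext fun k => ?_
  rw [DirectSum.add_apply, contract_apply, contract_apply, contract_apply, map_add]

theorem contract_smul (f : A) (X : Vec φ) (a : Forms φ) :
    contract (f • X) a = f • contract X a := by
  refine DFinsupp.ext fun k => ?_
  rw [contract_apply, map_smul, ← contract_apply]; rfl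

theorem contract_anticomm (X Y : Vec φ) (a : Forms φ) :
    contract X (contract Y a) = -contract Y (contract X a) := by
  refine DFinsupp.ext fun k => ?_
  rw [contract_apply, contract_apply, neg_curryLeft_curryLeft, ← contract_apply, ← contract_apply]
  rfl

/-- Iterated contraction. -/
def contractList : List (Vec φ) → Forms φ → Forms φ
  | [], a => a
  | X :: l, a => contractList l (contract X a)

/-- Each value `Ξ(x₁, …, x_k)` is the degree-zero value of an iterated contraction, so these numbers
see the whole form. -/
theorem eq_zero_of_contractList (a : Forms φ) (h : ∀ l, value (contractList l a) = 0) : a = 0 := by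
  refine DFinsupp.ext fun k => ?_
  induction k generalizing a with
  | zero =>
    ext x
    have := h []
    rw [Subsingleton.elim x ![]]
    exact this
  | succ k ih =>
    ext x
    have h1 := ih (contract (x 0) a) fun l => h (x 0 :: l)
    rw [contract_apply] at h1
    have h2 : x = Matrix.vecCons (x 0) (fun i => x i.succ) := (Fin.cons_self_tail x).symm
    rw [h2, ← AlternatingMap.curryLeft_apply_apply, h1]
    rfl

theorem eq_of_value_of_contract {a b : Forms φ} (h0 : value a = value b)
    (h : ∀ X, contract X a = contract X b) : a = b := by
  rw [← sub_eq_zero]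
  refine eq_zero_of_contractList _ fun l => ?_
  rcases l with _ | ⟨X, l⟩
  · simp [contractList, h0]
  · have h1 : contract X (a - b) = 0 := by rw [map_sub, h X, sub_self]
    have h2 : ∀ l : List (Vec φ), contractList l (0 : Forms φ) = 0 := by
      intro l
      induction l with
      | nil => rfl
      | cons X l ih => rw [contractList, map_zero, ih]
    rw [contractList, h1, h2, map_zero]

theorem contractList_add (l : List (Vec φ)) (a b : Forms φ) :
    contractList l (a + b) = contractList l a + contractList l b := by
  induction l generalizing a b with
  | nil => rfl
  | cons X l ih => rw [contractList, map_add, ih]; rfl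

theorem contractList_neg (l : List (Vec φ)) (a : Forms φ) :
    contractList l (-a) = -contractList l a := by
  induction l generalizing a with
  | nil => rfl
  | cons X l ih => rw [contractList, map_neg, ih]; rfl

/-- A set of forms of value zero that is closed under contraction up to sums is zero. -/
theorem eq_zero_of_closed (T : Set (Forms φ)) (h0 : ∀ a ∈ T, value a = 0)
    (h : ∀ a ∈ T, ∀ X, contract X a ∈ AddSubgroup.closure T) {a : Forms φ} (ha : a ∈ T) :
    a = 0 := by
  refine eq_zero_of_contractList _ fun l => ?_
  -- Contracting a member of `T` yields only a sum of members, so the induction on the list of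
  -- vectors has to run over the generated subgroup.
  have key : ∀ b ∈ AddSubgroup.closure T, value (contractList l b) = 0 := by
    induction l with
    | nil =>
      intro b hb
      induction hb using AddSubgroup.closure_induction with
      | mem x hx => exact h0 x hx
      | zero => exact map_zero _
      | add x y _ _ hx hy => rw [contractList_add, map_add, hx, hy, add_zero]
      | neg x _ hx => rw [contractList_neg, map_neg, hx, neg_zero]
    | cons X l ih =>
      intro b hb
      refine ih _ ?_
      induction hb using AddSubgroup.closure_induction with
      | mem x hx => exact h x hx X
      | zero => rw [map_zero]; exact zero_mem _
      | add x y _ _ hx hy => rw [map_add]; exact add_mem hx hy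
      | neg x _ hx => rw [map_neg]; exact neg_mem hx
  exact key a (AddSubgroup.subset_closure ha)

/-- The involution `Ξ ↦ (-1)^k Ξ` on `k`-forms. -/
def parity : Forms φ →ₗ[A] Forms φ :=
  DirectSum.lmap fun k => ((-1 : A) ^ k) • LinearMap.id

@[simp] theorem parity_inDeg (k : ℕ) (Ξ : Form φ k) :
    parity (inDeg k Ξ : Forms φ) = (-1 : A) ^ k • inDeg k Ξ := by
  rw [smul_inDeg]
  exact DirectSum.lmap_lof ..

theorem contract_parity (X : Vec φ) (a : Forms φ) :
    contract X (parity a) = -parity (contract X a) := by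
  induction a using forms_induction with
  | zero => simp
  | add a b ha hb => simp only [map_add, ha, hb]; abel
  | hdeg k Ξ =>
    rcases k with _ | k
    · simp
    · simp [pow_succ]

@[simp] theorem parity_parity (a : Forms φ) : parity (parity a) = a := by
  induction a using forms_induction with
  | zero => simp
  | add a b ha hb => simp only [map_add, ha, hb]
  | hdeg k Ξ => rw [parity_inDeg, map_smul, parity_inDeg, smul_smul, ← mul_pow]; simp

@[simp] theorem value_parity (a : Forms φ) : value (parity a) = value a := by
  induction a using forms_induction with
  | zero => simp
  | add a b ha hb => simp only [map_add, ha, hb]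
  | hdeg k Ξ =>
    rcases k with _ | k
    · simp
    · have : value (inDeg (k + 1) Ξ : Forms φ) = 0 := by
        change (inDeg (k + 1) Ξ : Forms φ) 0 ![] = 0
        rw [inDeg_apply_ne (by omega)]; rfl
      rw [parity_inDeg, map_smul, this, smul_zero]

@[simp] theorem value_inDeg_zero (Ξ : Form φ 0) : value (inDeg 0 Ξ : Forms φ) = Ξ ![] := by
  change (inDeg 0 Ξ : Forms φ) 0 ![] = _
  rw [inDeg_apply_self]

@[simp] theorem value_inDeg_succ (k : ℕ) (Ξ : Form φ (k + 1)) :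
    value (inDeg (k + 1) Ξ : Forms φ) = 0 := by
  change (inDeg (k + 1) Ξ : Forms φ) 0 ![] = 0
  rw [inDeg_apply_ne (by omega)]; rfl

theorem wedgeF_inDeg {p q : ℕ} (ξ : Form φ p) (η : Form φ q) :
    wedgeF φ (inDeg p ξ) (inDeg q η) = inDeg (p + q) (wedge p q ξ η) := by
  simp [wedgeF, DirectSum.toModule_lof]

theorem wedgeF_inDeg_eq {p q n : ℕ} (h : p + q = n) (ξ : Form φ p) (η : Form φ q) :
    wedgeF φ (inDeg p ξ) (inDeg q η) = inDeg n (wedgeN h ξ η) := by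
  subst h; rw [wedgeN_rfl, wedgeF_inDeg]

theorem value_wedgeF (a b : Forms φ) : value (wedgeF φ a b) = value a * value b := by
  induction a using forms_induction with
  | zero => simp
  | add a a' ha hb => simp only [map_add, LinearMap.add_apply, ha, hb, add_mul]
  | hdeg p ξ =>
    induction b using forms_induction with
    | zero => simp
    | add a b ha hb => simp only [map_add, ha, hb, mul_add]
    | hdeg q η =>
      rcases p with _ | p <;> rcases q with _ | q
      · rw [wedgeF_inDeg_eq rfl, wedgeN_zero_left]; simp
      · rw [wedgeF_inDeg_eq (by omega : 0 + (q + 1) = q + 1)]; simp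
      · rw [wedgeF_inDeg_eq rfl]; simp
      · rw [wedgeF_inDeg_eq (by omega : p + 1 + (q + 1) = p + q + 1 + 1)]; simp

theorem contract_wedgeF (X : Vec φ) (a b : Forms φ) :
    contract X (wedgeF φ a b) =
      wedgeF φ (contract X a) b + wedgeF φ (parity a) (contract X b) := by
  induction a using forms_induction with
  | zero => simp
  | add a a' ha hb => simp only [map_add, LinearMap.add_apply, ha, hb]; abel
  | hdeg p ξ =>
    induction b using forms_induction with
    | zero => simp
    | add a b ha hb => simp only [map_add, ha, hb]; abel
    | hdeg q η =>
      have hs : parity (inDeg p ξ : Forms φ) = inDeg p ((-1 : A) ^ p • ξ) := by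
        rw [parity_inDeg, smul_inDeg]
      rw [hs]
      rcases p with _ | p <;> rcases q with _ | q
      · rw [wedgeF_inDeg_eq rfl]; simp
      · rw [wedgeF_inDeg_eq (by omega : 0 + (q + 1) = q + 1)]
        simp only [contract_inDeg_succ, contract_inDeg_zero, map_zero, LinearMap.zero_apply]
        rw [wedgeF_inDeg_eq (by omega : 0 + q = q), wedgeN_curryLeft_zero _ (zero_add q)]
        simp
      · rw [wedgeF_inDeg_eq rfl, wedgeN_zero_right]
        simp only [contract_inDeg_succ, contract_inDeg_zero, map_zero]
        rw [wedgeF_inDeg_eq rfl, wedgeN_zero_right]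
        simp
      · rw [wedgeF_inDeg_eq (by omega : p + 1 + (q + 1) = p + q + 2)]
        simp only [contract_inDeg_succ]
        rw [wedgeF_inDeg_eq (by omega : p + (q + 1) = p + q + 1),
          wedgeF_inDeg_eq (by omega : p + 1 + q = p + q + 1),
          wedgeN_curryLeft (n := p + q) _ (by omega) (by omega), wedgeN_smul_left]
        exact (DirectSum.lof ℝ ℕ (Form φ) _).map_add _ _

/-! The ring structure on forms. -/

theorem wedgeF_smul_left (f : A) (a b : Forms φ) : wedgeF φ (f • a) b = f • wedgeF φ a b := by
  induction a using forms_induction with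
  | zero => simp
  | add a a' ha hb => simp only [map_add, LinearMap.add_apply, ha, hb, smul_add]
  | hdeg p ξ =>
    induction b using forms_induction with
    | zero => simp
    | add a b ha hb => simp only [map_add, ha, hb, smul_add]
    | hdeg q η => rw [smul_inDeg, wedgeF_inDeg, wedgeF_inDeg, smul_inDeg, map_smul]; rfl

theorem wedgeF_smul_right (f : A) (a b : Forms φ) : wedgeF φ a (f • b) = f • wedgeF φ a b := by
  induction a using forms_induction with
  | zero => simp
  | add a a' ha hb => simp only [map_add, LinearMap.add_apply, ha, hb, smul_add]
  | hdeg p ξ =>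
    induction b using forms_induction with
    | zero => simp
    | add a b ha hb => simp only [map_add, ha, hb, smul_add]
    | hdeg q η => rw [smul_inDeg, wedgeF_inDeg, wedgeF_inDeg, smul_inDeg, map_smul]

theorem parity_wedgeF (a b : Forms φ) :
    parity (wedgeF φ a b) = wedgeF φ (parity a) (parity b) := by
  induction a using forms_induction with
  | zero => simp
  | add a a' ha hb => simp only [map_add, LinearMap.add_apply, ha, hb]
  | hdeg p ξ =>
    induction b using forms_induction with
    | zero => simp
    | add a b ha hb => simp only [map_add, ha, hb]
    | hdeg q η =>
      rw [parity_inDeg, parity_inDeg, wedgeF_smul_left, wedgeF_smul_right, wedgeF_inDeg,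
        parity_inDeg, smul_smul, pow_add]

/-- By the antiderivation rule, the contraction of an associator is a sum of three associators, and
in degree zero associativity is that of `A`. The later identities proved with `eq_zero_of_closed`
follow this pattern. -/
theorem wedgeF_assoc (a b c : Forms φ) :
    wedgeF φ (wedgeF φ a b) c = wedgeF φ a (wedgeF φ b c) := by
  rw [← sub_eq_zero]
  refine eq_zero_of_closed {x | ∃ a b c : Forms φ,
    x = wedgeF φ (wedgeF φ a b) c - wedgeF φ a (wedgeF φ b c)} ?_ ?_ ⟨a, b, c, rfl⟩
  · rintro _ ⟨a, b, c, rfl⟩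
    simp [value_wedgeF, mul_assoc]
  · rintro _ ⟨a, b, c, rfl⟩ X
    have h : contract X (wedgeF φ (wedgeF φ a b) c - wedgeF φ a (wedgeF φ b c)) =
      (wedgeF φ (wedgeF φ (contract X a) b) c - wedgeF φ (contract X a) (wedgeF φ b c)) +
      (wedgeF φ (wedgeF φ (parity a) (contract X b)) c -
        wedgeF φ (parity a) (wedgeF φ (contract X b) c)) +
      (wedgeF φ (wedgeF φ (parity a) (parity b)) (contract X c) -
        wedgeF φ (parity a) (wedgeF φ (parity b) (contract X c))) := by
      simp only [map_sub, contract_wedgeF, map_add, LinearMap.add_apply, parity_wedgeF]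
      abel
    rw [h]
    exact add_mem (add_mem (AddSubgroup.subset_closure ⟨_, _, _, rfl⟩)
      (AddSubgroup.subset_closure ⟨_, _, _, rfl⟩)) (AddSubgroup.subset_closure ⟨_, _, _, rfl⟩)

theorem oneForm_wedgeF (a : Forms φ) : wedgeF φ (oneForm φ) a = a := by
  induction a using forms_induction with
  | zero => simp
  | add a b ha hb => rw [map_add, ha, hb]
  | hdeg k Ξ => rw [oneForm, wedgeF_inDeg_eq (zero_add k), wedgeN_zero_left]; simp

theorem wedgeF_oneForm (a : Forms φ) : wedgeF φ a (oneForm φ) = a := by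
  induction a using forms_induction with
  | zero => simp
  | add a b ha hb => rw [map_add, LinearMap.add_apply, ha, hb]
  | hdeg k Ξ => rw [oneForm, wedgeF_inDeg_eq (add_zero k), wedgeN_zero_right]; simp

scoped instance instRingForms : Ring (Forms φ) :=
  { (inferInstance : AddCommGroup (Forms φ)) with
    mul := fun a b => wedgeF φ a b
    one := oneForm φ
    left_distrib := fun a b c => map_add (wedgeF φ a) b c
    right_distrib := fun a b c => by
      change wedgeF φ (a + b) c = _
      rw [map_add]; rfl
    zero_mul := fun a => by
      change wedgeF φ 0 a = 0
      rw [map_zero]; rfl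
    mul_zero := fun a => map_zero (wedgeF φ a)
    mul_assoc := wedgeF_assoc
    one_mul := oneForm_wedgeF
    mul_one := wedgeF_oneForm }

theorem wedgeF_eq_mul (a b : Forms φ) : wedgeF φ a b = a * b := rfl

theorem oneForm_eq_one : oneForm φ = 1 := rfl

scoped instance : IsScalarTower A (Forms φ) (Forms φ) := ⟨fun f a b => wedgeF_smul_left f a b⟩
scoped instance : SMulCommClass A (Forms φ) (Forms φ) := ⟨fun f a b => (wedgeF_smul_right f a b).symm⟩
scoped instance : IsScalarTower ℝ (Forms φ) (Forms φ) :=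
  ⟨fun r a b => by
    change wedgeF φ (r • a) b = r • wedgeF φ a b
    rw [map_smul]; rfl⟩
scoped instance : SMulCommClass ℝ (Forms φ) (Forms φ) :=
  ⟨fun r a b => (map_smul (wedgeF φ a) r b).symm⟩

theorem value_mul (a b : Forms φ) : value (a * b) = value a * value b := value_wedgeF a b

theorem contract_mul (X : Vec φ) (a b : Forms φ) :
    contract X (a * b) = contract X a * b + parity a * contract X b := contract_wedgeF X a b

theorem parity_mul (a b : Forms φ) : parity (a * b) = parity a * parity b := parity_wedgeF a b

/-! Parity classes and graded commutativity. -/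

/-- `a` is a sum of forms whose degrees have the parity of `i`. -/
def HasParity (i : ℕ) (a : Forms φ) : Prop := parity a = (-1 : ℝ) ^ i • a

theorem neg_one_pow_smul (i : ℕ) (a : Forms φ) : (-1 : A) ^ i • a = (-1 : ℝ) ^ i • a := by
  rcases Nat.even_or_odd i with h | h <;> simp [h.neg_one_pow]

theorem hasParity_inDeg (k : ℕ) (Ξ : Form φ k) : HasParity k (inDeg k Ξ : Forms φ) := by
  rw [HasParity, parity_inDeg, neg_one_pow_smul]

theorem HasParity.mul {i j : ℕ} {a b : Forms φ} (ha : HasParity i a) (hb : HasParity j b) :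
    HasParity (i + j) (a * b) := by
  rw [HasParity, parity_mul, ha, hb, smul_mul_smul_comm, pow_add]

/-- Contraction lowers degrees by one, but only the parity of the index matters, so `i + 1` can
stand for `i - 1`. -/
theorem HasParity.contract {i : ℕ} {a : Forms φ} (ha : HasParity i a) (X : Vec φ) :
    HasParity (i + 1) (contract X a) := by
  have h := contract_parity X a
  rw [ha, LinearMap.map_smul_of_tower] at h
  rw [HasParity, ← neg_eq_iff_eq_neg.mpr h, pow_succ]
  simp

theorem HasParity.neg_one_pow {i : ℕ} {a : Forms φ} (ha : HasParity i a) :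
    parity a = (-1 : ℝ) ^ i • a := ha

theorem HasParity.value_eq_zero {i : ℕ} {a : Forms φ} (ha : HasParity i a) (hi : Odd i) :
    value a = 0 := by
  have h := congrArg value ha.neg_one_pow
  rw [value_parity, hi.neg_one_pow, neg_one_smul, map_neg] at h
  have h2 : (2 : ℝ) • value a = 0 := by rw [two_smul]; nth_rewrite 1 [h]; simp
  have h3 := congrArg (fun x => (2⁻¹ : ℝ) • x) h2
  simpa [smul_smul] using h3

/-- Working with parities instead of degrees keeps the family of graded commutators stable under
contraction. In degree zero the sign is harmless, since a form of odd parity has no component there.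
-/
theorem mul_comm_of_hasParity {i j : ℕ} {a b : Forms φ} (ha : HasParity i a)
    (hb : HasParity j b) : a * b = (-1 : ℝ) ^ (i * j) • (b * a) := by
  rw [← sub_eq_zero]
  refine eq_zero_of_closed {x | ∃ (i j : ℕ) (a b : Forms φ), HasParity i a ∧ HasParity j b ∧
    x = a * b - (-1 : ℝ) ^ (i * j) • (b * a)} ?_ ?_ ⟨i, j, a, b, ha, hb, rfl⟩
  · rintro _ ⟨i, j, a, b, ha, hb, rfl⟩
    rw [map_sub, LinearMap.map_smul_of_tower, value_mul, value_mul]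
    rcases Nat.even_or_odd i with h | h
    · rw [(h.mul_right j).neg_one_pow, one_smul, mul_comm, sub_self]
    · rw [ha.value_eq_zero h]; simp
  · rintro _ ⟨i, j, a, b, ha, hb, rfl⟩ X
    have h : contract X (a * b - (-1 : ℝ) ^ (i * j) • (b * a)) =
        (contract X a * b - (-1 : ℝ) ^ ((i + 1) * j) • (b * contract X a)) +
        (-1 : ℝ) ^ i • (a * contract X b - (-1 : ℝ) ^ (i * (j + 1)) • (contract X b * a)) := by
      rw [map_sub, LinearMap.map_smul_of_tower, contract_mul, contract_mul, ha.neg_one_pow,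
        hb.neg_one_pow, smul_sub, smul_smul, ← pow_add, smul_add, smul_mul_assoc, smul_mul_assoc,
        smul_smul, ← pow_add, show i + i * (j + 1) = i * j + 2 * i by ring,
        show (i + 1) * j = i * j + j by ring, pow_add _ (i * j) (2 * i), pow_mul _ 2 i]
      simp only [even_two, Even.neg_pow, one_pow, mul_one]
      abel
    rw [h]
    refine add_mem (AddSubgroup.subset_closure ⟨_, _, _, _, ha.contract X, hb, rfl⟩) ?_
    have h2 := AddSubgroup.subset_closure (G := Forms φ) (k := {x | ∃ (i j : ℕ) (a b : Forms φ),
      HasParity i a ∧ HasParity j b ∧ x = a * b - (-1 : ℝ) ^ (i * j) • (b * a)})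
      ⟨i, j + 1, a, contract X b, ha, hb.contract X, rfl⟩
    rcases Nat.even_or_odd i with hi | hi
    · rwa [hi.neg_one_pow, one_smul]
    · rw [hi.neg_one_pow, neg_one_smul]; exact neg_mem h2

theorem isGradedCommAlgebra_forms : IsGradedCommAlgebra (oneForm φ) (wedgeF φ) where
  one_mem k hk := inDeg_apply_ne hk _
  one_mul := oneForm_wedgeF
  mul_one := wedgeF_oneForm
  assoc := wedgeF_assoc
  degree i j x y k hk := by rw [wedgeF_inDeg, inDeg_apply_ne hk]
  comm i j x y := mul_comm_of_hasParity (hasParity_inDeg i x) (hasParity_inDeg j y)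

/-- Functions as forms. -/
def func : A →ₗ[A] Forms φ := DirectSum.lof A ℕ (Form φ) 0 ∘ₗ fn φ

theorem func_eq (f : A) : (func f : Forms φ) = inDeg 0 (fn φ f) := rfl

theorem func_eq_smul_one (f : A) : (func f : Forms φ) = f • 1 := by
  rw [← oneForm_eq_one, oneForm, smul_inDeg, ← map_smul, func_eq, smul_eq_mul, mul_one]

theorem func_mul (f : A) (a : Forms φ) : func f * a = f • a := by
  rw [func_eq_smul_one, smul_mul_assoc, one_mul]

theorem mul_func (f : A) (a : Forms φ) : a * func f = f • a := by
  rw [func_eq_smul_one, mul_smul_comm, mul_one]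

@[simp] theorem contract_func (X : Vec φ) (f : A) : contract X (func f) = 0 :=
  contract_inDeg_zero X _

@[simp] theorem value_func (f : A) : value (func f : Forms φ) = f := value_inDeg_zero _

@[simp] theorem parity_func (f : A) : parity (func f : Forms φ) = func f := by
  rw [func_eq, parity_inDeg]; simp

theorem inDeg_zero_eq_func (Ξ : Form φ 0) : (inDeg 0 Ξ : Forms φ) = func (Ξ ![]) := by
  rw [func_eq]; congr 1; ext x; rw [Subsingleton.elim x ![]]; rfl

theorem contract_inDeg_one (X : Vec φ) (ξ : Form φ 1) :
    contract X (inDeg 1 ξ) = func (ξ fun _ => X) := by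
  rw [contract_inDeg_succ, inDeg_zero_eq_func, AlternatingMap.curryLeft_apply_apply]
  congr 2
  ext1 i
  rw [Subsingleton.elim i 0]; rfl

end FormAlgebra

/-! ### Cartan calculus for the untwisted differential -/

section Cartan

variable {A : Type*} [CommRing A] [Algebra ℝ A] {φ : A ≃ₐ[ℝ] A}

/-- The derivation `X ∘ φ⁻¹` of `A` that corresponds to the `φ`-derivation `X`. -/
def der (X : Vec φ) : A →ₗ[ℝ] A := act X ∘ₗ φ.symm.toLinearMap

theorem der_apply (X : Vec φ) (f : A) : der X f = act X (φ.symm f) := rfl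

theorem act_eq_der (X : Vec φ) (f : A) : act X f = der X (φ f) := by simp [der_apply]

theorem der_mul (X : Vec φ) (f g : A) : der X (f * g) = f * der X g + g * der X f := by
  simp [der_apply, vec_leibniz]

@[simp] theorem der_smul (c : A) (X : Vec φ) (f : A) : der (c • X) f = c * der X f := by
  simp [der_apply]

@[simp] theorem der_add (X Y : Vec φ) (f : A) : der (X + Y) f = der X f + der Y f := by
  simp [der_apply]

theorem der_ext {X Y : Vec φ} (h : ∀ f, der X f = der Y f) : X = Y := by
  ext f; rw [act_eq_der, act_eq_der, h]

/-- The commutator of `φ`-derivations, viewed as derivations. -/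
def comm (X Y : Vec φ) : Vec φ := (Ad φ).symm (tbr X Y)

theorem der_comm (X Y : Vec φ) (f : A) :
    der (comm X Y) f = der X (der Y f) - der Y (der X f) := by
  simp [der_apply, comm, tbr_apply]

/-- The untwisted differential on `k`-forms. -/
def dk (k : ℕ) : Form φ k →ₗ[ℝ] Form φ (k + 1) := extD φ k ∘ₗ (Adt φ k).symm.toLinearMap

theorem dk_apply {k : ℕ} (Θ : Form φ k) (x : Fin (k + 1) → Vec φ) :
    dk k Θ x = extDAlt ((Adt φ k).symm Θ) x := by
  rw [extDAlt_apply]; rfl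

theorem formR_Adt_symm {k : ℕ} (Θ : Form φ k) (x : Fin k → Vec φ) :
    formR ((Adt φ k).symm Θ) x = φ.symm (Θ x) := by
  simp [formR_apply]

theorem anchorPart_Adt_symm {k : ℕ} (Θ : Form φ k) (X : Vec φ) (x : Fin k → Vec φ) :
    anchorPart ((Adt φ k).symm Θ) X x = der X (Θ x) := by
  change act X (formR _ x) = _
  rw [formR_Adt_symm]; rfl

theorem bracketPart_Adt_symm {k : ℕ} (Θ : Form φ (k + 1)) (X Y : Vec φ) (x : Fin k → Vec φ) :
    bracketPart ((Adt φ (k + 1)).symm Θ) X Y x = Θ (Matrix.vecCons (comm X Y) x) := by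
  rw [bracketPart_apply, Adt_symm_apply, AlgEquiv.apply_symm_apply]
  congr 1
  ext1 i
  refine Fin.cases ?_ (fun i => ?_) i
  · simp [comm]
  · simp

theorem dk_zero_apply (Θ : Form φ 0) (X : Vec φ) : (dk 0 Θ).curryLeft X ![] = der X (Θ ![]) := by
  rw [AlternatingMap.curryLeft_apply_apply, dk_apply, extDAlt, AlternatingMap.add_apply,
    AlternatingMap.alternatizeUncurryFin_apply]
  simp only [bracketAlt, Fin.sum_univ_succ, anchorPart_Adt_symm]
  simp

theorem bracketAlt_succ {m : ℕ} (Ξ : Form φ (m + 1)) (x : Fin (m + 2) → Vec φ) :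
    bracketAlt Ξ x = (-(1 / 2) : ℝ) •
      AlternatingMap.alternatizeUncurryFin (R := ℝ) (M := Vec φ) (N := A)
        (AlternatingMap.alternatizeUncurryFinLM (R := ℝ) (M := Vec φ) (N := A) ∘ₗ
          bracketPart Ξ) x := rfl

/-- In `dΘ(X, x)` the terms where `X` stays an argument of `Θ` cancel against `d(Θ(X, -))(x)`. What
survives is the derivative along `X` and the brackets of `X` with the other arguments. -/
theorem cartan_explicit {k : ℕ} (Θ : Form φ (k + 1)) (X : Vec φ) (x : Fin (k + 1) → Vec φ) :
    (dk (k + 1) Θ).curryLeft X x + dk k (Θ.curryLeft X) x =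
      der X (Θ x) -
        ∑ i : Fin (k + 1), (-1 : A) ^ i.val * Θ (Matrix.vecCons (comm X (x i)) (i.removeNth x)) := by
  -- `bracketAlt` sums over ordered pairs with weight `-1/2`, so `(X, x i)` and `(x i, X)` each
  -- contribute half of the bracket terms.
  have hh : ∀ a : A, (-(1 / 2) : ℝ) • a + (-(1 / 2) : ℝ) • a = -a := by
    intro a; rw [← add_smul]; norm_num
  rw [AlternatingMap.curryLeft_apply_apply, dk_apply, dk_apply, extDAlt, extDAlt,
    AlternatingMap.add_apply, AlternatingMap.add_apply]
  have h1 := alternatizeUncurryFin_cons (anchorPart ((Adt φ (k + 1)).symm Θ)) X x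
  have h2 : AlternatingMap.alternatizeUncurryFin (R := ℝ) (M := Vec φ) (N := A)
      (anchorPart ((Adt φ k).symm (Θ.curryLeft X))) x =
      ∑ i : Fin (k + 1), (-1 : A) ^ i.val *
        anchorPart ((Adt φ (k + 1)).symm Θ) (x i) (Fin.cons X (i.removeNth x)) := by
    rw [AlternatingMap.alternatizeUncurryFin_apply]
    refine Finset.sum_congr rfl fun i _ => ?_
    rw [anchorPart_Adt_symm, anchorPart_Adt_symm]
    simp [Matrix.vecCons]
  have h1' : AlternatingMap.alternatizeUncurryFin (R := ℝ) (M := Vec φ) (N := A)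
      (anchorPart ((Adt φ (k + 1)).symm Θ)) (Matrix.vecCons X x) = _ := h1
  rw [h1', h2, anchorPart_Adt_symm]
  set S := ∑ i : Fin (k + 1), (-1 : A) ^ i.val *
    Θ (Matrix.vecCons (comm X (x i)) (i.removeNth x)) with hS
  have h3 : AlternatingMap.alternatizeUncurryFin (R := ℝ) (M := Vec φ) (N := A)
      (bracketPart ((Adt φ (k + 1)).symm Θ) X) x = S := by
    rw [AlternatingMap.alternatizeUncurryFin_apply]
    refine Finset.sum_congr rfl fun i _ => ?_
    rw [bracketPart_Adt_symm]
    simp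
  have h4 : bracketAlt ((Adt φ (k + 1)).symm Θ) (Matrix.vecCons X x) =
      -(1 / 2 : ℝ) • (S - ∑ i : Fin (k + 1), (-1 : A) ^ i.val *
        AlternatingMap.alternatizeUncurryFin (R := ℝ) (M := Vec φ) (N := A)
          (bracketPart ((Adt φ (k + 1)).symm Θ) (x i)) (Fin.cons X (i.removeNth x))) := by
    rw [← h3, bracketAlt_succ]
    congr 1
    exact alternatizeUncurryFin_cons _ X x
  have h5 : ∑ i : Fin (k + 1), (-1 : A) ^ i.val *
        bracketPart ((Adt φ (k + 1)).symm Θ) (x i) X (i.removeNth x) = -S := by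
    rw [hS, ← Finset.sum_neg_distrib]
    refine Finset.sum_congr rfl fun i _ => ?_
    rw [bracketPart_skew, bracketPart_Adt_symm, mul_neg]
  rw [h4]
  -- For `k = 0` the contracted form is a function, where `bracketAlt` is zero by definition; there
  -- are then no brackets between the `x i` to cancel.
  cases k with
  | zero =>
    have h6 : ∀ i : Fin 1, AlternatingMap.alternatizeUncurryFin (R := ℝ) (M := Vec φ) (N := A)
          (bracketPart ((Adt φ 1).symm Θ) (x i)) (Fin.cons X (i.removeNth x)) =
        bracketPart ((Adt φ 1).symm Θ) (x i) X (i.removeNth x) := by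
      intro i
      rw [AlternatingMap.alternatizeUncurryFin_apply]
      simp
    simp only [h6, h5]
    simp only [bracketAlt, sub_neg_eq_add, smul_add]
    rw [hh]
    simp
    ring
  | succ m =>
    have h7 : bracketAlt ((Adt φ (m + 1)).symm (Θ.curryLeft X)) x =
      (1 / 2 : ℝ) • ∑ i : Fin (m + 2), (-1 : A) ^ i.val * ∑ j : Fin (m + 1), (-1 : A) ^ j.val *
        bracketPart ((Adt φ (m + 2)).symm Θ) (x i) (i.removeNth x j)
          (Fin.cons X (j.removeNth (i.removeNth x))) := by
      rw [bracketAlt_succ, neg_smul, ← smul_neg]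
      congr 1
      refine (congrArg Neg.neg (AlternatingMap.alternatizeUncurryFin_apply ..)).trans ?_
      rw [← Finset.sum_neg_distrib]
      refine Finset.sum_congr rfl fun i _ => ?_
      have h8 : AlternatingMap.alternatizeUncurryFin (R := ℝ) (M := Vec φ) (N := A)
          (bracketPart ((Adt φ (m + 1)).symm (Θ.curryLeft X)) (x i)) (i.removeNth x) =
          -∑ j : Fin (m + 1), (-1 : A) ^ j.val *
            bracketPart ((Adt φ (m + 2)).symm Θ) (x i) (i.removeNth x j)
              (Fin.cons X (j.removeNth (i.removeNth x))) := by
        rw [AlternatingMap.alternatizeUncurryFin_apply, ← Finset.sum_neg_distrib]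
        refine Finset.sum_congr rfl fun j _ => ?_
        rw [bracketPart_Adt_symm, bracketPart_Adt_symm, ← AlternatingMap.curryLeft_apply_apply,
          neg_curryLeft_curryLeft]
        simp [Matrix.vecCons]
      refine (congrArg (fun a : A => -((-1 : ℤ) ^ i.val • a)) h8).trans ?_
      simp
    have h6 : ∀ i : Fin (m + 2), AlternatingMap.alternatizeUncurryFin (R := ℝ) (M := Vec φ) (N := A)
          (bracketPart ((Adt φ (m + 2)).symm Θ) (x i)) (Fin.cons X (i.removeNth x)) =
        bracketPart ((Adt φ (m + 2)).symm Θ) (x i) X (i.removeNth x) -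
        ∑ j : Fin (m + 1), (-1 : A) ^ j.val *
          bracketPart ((Adt φ (m + 2)).symm Θ) (x i) (i.removeNth x j)
            (Fin.cons X (j.removeNth (i.removeNth x))) := fun i =>
      alternatizeUncurryFin_cons _ X (i.removeNth x)
    rw [h7]
    simp only [h6, mul_sub, Finset.sum_sub_distrib, h5]
    have h9 : ∀ P Q T : A, P - Q + -(1 / 2 : ℝ) • (S - (-S - T)) + (Q + (1 / 2 : ℝ) • T) = P - S := by
      intro P Q T
      have := hh S
      simp only [Algebra.smul_def, map_neg] at this ⊢
      linear_combination this
    exact h9 _ _ _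

end Cartan

/-! ### Cartan identities on the algebra of all forms -/

section CartanForms

variable {A : Type*} [CommRing A] [Algebra ℝ A] {φ : A ≃ₐ[ℝ] A}

theorem inDeg_add (k : ℕ) (Ξ Θ : Form φ k) :
    (inDeg k (Ξ + Θ) : Forms φ) = inDeg k Ξ + inDeg k Θ :=
  (DirectSum.lof ℝ ℕ (Form φ) k).map_add Ξ Θ

theorem comm_jacobi (X Y Z : Vec φ) :
    comm (comm X Y) Z = comm X (comm Y Z) + (-1 : A) • comm Y (comm X Z) := by
  refine der_ext fun f => ?_
  simp only [der_add, der_smul, der_comm, map_sub]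
  ring

/-- The untwisted differential on all forms. -/
def dF : Forms φ →ₗ[ℝ] Forms φ :=
  DirectSum.toModule ℝ ℕ _ fun k => DirectSum.lof ℝ ℕ (Form φ) (k + 1) ∘ₗ dk k

@[simp] theorem dF_inDeg {k : ℕ} (Θ : Form φ k) :
    dF (inDeg k Θ : Forms φ) = inDeg (k + 1) (dk k Θ) :=
  DirectSum.toModule_lof ℝ k Θ

@[simp] theorem value_dF (a : Forms φ) : value (dF a) = 0 := by
  induction a using forms_induction with
  | zero => simp
  | add a b ha hb => simp only [map_add, ha, hb, add_zero]
  | hdeg k Ξ => rw [dF_inDeg, value_inDeg_succ]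

@[simp] theorem contract_dF_func (X : Vec φ) (f : A) :
    contract X (dF (func f : Forms φ)) = func (der X f) := by
  rw [func_eq, dF_inDeg, contract_inDeg_succ, inDeg_zero_eq_func, dk_zero_apply]; rfl

theorem parity_dF (a : Forms φ) : parity (dF a) = -dF (parity a) := by
  induction a using forms_induction with
  | zero => simp
  | add a b ha hb => simp only [map_add, ha, hb]; abel
  | hdeg k Ξ =>
    rw [dF_inDeg, parity_inDeg, parity_inDeg, neg_one_pow_smul, neg_one_pow_smul, map_smul,
      dF_inDeg, pow_succ]
    simp

/-- The untwisted Lie derivative. -/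
def lie (X : Vec φ) : Forms φ →ₗ[ℝ] Forms φ :=
  (contract X).restrictScalars ℝ ∘ₗ dF + dF ∘ₗ (contract X).restrictScalars ℝ

theorem lie_apply (X : Vec φ) (a : Forms φ) :
    lie X a = contract X (dF a) + dF (contract X a) := rfl

theorem contract_dF (X : Vec φ) (a : Forms φ) :
    contract X (dF a) = lie X a - dF (contract X a) := by
  rw [lie_apply, add_sub_cancel_right]

@[simp] theorem lie_func (X : Vec φ) (f : A) : lie X (func f : Forms φ) = func (der X f) := by
  simp [lie_apply]

theorem lie_inDeg_succ (X : Vec φ) {k : ℕ} (Θ : Form φ (k + 1)) :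
    lie X (inDeg (k + 1) Θ : Forms φ) =
      inDeg (k + 1) ((dk (k + 1) Θ).curryLeft X + dk k (Θ.curryLeft X)) := by
  rw [lie_apply, inDeg_add, dF_inDeg, contract_inDeg_succ, contract_inDeg_succ, dF_inDeg]

theorem value_lie (X : Vec φ) (a : Forms φ) : value (lie X a) = der X (value a) := by
  induction a using forms_induction with
  | zero => simp
  | add a b ha hb => simp only [map_add, ha, hb]
  | hdeg k Ξ =>
    rcases k with _ | k
    · rw [inDeg_zero_eq_func]; simp
    · rw [lie_inDeg_succ]; simp

theorem parity_lie (X : Vec φ) (a : Forms φ) : parity (lie X a) = lie X (parity a) := by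
  have h (b : Forms φ) : parity (contract X b) = -contract X (parity b) := by
    rw [contract_parity, neg_neg]
  simp only [lie_apply, map_add, h, parity_dF, map_neg, neg_neg]

/-- Putting `Y` first in the explicit Cartan formula, the summand of index `0` is the one containing
`[X, Y]`, and the rest is the same formula for the contracted form. The Cartan identities below are
deduced from this by contraction, without returning to sums over indices. -/
theorem contract_lie (X Y : Vec φ) (a : Forms φ) :
    contract Y (lie X a) = lie X (contract Y a) - contract (comm X Y) a := by
  induction a using forms_induction with
  | zero => simp
  | add a b ha hb => simp only [map_add, ha, hb]; abel
  | hdeg k Θ =>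
    rcases k with _ | _ | k
    · rw [inDeg_zero_eq_func]; simp
    · rw [lie_inDeg_succ, contract_inDeg_succ, contract_inDeg_succ, contract_inDeg_succ,
        inDeg_zero_eq_func, inDeg_zero_eq_func, inDeg_zero_eq_func, lie_func, ← map_sub]
      congr 1
      rw [AlternatingMap.curryLeft_apply_apply, AlternatingMap.add_apply, cartan_explicit]
      simp only [Fin.sum_univ_succ, AlternatingMap.curryLeft_apply_apply]
      simp
    · rw [lie_inDeg_succ, contract_inDeg_succ, contract_inDeg_succ, contract_inDeg_succ,
        lie_inDeg_succ, eq_sub_iff_add_eq, ← inDeg_add]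
      congr 1
      ext x
      rw [AlternatingMap.add_apply, AlternatingMap.curryLeft_apply_apply,
        AlternatingMap.add_apply, cartan_explicit, AlternatingMap.add_apply, cartan_explicit,
        Fin.sum_univ_succ]
      have h1 : ∀ i : Fin (k + 1), Θ (Matrix.vecCons (comm X (x i))
          (i.succ.removeNth (Matrix.vecCons Y x))) =
          -Θ (Matrix.vecCons Y (Matrix.vecCons (comm X (x i)) (i.removeNth x))) := by
        intro i
        rw [show i.succ.removeNth (Matrix.vecCons Y x) = Matrix.vecCons Y (i.removeNth x) from
          removeNth_succ_cons i Y x, ← AlternatingMap.curryLeft_apply_apply,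
          ← AlternatingMap.curryLeft_apply_apply, neg_curryLeft_curryLeft]
        rfl
      rw [show (0 : Fin (k + 2)).removeNth (Matrix.vecCons Y x) = x from removeNth_zero_cons Y x]
      simp only [Matrix.cons_val_succ, Matrix.cons_val_zero, h1,
        AlternatingMap.curryLeft_apply_apply, Fin.val_succ, pow_succ, mul_neg, mul_one, neg_neg,
        neg_mul]
      simp
      ring

theorem lie_mul (X : Vec φ) (a b : Forms φ) : lie X (a * b) = lie X a * b + a * lie X b := by
  rw [← sub_eq_zero]
  refine eq_zero_of_closed {x | ∃ a b : Forms φ,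
    x = lie X (a * b) - (lie X a * b + a * lie X b)} ?_ ?_ ⟨a, b, rfl⟩
  · rintro _ ⟨a, b, rfl⟩
    simp only [map_sub, map_add, value_lie, value_mul, der_mul]
    ring
  · rintro _ ⟨a, b, rfl⟩ Y
    have h : contract Y (lie X (a * b) - (lie X a * b + a * lie X b)) =
        (lie X (contract Y a * b) - (lie X (contract Y a) * b + contract Y a * lie X b)) +
        (lie X (parity a * contract Y b) -
          (lie X (parity a) * contract Y b + parity a * lie X (contract Y b))) := by
      simp only [map_sub, map_add, contract_mul, contract_lie, parity_lie]
      noncomm_ring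
    rw [h]
    exact add_mem (AddSubgroup.subset_closure ⟨_, _, rfl⟩)
      (AddSubgroup.subset_closure ⟨_, _, rfl⟩)

/-- Contraction turns `dF` into `lie X` minus `dF` of the contraction. Once `lie X` is known to be a
derivation, the defect of the Leibniz rule therefore contracts to negatives of defects of the same
kind. -/
theorem dF_mul (a b : Forms φ) : dF (a * b) = dF a * b + parity a * dF b := by
  rw [← sub_eq_zero]
  refine eq_zero_of_closed {x | ∃ a b : Forms φ,
    x = dF (a * b) - (dF a * b + parity a * dF b)} ?_ ?_ ⟨a, b, rfl⟩
  · rintro _ ⟨a, b, rfl⟩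
    simp [value_mul]
  · rintro _ ⟨a, b, rfl⟩ X
    have h : contract X (dF (a * b) - (dF a * b + parity a * dF b)) =
        -(dF (contract X a * b) - (dF (contract X a) * b + parity (contract X a) * dF b)) -
        (dF (parity a * contract X b) -
          (dF (parity a) * contract X b + parity (parity a) * dF (contract X b))) := by
      simp only [map_sub, map_add, contract_mul, contract_dF, lie_mul, parity_dF,
        contract_parity, parity_parity]
      noncomm_ring
    rw [h]
    exact sub_mem (neg_mem (AddSubgroup.subset_closure ⟨_, _, rfl⟩))
      (AddSubgroup.subset_closure ⟨_, _, rfl⟩)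

/-- Contracting the defect with `Z` creates extra contractions with iterated commutators, which
cancel by the Jacobi identity `comm_jacobi`. -/
theorem lie_lie (X Y : Vec φ) (a : Forms φ) :
    lie X (lie Y a) = lie Y (lie X a) + lie (comm X Y) a := by
  rw [← sub_eq_zero]
  refine eq_zero_of_closed {x | ∃ a : Forms φ,
    x = lie X (lie Y a) - (lie Y (lie X a) + lie (comm X Y) a)} ?_ ?_ ⟨a, rfl⟩
  · rintro _ ⟨a, rfl⟩
    simp only [map_sub, map_add, value_lie, der_comm]
    ring
  · rintro _ ⟨a, rfl⟩ Z
    have h : contract Z (lie X (lie Y a) - (lie Y (lie X a) + lie (comm X Y) a)) =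
        lie X (lie Y (contract Z a)) -
          (lie Y (lie X (contract Z a)) + lie (comm X Y) (contract Z a)) := by
      simp only [map_sub, map_add, contract_lie, comm_jacobi X Y Z, contract_add, contract_smul]
      rw [neg_one_smul]
      abel
    rw [h]
    exact AddSubgroup.subset_closure ⟨_, rfl⟩

/-- The usual order is reversed: this is deduced from `lie_lie`, and `dF_dF` then follows from it,
since contraction commutes with `dF ∘ dF`. -/
theorem dF_lie (X : Vec φ) (a : Forms φ) : dF (lie X a) = lie X (dF a) := by
  rw [← sub_eq_zero]
  refine eq_zero_of_closed {x | ∃ a : Forms φ, x = dF (lie X a) - lie X (dF a)} ?_ ?_ ⟨a, rfl⟩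
  · rintro _ ⟨a, rfl⟩
    simp [value_lie]
  · rintro _ ⟨a, rfl⟩ Y
    have h : contract Y (dF (lie X a) - lie X (dF a)) =
        -(dF (lie X (contract Y a)) - lie X (dF (contract Y a))) := by
      simp only [map_sub, contract_lie, contract_dF]
      rw [lie_lie X Y]
      abel
    rw [h]
    exact neg_mem (AddSubgroup.subset_closure ⟨_, rfl⟩)

@[simp] theorem dF_dF (a : Forms φ) : dF (dF a) = 0 := by
  refine eq_zero_of_closed {x | ∃ a : Forms φ, x = dF (dF a)} ?_ ?_ ⟨a, rfl⟩
  · rintro _ ⟨a, rfl⟩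
    simp
  · rintro _ ⟨a, rfl⟩ X
    have h : contract X (dF (dF a)) = dF (dF (contract X a)) := by
      rw [contract_dF, contract_dF, map_sub, dF_lie]; abel
    rw [h]
    exact AddSubgroup.subset_closure ⟨_, rfl⟩

end CartanForms

section Equivariance

variable {A : Type*} [CommRing A] [Algebra ℝ A] {φ : A ≃ₐ[ℝ] A}

/-! The automorphism `Ad^†` of the algebra of forms. -/

@[simp] theorem AdtF_inDeg {k : ℕ} (Ξ : Form φ k) :
    AdtF φ (inDeg k Ξ) = inDeg k (Adt φ k Ξ) := DirectSum.lmap_lof ..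

@[simp] theorem AdtInvF_inDeg {k : ℕ} (Ξ : Form φ k) :
    AdtInvF φ (inDeg k Ξ) = inDeg k ((Adt φ k).symm Ξ) := DirectSum.lmap_lof ..

@[simp] theorem AdtF_AdtInvF (a : Forms φ) : AdtF φ (AdtInvF φ a) = a := by
  induction a using forms_induction with
  | zero => simp
  | add a b ha hb => simp only [map_add, ha, hb]
  | hdeg k Ξ => rw [AdtInvF_inDeg, AdtF_inDeg, LinearEquiv.apply_symm_apply]

@[simp] theorem AdtInvF_AdtF (a : Forms φ) : AdtInvF φ (AdtF φ a) = a := by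
  induction a using forms_induction with
  | zero => simp
  | add a b ha hb => simp only [map_add, ha, hb]
  | hdeg k Ξ => rw [AdtF_inDeg, AdtInvF_inDeg, LinearEquiv.symm_apply_apply]

theorem Adt_smul {k : ℕ} (f : A) (Ξ : Form φ k) : Adt φ k (f • Ξ) = φ f • Adt φ k Ξ := by
  ext x; simp

theorem AdtF_smul (f : A) (a : Forms φ) : AdtF φ (f • a) = φ f • AdtF φ a := by
  induction a using forms_induction with
  | zero => simp
  | add a b ha hb => simp only [map_add, smul_add, ha, hb]
  | hdeg k Ξ => rw [smul_inDeg, AdtF_inDeg, Adt_smul, ← smul_inDeg, AdtF_inDeg]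

@[simp] theorem AdtF_func (f : A) : AdtF φ (func f) = func (φ f) := by
  rw [func_eq, AdtF_inDeg, func_eq]; congr 1

theorem func_one : (func 1 : Forms φ) = 1 := rfl

@[simp] theorem AdtF_one : AdtF φ 1 = 1 := by
  rw [← func_one, AdtF_func, map_one]

@[simp] theorem value_AdtF (a : Forms φ) : value (AdtF φ a) = φ (value a) := by
  induction a using forms_induction with
  | zero => simp
  | add a b ha hb => simp only [map_add, ha, hb]
  | hdeg k Ξ =>
    rcases k with _ | k
    · rw [inDeg_zero_eq_func]; simp
    · simp

theorem AdtF_contract (X : Vec φ) (a : Forms φ) :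
    AdtF φ (contract X a) = contract (Ad φ X) (AdtF φ a) := by
  induction a using forms_induction with
  | zero => simp
  | add a b ha hb => simp only [map_add, ha, hb]
  | hdeg k Ξ =>
    rcases k with _ | k
    · simp
    · rw [AdtF_inDeg, contract_inDeg_succ, contract_inDeg_succ, AdtF_inDeg]
      congr 1
      ext x
      simp only [Adt_apply, AlternatingMap.curryLeft_apply_apply]
      congr 2
      ext1 i
      refine Fin.cases ?_ (fun i => ?_) i <;> simp

theorem contract_AdtF (X : Vec φ) (a : Forms φ) :
    contract X (AdtF φ a) = AdtF φ (contract ((Ad φ).symm X) a) := by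
  rw [AdtF_contract, LinearEquiv.apply_symm_apply]

theorem parity_AdtF (a : Forms φ) : parity (AdtF φ a) = AdtF φ (parity a) := by
  induction a using forms_induction with
  | zero => simp
  | add a b ha hb => simp only [map_add, ha, hb]
  | hdeg k Ξ =>
    rw [AdtF_inDeg, parity_inDeg, parity_inDeg, neg_one_pow_smul, neg_one_pow_smul, map_smul,
      AdtF_inDeg]

theorem AdtF_mul (a b : Forms φ) : AdtF φ (a * b) = AdtF φ a * AdtF φ b := by
  rw [← sub_eq_zero]
  refine eq_zero_of_closed {x | ∃ a b : Forms φ,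
    x = AdtF φ (a * b) - AdtF φ a * AdtF φ b} ?_ ?_ ⟨a, b, rfl⟩
  · rintro _ ⟨a, b, rfl⟩
    simp [value_mul]
  · rintro _ ⟨a, b, rfl⟩ X
    have h : contract X (AdtF φ (a * b) - AdtF φ a * AdtF φ b) =
        (AdtF φ (contract ((Ad φ).symm X) a * b) -
          AdtF φ (contract ((Ad φ).symm X) a) * AdtF φ b) +
        (AdtF φ (parity a * contract ((Ad φ).symm X) b) -
          AdtF φ (parity a) * AdtF φ (contract ((Ad φ).symm X) b)) := by
      simp only [map_sub, map_add, contract_mul, contract_AdtF, parity_AdtF]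
      noncomm_ring
    rw [h]
    exact add_mem (AddSubgroup.subset_closure ⟨_, _, rfl⟩)
      (AddSubgroup.subset_closure ⟨_, _, rfl⟩)

theorem der_Ad (X : Vec φ) (f : A) : der (Ad φ X) (φ f) = φ (der X f) := by
  simp [der_apply]

theorem Ad_comm (X Y : Vec φ) : Ad φ (comm X Y) = comm (Ad φ X) (Ad φ Y) := by
  refine der_ext fun f => ?_
  obtain ⟨g, rfl⟩ := φ.surjective f
  rw [der_Ad, der_comm, der_comm, der_Ad, der_Ad, der_Ad, der_Ad, map_sub]

theorem AdtF_lie (X : Vec φ) (a : Forms φ) :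
    AdtF φ (lie X a) = lie (Ad φ X) (AdtF φ a) := by
  rw [← sub_eq_zero]
  refine eq_zero_of_closed {x | ∃ a : Forms φ,
    x = AdtF φ (lie X a) - lie (Ad φ X) (AdtF φ a)} ?_ ?_ ⟨a, rfl⟩
  · rintro _ ⟨a, rfl⟩
    simp [value_lie, der_Ad]
  · rintro _ ⟨a, rfl⟩ Y
    have h : contract Y (AdtF φ (lie X a) - lie (Ad φ X) (AdtF φ a)) =
        AdtF φ (lie X (contract ((Ad φ).symm Y) a)) -
          lie (Ad φ X) (AdtF φ (contract ((Ad φ).symm Y) a)) := by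
      obtain ⟨Y, rfl⟩ := (Ad φ).surjective Y
      simp only [map_sub, contract_AdtF, contract_lie, LinearEquiv.symm_apply_apply, ← Ad_comm]
      abel
    rw [h]
    exact AddSubgroup.subset_closure ⟨_, rfl⟩

theorem AdtF_dF (a : Forms φ) : AdtF φ (dF a) = dF (AdtF φ a) := by
  rw [← sub_eq_zero]
  refine eq_zero_of_closed {x | ∃ a : Forms φ, x = AdtF φ (dF a) - dF (AdtF φ a)} ?_ ?_ ⟨a, rfl⟩
  · rintro _ ⟨a, rfl⟩
    simp
  · rintro _ ⟨a, rfl⟩ Y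
    have h : contract Y (AdtF φ (dF a) - dF (AdtF φ a)) =
        -(AdtF φ (dF (contract ((Ad φ).symm Y) a)) -
          dF (AdtF φ (contract ((Ad φ).symm Y) a))) := by
      obtain ⟨Y, rfl⟩ := (Ad φ).surjective Y
      simp only [map_sub, contract_AdtF, contract_dF, LinearEquiv.symm_apply_apply, AdtF_lie]
      abel
    rw [h]
    exact neg_mem (AddSubgroup.subset_closure ⟨_, rfl⟩)

/-- The operators `Ad⁻¹` in the arguments of the twisted differential, and the `φ` in front of its
bracket terms, are exactly those of `Ad^†`. -/
theorem extDF_eq (a : Forms φ) : extDF φ a = dF (AdtF φ a) := by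
  induction a using forms_induction with
  | zero => simp
  | add a b ha hb => simp only [map_add, ha, hb]
  | hdeg k Ξ =>
    rw [AdtF_inDeg, dF_inDeg]
    refine (DirectSum.toModule_lof ℝ k Ξ).trans ?_
    simp [dk]

theorem inDeg_extD {k : ℕ} (Ξ : Form φ k) :
    (inDeg (k + 1) (extD φ k Ξ) : Forms φ) = dF (inDeg k (Adt φ k Ξ)) := by
  rw [dF_inDeg, dk, LinearMap.comp_apply]; simp

/-! ### Contraction with a bivector -/

/-- A scalar is absorbed into the first factor of `X ∧ Y`, so decomposables generate under sums
alone. This matters because `koszul π` and `koszulBr π` are additive in `π` but differentiate its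
coefficients. -/
theorem bivec_induction {P : Bivec φ → Prop} (π : Bivec φ) (zero : P 0)
    (hdec : ∀ X Y, P (exteriorPower.ιMulti A 2 ![X, Y]))
    (add : ∀ π π', P π → P π' → P (π + π')) : P π := by
  have hs : π ∈ Submodule.span A (Set.range (exteriorPower.ιMulti A 2 (M := Vec φ))) := by
    rw [exteriorPower.ιMulti_span]; trivial
  have key : ∀ f : A, P (f • π) := by
    induction hs using Submodule.span_induction with
    | mem x hx =>
      obtain ⟨v, rfl⟩ := hx
      intro f
      have h := (exteriorPower.ιMulti A 2 (M := Vec φ)).map_update_smul v 0 f (v 0)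
      rw [Function.update_eq_self] at h
      rw [← h]
      convert hdec (f • v 0) (v 1) using 2
      ext1 i
      fin_cases i <;> simp
    | zero => intro f; rwa [smul_zero]
    | add x y _ _ hx hy => intro f; rw [smul_add]; exact add _ _ (hx f) (hy f)
    | smul c x _ hx => intro f; rw [smul_smul]; exact hx _
  simpa using key 1

/-- Contraction `Ξ ↦ Ξ(π, -, …, -)` with a bivector, on all forms. -/
def contractBi (π : Bivec φ) : Forms φ →ₗ[A] Forms φ :=
  DirectSum.toModule A ℕ _ fun k =>
    match k with
    | 0 => 0
    | 1 => 0
    | k + 2 => DirectSum.lof A ℕ (Form φ) k ∘ₗ contr φ k π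

@[simp] theorem contractBi_inDeg_zero (π : Bivec φ) (Ξ : Form φ 0) :
    contractBi π (inDeg 0 Ξ) = 0 := DirectSum.toModule_lof A 0 Ξ

@[simp] theorem contractBi_inDeg_one (π : Bivec φ) (Ξ : Form φ 1) :
    contractBi π (inDeg 1 Ξ) = 0 := DirectSum.toModule_lof A 1 Ξ

@[simp] theorem contractBi_inDeg_add_two (π : Bivec φ) {k : ℕ} (Ξ : Form φ (k + 2)) :
    contractBi π (inDeg (k + 2) Ξ) = inDeg k (contr φ k π Ξ) :=
  DirectSum.toModule_lof A (k + 2) Ξ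

theorem contractBi_zero (a : Forms φ) : contractBi 0 a = 0 := by
  induction a using forms_induction with
  | zero => simp
  | add a b ha hb => simp only [map_add, ha, hb, add_zero]
  | hdeg k Ξ => rcases k with _ | _ | k <;> simp

theorem contractBi_add (π π' : Bivec φ) (a : Forms φ) :
    contractBi (π + π') a = contractBi π a + contractBi π' a := by
  induction a using forms_induction with
  | zero => simp
  | add a b ha hb => simp only [map_add, ha, hb]; abel
  | hdeg k Ξ =>
    rcases k with _ | _ | k
    · simp
    · simp
    · rw [contractBi_inDeg_add_two, map_add, LinearMap.add_apply, inDeg_add]; simp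

theorem contractBi_ιMulti (X Y : Vec φ) (a : Forms φ) :
    contractBi (exteriorPower.ιMulti A 2 ![X, Y]) a = contract Y (contract X a) := by
  induction a using forms_induction with
  | zero => simp
  | add a b ha hb => simp only [map_add, ha, hb]
  | hdeg k Ξ =>
    rcases k with _ | _ | k
    · simp
    · simp
    · rw [contractBi_inDeg_add_two, contract_inDeg_succ, contract_inDeg_succ]
      simp [contr]

theorem innerF_eq (π : Bivec φ) (a : Forms φ) : innerF φ π a = AdtF φ (contractBi π a) := by
  induction a using forms_induction with
  | zero => simp
  | add a b ha hb => simp only [map_add, ha, hb]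
  | hdeg k Ξ =>
    rcases k with _ | _ | k
    · simp [innerF]
    · simp [innerF]
    · rw [contractBi_inDeg_add_two, AdtF_inDeg]; exact DirectSum.toModule_lof ℝ (k + 2) Ξ

theorem contractBi_parity (π : Bivec φ) (a : Forms φ) :
    parity (contractBi π a) = contractBi π (parity a) := by
  induction π using bivec_induction generalizing a with
  | zero => simp [contractBi_zero]
  | hdec X Y => simp [contractBi_ιMulti, contract_parity]
  | add π π' h h' => simp only [contractBi_add, map_add, h, h']

theorem contract_contractBi (X : Vec φ) (π : Bivec φ) (a : Forms φ) :
    contract X (contractBi π a) = contractBi π (contract X a) := by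
  induction π using bivec_induction generalizing a with
  | zero => simp [contractBi_zero]
  | hdec Y Z =>
    simp only [contractBi_ιMulti]
    rw [contract_anticomm X Z, contract_anticomm X Y, map_neg, neg_neg]
  | add π π' h h' => simp only [contractBi_add, map_add, h, h']

theorem sharp_ιMulti (X Y : Vec φ) (ξ : Form φ 1) :
    sharp φ (exteriorPower.ιMulti A 2 ![X, Y]) ξ =
      (ξ fun _ => X) • Y - (ξ fun _ => Y) • X := by
  simp [sharp]

/-- For `π = X ∧ Y` the double contraction meets `ξ` at most once; the mixed terms are `ξ(X) i_Y -
ξ(Y) i_X`, which is contraction with `π^♯ ξ`. -/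
theorem contractBi_one_form_mul (π : Bivec φ) (ξ : Form φ 1) (a : Forms φ) :
    contractBi π (inDeg 1 ξ * a) = contract (sharp φ π ξ) a + inDeg 1 ξ * contractBi π a := by
  have h1 : parity (inDeg 1 ξ : Forms φ) = -inDeg 1 ξ := by
    rw [parity_inDeg, pow_one, neg_one_smul]
  induction π using bivec_induction generalizing a with
  | zero =>
    rw [show sharp φ 0 ξ = (0 : A) • 0 by simp [sharp], contract_smul]
    simp [contractBi_zero]
  | hdec X Y =>
    rw [contractBi_ιMulti, contractBi_ιMulti, sharp_ιMulti, sub_eq_add_neg, ← neg_smul,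
      contract_add, contract_smul, contract_smul, contract_mul, map_add, contract_mul,
      contract_mul, contract_inDeg_one, contract_func, parity_func, h1, map_neg, map_neg, h1,
      contract_inDeg_one, func_mul, neg_mul, func_mul]
    simp
    abel
  | add π₁ π₂ h h' =>
    rw [contractBi_add, contractBi_add, h, h', show sharp φ (π₁ + π₂) ξ =
      sharp φ π₁ ξ + sharp φ π₂ ξ by simp [sharp], contract_add, mul_add]
    abel

theorem contractBi_two_form (π : Bivec φ) (Θ : Form φ 2) :
    contractBi π (inDeg 2 Θ) = func (pairing φ π Θ) := by
  induction π using bivec_induction with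
  | zero => simp [pairing]
  | hdec X Y =>
    rw [pairing_decomposable, contractBi_ιMulti, contract_inDeg_succ, contract_inDeg_one]
    congr 1
    simp only [AlternatingMap.curryLeft_apply_apply]
    congr 1
    ext1 i
    fin_cases i <;> rfl
  | add π₁ π₂ h h' =>
    rw [contractBi_add, h, h', show pairing φ (π₁ + π₂) Θ =
      pairing φ π₁ Θ + pairing φ π₂ Θ by simp [pairing], map_add]

end Equivariance

section BV

variable {A : Type*} [CommRing A] [Algebra ℝ A] {φ : A ≃ₐ[ℝ] A}

/-! ### The untwisted Koszul operator and its bracket -/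

/-- The commutator of the contraction with `π` and the untwisted differential. -/
def koszul (π : Bivec φ) : Forms φ →ₗ[ℝ] Forms φ :=
  (contractBi π).restrictScalars ℝ ∘ₗ dF - dF ∘ₗ (contractBi π).restrictScalars ℝ

theorem koszul_apply (π : Bivec φ) (a : Forms φ) :
    koszul π a = contractBi π (dF a) - dF (contractBi π a) := rfl

theorem koszul_zero (a : Forms φ) : koszul 0 a = 0 := by
  simp [koszul_apply, contractBi_zero]

theorem koszul_add (π π' : Bivec φ) (a : Forms φ) :
    koszul (π + π') a = koszul π a + koszul π' a := by
  simp only [koszul_apply, contractBi_add, map_add]; abel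

/-- Two applications of Cartan's formula to `i_Y i_X d - d i_Y i_X`. Together with additivity in
`π`, this reduces the product rules of the bracket to those of `lie` and `contract`. -/
theorem koszul_ιMulti (X Y : Vec φ) (a : Forms φ) :
    koszul (exteriorPower.ιMulti A 2 ![X, Y]) a =
      contract Y (lie X a) - lie Y (contract X a) := by
  simp only [koszul_apply, contractBi_ιMulti, lie_apply, map_add]
  abel

theorem parity_koszul (π : Bivec φ) (a : Forms φ) :
    parity (koszul π a) = -koszul π (parity a) := by
  simp only [koszul_apply, map_sub, contractBi_parity, parity_dF, map_neg]
  abel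

theorem HasParity.koszul {i : ℕ} {a : Forms φ} (ha : HasParity i a) (π : Bivec φ) :
    HasParity (i + 1) (koszul π a) := by
  rw [HasParity, parity_koszul, ha.neg_one_pow, map_smul, pow_succ]; simp

theorem koszul_inDeg_zero (π : Bivec φ) (Ξ : Form φ 0) : koszul π (inDeg 0 Ξ) = 0 := by
  rw [koszul_apply, dF_inDeg, contractBi_inDeg_one, contractBi_inDeg_zero, map_zero, sub_zero]

theorem koszul_func (π : Bivec φ) (f : A) : koszul π (func f) = 0 := koszul_inDeg_zero π _

theorem exists_koszul_inDeg_succ (π : Bivec φ) {k : ℕ} (Ξ : Form φ (k + 1)) :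
    ∃ Θ : Form φ k, koszul π (inDeg (k + 1) Ξ) = inDeg k Θ := by
  rcases k with _ | k
  · refine ⟨contr φ 0 π (dk 1 Ξ), ?_⟩
    rw [koszul_apply, dF_inDeg, contractBi_inDeg_add_two, contractBi_inDeg_one, map_zero, sub_zero]
  · refine ⟨contr φ (k + 1) π (dk (k + 2) Ξ) - dk k (contr φ k π Ξ), ?_⟩
    rw [koszul_apply, dF_inDeg, contractBi_inDeg_add_two, contractBi_inDeg_add_two, dF_inDeg,
      sub_eq_iff_eq_add, ← inDeg_add, sub_add_cancel]

/-- The bracket generated by the untwisted Koszul operator. -/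
def koszulBr (π : Bivec φ) : Forms φ →ₗ[ℝ] Forms φ →ₗ[ℝ] Forms φ :=
  LinearMap.mk₂ ℝ
    -- On a form `a` of degree `i` this is `(-1)^i (Δ(ab) - Δ(a) b - (-1)^i a Δ(b))`; `parity`
    -- supplies the sign without a choice of degree.
    (fun a b => koszul π (parity a * b) - koszul π (parity a) * b - a * koszul π b)
    (by intro a b c; simp only [map_add, add_mul]; abel)
    (by intro r a b
        simp only [LinearMap.map_smul_of_tower, smul_mul_assoc, map_smul, smul_sub])
    (by intro a b c; simp only [map_add, mul_add]; abel)
    (by intro r a b; simp only [mul_smul_comm, map_smul, smul_sub])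

theorem koszulBr_apply (π : Bivec φ) (a b : Forms φ) :
    koszulBr π a b = koszul π (parity a * b) - koszul π (parity a) * b - a * koszul π b := rfl

theorem koszulBr_zero (a b : Forms φ) : koszulBr 0 a b = 0 := by
  simp [koszulBr_apply, koszul_zero]

theorem koszulBr_add (π π' : Bivec φ) (a b : Forms φ) :
    koszulBr (π + π') a b = koszulBr π a b + koszulBr π' a b := by
  simp only [koszulBr_apply, koszul_add, add_mul, mul_add]; abel

/-- The terms where both operators hit the same factor drop out. Each remaining term applies a
single `lie` or `contract` to `b`, which is why the bracket obeys a Leibniz rule. -/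
theorem koszulBr_ιMulti (X Y : Vec φ) (a b : Forms φ) :
    koszulBr (exteriorPower.ιMulti A 2 ![X, Y]) a b =
      lie X a * contract Y b + contract Y (parity a) * lie X b -
        contract X (parity a) * lie Y b - lie Y a * contract X b := by
  simp only [koszulBr_apply, koszul_ιMulti, contract_mul, lie_mul, map_add, parity_parity,
    parity_lie]
  noncomm_ring

theorem koszul_mul {i : ℕ} {a : Forms φ} (ha : HasParity i a) (π : Bivec φ) (b : Forms φ) :
    koszul π (a * b) = (-1 : ℝ) ^ i • koszulBr π a b + koszul π a * b +
      (-1 : ℝ) ^ i • (a * koszul π b) := by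
  rw [koszulBr_apply, ha.neg_one_pow, smul_mul_assoc, map_smul, map_smul, smul_sub, smul_sub,
    smul_mul_assoc, smul_smul, smul_smul, ← mul_pow]
  simp
  abel

theorem HasParity.lie {i : ℕ} {a : Forms φ} (ha : HasParity i a) (X : Vec φ) :
    HasParity i (lie X a) := by
  rw [HasParity, parity_lie, ha.neg_one_pow, map_smul]

theorem koszulBr_mul {i j : ℕ} {a b : Forms φ} (ha : HasParity i a) (hb : HasParity j b)
    (π : Bivec φ) (c : Forms φ) :
    koszulBr π a (b * c) =
      koszulBr π a b * c + (-1 : ℝ) ^ ((i + 1) * j) • (b * koszulBr π a c) := by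
  induction π using bivec_induction with
  | zero => simp [koszulBr_zero]
  | add π π' h h' =>
    simp only [koszulBr_add, h, h', add_mul, mul_add, smul_add]; abel
  | hdec X Y =>
    -- The factor `b` has to be moved to the left past the differentiated or contracted `a`; `h3`
    -- and `h4` show that all four terms produce the same sign.
    have h1 (Z : Vec φ) : lie Z a * b = (-1 : ℝ) ^ (i * j) • (b * lie Z a) :=
      mul_comm_of_hasParity (ha.lie Z) hb
    have h2 (Z : Vec φ) : contract Z a * b = (-1 : ℝ) ^ ((i + 1) * j) • (b * contract Z a) :=
      mul_comm_of_hasParity (ha.contract Z) hb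
    have e : (-1 : ℝ) ^ j * (-1) ^ (i * j) = (-1) ^ ((i + 1) * j) := by
      rw [← pow_add]; congr 1; ring
    have h3 (Z : Vec φ) (d : Forms φ) : lie Z a * (parity b * d) =
        (-1 : ℝ) ^ ((i + 1) * j) • (b * (lie Z a * d)) := by
      rw [hb.neg_one_pow, ← mul_assoc, mul_smul_comm, h1, smul_smul, e, smul_mul_assoc, mul_assoc]
    have h4 (Z : Vec φ) (d : Forms φ) : contract Z (parity a) * (b * d) =
        (-1 : ℝ) ^ ((i + 1) * j) • (b * (contract Z (parity a) * d)) := by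
      rw [ha.neg_one_pow, LinearMap.map_smul_of_tower, smul_mul_assoc, ← mul_assoc, h2,
        smul_mul_assoc, smul_mul_assoc, mul_smul_comm, smul_comm, mul_assoc]
    simp only [koszulBr_ιMulti, contract_mul, lie_mul, mul_add, h3, h4, mul_sub, smul_add,
      smul_sub]
    noncomm_ring

/-- Formal: graded commutativity exchanges the factors in each of the three terms defining the
bracket, and only the signs need checking. -/
theorem koszul_mul_comm {i j : ℕ} {a b : Forms φ} (ha : HasParity i a) (hb : HasParity j b)
    (π : Bivec φ) :
    koszulBr π a b = -((-1 : ℝ) ^ ((i + 1) * (j + 1)) • koszulBr π b a) := by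
  have h1 : parity a * b = (-1 : ℝ) ^ (i + i * j) • (b * a) := by
    rw [ha.neg_one_pow, smul_mul_assoc, mul_comm_of_hasParity ha hb, smul_smul, pow_add]
  have h2 := mul_comm_of_hasParity (ha.koszul π) hb
  have h3 := mul_comm_of_hasParity ha (hb.koszul π)
  rw [koszulBr_apply, koszulBr_apply, h1, ha.neg_one_pow, hb.neg_one_pow]
  simp only [map_smul, smul_mul_assoc, h2, h3, smul_sub, smul_smul, ← pow_add]
  have e1 : (-1 : ℝ) ^ ((i + 1) * (j + 1) + j) = -(-1) ^ (i + i * j) := by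
    rw [show (i + 1) * (j + 1) + j = i + i * j + 2 * j + 1 by ring, pow_succ, pow_add _ _ (2 * j),
      pow_mul _ 2]; simp
  have e2 : (-1 : ℝ) ^ (i + (i + 1) * j) = -(-1) ^ ((i + 1) * (j + 1)) := by
    rw [show (i + 1) * (j + 1) = (i + (i + 1) * j) + 1 by ring, pow_succ]; simp
  have e3 : (-1 : ℝ) ^ (i * (j + 1)) = (-1) ^ (i + i * j) := by
    congr 1; ring
  rw [e1, e2, e3]
  simp only [neg_smul]
  abel

end BV

section LocalCoordinates

variable {A : Type*} [CommRing A] [Algebra ℝ A] {φ : A ≃ₐ[ℝ] A}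

/-! ### Local generation of the algebra of forms -/

/-- Functions `x` and vector fields `e` that restrict to coordinates and coordinate vector fields
(times `χ`) where `χ` is invertible. -/
structure IsLocalFrame {n : ℕ} (χ : A) (x : Fin n → A) (e : Fin n → Vec φ) : Prop where
  expand : ∀ X : Vec φ, χ • X = ∑ i, der X (x i) • e i
  dual : ∀ i j, der (e i) (x j) = if i = j then χ else 0

variable (φ) in
/-- The local frames of `n` vector fields have no common zero. -/
def HasLocalFrames (n : ℕ) : Prop :=
  ∀ a : A, a ≠ 0 → ∃ (ev : A →+* ℝ) (χ : A) (x : Fin n → A) (e : Fin n → Vec φ),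
    IsLocalFrame χ x e ∧ ev a ≠ 0 ∧ ev χ = 1

/-- If `a ≠ 0`, take a frame with `χ` equal to `1` at a point where `a` does not vanish: evaluation
there contradicts `χ ^ m * a = 0`. The exponent may depend on the frame. -/
theorem HasLocalFrames.eq_zero {n : ℕ} (H : HasLocalFrames φ n) {a : A}
    (h : ∀ (χ : A) (x : Fin n → A) (e : Fin n → Vec φ), IsLocalFrame χ x e →
      ∃ m : ℕ, χ ^ m * a = 0) : a = 0 := by
  by_contra ha
  obtain ⟨ev, χ, x, e, hf, h1, h2⟩ := H a ha
  obtain ⟨m, hm⟩ := h χ x e hf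
  have := congrArg ev hm
  rw [map_mul, map_pow, h2, one_pow, one_mul, map_zero] at this
  exact h1 this

theorem HasLocalFrames.form_eq_zero {n : ℕ} (H : HasLocalFrames φ n) {a : Forms φ}
    (h : ∀ (χ : A) (x : Fin n → A) (e : Fin n → Vec φ), IsLocalFrame χ x e →
      ∃ m : ℕ, χ ^ m • a = 0) : a = 0 := by
  refine DFinsupp.ext fun k => ?_
  ext v
  refine H.eq_zero fun χ x e hf => ?_
  obtain ⟨m, hm⟩ := h χ x e hf
  exact ⟨m, congrArg (fun b : Forms φ => b k v) hm⟩

variable (φ) in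
/-- Sums of products `f dx₁ ∧ ⋯ ∧ dx_k`. -/
def decomposables : ℕ → Submodule A (Forms φ)
  | 0 => LinearMap.range func
  | k + 1 => ⨆ f : A, (decomposables k).map (LinearMap.mulLeft A (dF (func f)))

theorem mul_mem_decomposables {k : ℕ} (f : A) {a : Forms φ} (ha : a ∈ decomposables φ k) :
    dF (func f) * a ∈ decomposables φ (k + 1) :=
  Submodule.mem_iSup_of_mem f (Submodule.mem_map_of_mem (f := LinearMap.mulLeft A _) ha)

theorem decomposables_zero_le {N : Submodule A (Forms φ)} (h : ∀ f, func f ∈ N) :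
    decomposables φ 0 ≤ N := by
  rintro _ ⟨f, rfl⟩; exact h f

theorem decomposables_succ_le {k : ℕ} {N : Submodule A (Forms φ)}
    (h : ∀ f, decomposables φ k ≤ N.comap (LinearMap.mulLeft A (dF (func f)))) :
    decomposables φ (k + 1) ≤ N :=
  iSup_le fun f => Submodule.map_le_iff_le_comap.mpr (h f)

theorem decomposables_two_le {N : Submodule A (Forms φ)}
    (h : ∀ f g : A, dF (func f) * dF (func g) ∈ N) : decomposables φ 2 ≤ N := by
  refine decomposables_succ_le fun f => decomposables_succ_le fun g =>
    decomposables_zero_le fun u => ?_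
  rw [Submodule.mem_comap, Submodule.mem_comap, LinearMap.mulLeft_apply, LinearMap.mulLeft_apply,
    mul_func, mul_smul_comm]
  exact Submodule.smul_mem _ _ (h f g)

theorem decomposables_three_le {N : Submodule A (Forms φ)}
    (h : ∀ f g h : A, dF (func f) * (dF (func g) * dF (func h)) ∈ N) : decomposables φ 3 ≤ N := by
  refine decomposables_succ_le fun f => decomposables_two_le fun g k => ?_
  exact h f g k

/-- Contract with `X` and induct on the degree: the factors `dxᵢ` contribute `∑ X(xᵢ) i_{eᵢ} = χ
i_X`, and the remaining terms are the same identity for `i_X Ξ`. -/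
theorem IsLocalFrame.euler {n : ℕ} {χ : A} {x : Fin n → A} {e : Fin n → Vec φ}
    (hf : IsLocalFrame χ x e) {k : ℕ} (Ξ : Form φ k) :
    ∑ i, dF (func (x i)) * contract (e i) (inDeg k Ξ) = ((k : A) * χ) • inDeg k Ξ := by
  have h1 : ∀ f : A, parity (dF (func f) : Forms φ) = -dF (func f) := by
    intro f; rw [parity_dF, parity_func]
  have hsum : ∀ X (a : Forms φ), ∑ i, der X (x i) • contract (e i) a = χ • contract X a := by
    intro X a
    have hs : ∀ s : Finset (Fin n), contract (∑ i ∈ s, der X (x i) • e i) a =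
        ∑ i ∈ s, der X (x i) • contract (e i) a := by
      intro s
      induction s using Finset.cons_induction with
      | empty =>
        rw [Finset.sum_empty, Finset.sum_empty, ← zero_smul A (0 : Vec φ), contract_smul, zero_smul]
      | cons i s hi ih => rw [Finset.sum_cons, Finset.sum_cons, contract_add, contract_smul, ih]
    rw [← hs, ← hf.expand, contract_smul]
  induction k with
  | zero => simp
  | succ k ih =>
    refine eq_of_value_of_contract ?_ fun X => ?_
    · simp [value_mul]
    · have h2 : ∀ i, contract X (dF (func (x i)) * contract (e i) (inDeg (k + 1) Ξ)) =
          der X (x i) • contract (e i) (inDeg (k + 1) Ξ) +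
          dF (func (x i)) * contract (e i) (inDeg k (Ξ.curryLeft X)) := by
        intro i
        rw [contract_mul, contract_dF_func, h1, contract_anticomm X, contract_inDeg_succ X,
          func_mul, neg_mul_neg]
      rw [map_sum]
      simp only [h2]
      rw [Finset.sum_add_distrib, hsum, ih, contract_inDeg_succ, map_smul, contract_inDeg_succ,
        ← add_smul]
      push_cast
      congr 1
      ring

/-- Dividing Euler's identity by the degree splits off one exact factor `dxᵢ` at the cost of one
power of `χ`. -/
theorem IsLocalFrame.smul_mem_decomposables {n : ℕ} {χ : A} {x : Fin n → A} {e : Fin n → Vec φ}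
    (hf : IsLocalFrame χ x e) {k : ℕ} (Ξ : Form φ k) :
    χ ^ k • (inDeg k Ξ : Forms φ) ∈ decomposables φ k := by
  induction k with
  | zero =>
    rw [inDeg_zero_eq_func]
    exact Submodule.smul_mem _ _ ⟨_, rfl⟩
  | succ k ih =>
    have h := hf.euler Ξ
    have h0 : (algebraMap ℝ A ((k + 1 : ℕ) : ℝ)⁻¹) * ((k + 1 : ℕ) : A) = 1 := by
      rw [← map_natCast (algebraMap ℝ A), ← map_mul, inv_mul_cancel₀ (by positivity), map_one]
    have h1 : χ ^ (k + 1) • (inDeg (k + 1) Ξ : Forms φ) =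
        (algebraMap ℝ A ((k + 1 : ℕ) : ℝ)⁻¹) •
          ∑ i, dF (func (x i)) * (χ ^ k • inDeg k (Ξ.curryLeft (e i))) := by
      have h2 : ∑ i, dF (func (x i)) * (χ ^ k • inDeg k (Ξ.curryLeft (e i))) =
          χ ^ k • (((k + 1 : ℕ) : A) * χ) • (inDeg (k + 1) Ξ : Forms φ) := by
        rw [← h, Finset.smul_sum]
        simp only [contract_inDeg_succ, mul_smul_comm]
      rw [h2, smul_smul, smul_smul]
      congr 1
      linear_combination (-χ ^ (k + 1)) * h0
    rw [h1]
    exact Submodule.smul_mem _ _ (Submodule.sum_mem _ fun i _ => mul_mem_decomposables _ (ih _))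

/-- An operator that commutes with contractions up to a sign is determined by one degree. -/
theorem HasLocalFrames.operator_eq_zero {n : ℕ} (H : HasLocalFrames φ n)
    (T : Forms φ →ₗ[A] Forms φ) (m : ℕ)
    (hT : ∀ X a, T (contract X a) = 0 → contract X (T a) = 0)
    (hdeg : ∀ k, k ≠ m → ∀ Ξ : Form φ k, value (T (inDeg k Ξ)) = 0)
    (hm : decomposables φ m ≤ LinearMap.ker T) (a : Forms φ) : T a = 0 := by
  induction a using forms_induction with
  | zero => exact map_zero T
  | add a b ha hb => rw [map_add, ha, hb, add_zero]
  | hdeg k Ξ =>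
    -- All contractions of `T Ξ` vanish because `T` vanishes one degree lower, so `T Ξ` is a
    -- function. It is zero by `hdeg` unless `k = m`, and in degree `m` a power of `χ` carries `Ξ`
    -- into the decomposables.
    induction k with
    | zero =>
      by_cases h : 0 = m
      · refine H.form_eq_zero fun χ x e hf => ⟨0, ?_⟩
        rw [← map_smul]
        exact hm (h ▸ hf.smul_mem_decomposables Ξ)
      · refine eq_of_value_of_contract (by rw [hdeg 0 h, map_zero]) fun X => ?_
        rw [hT X _ (by rw [contract_inDeg_zero, map_zero]), map_zero]
    | succ k ih =>
      by_cases h : k + 1 = m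
      · refine H.form_eq_zero fun χ x e hf => ⟨k + 1, ?_⟩
        rw [← map_smul]
        exact hm (h ▸ hf.smul_mem_decomposables Ξ)
      · refine eq_of_value_of_contract (by rw [hdeg _ h, map_zero]) fun X => ?_
        rw [hT X _ (by rw [contract_inDeg_succ, ih]), map_zero]

/-- A twisted derivation of the algebra of forms that vanishes on functions and `1`-forms is zero. -/
theorem HasLocalFrames.derivation_eq_zero {n : ℕ} (H : HasLocalFrames φ n)
    (E : Forms φ →ₗ[ℝ] Forms φ) (c : ℕ → ℝ) (hc : c 0 = 1)
    (hE : ∀ j k (y : Form φ j) (z : Form φ k), E (inDeg j y * inDeg k z) =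
      E (inDeg j y) * AdtF φ (inDeg k z) + c j • (AdtF φ (inDeg j y) * E (inDeg k z)))
    (h0 : ∀ f, E (func f) = 0) (h1 : ∀ ξ : Form φ 1, E (inDeg 1 ξ) = 0) : E = 0 := by
  have hmul : ∀ j (y : Form φ j) (a : Forms φ), E (inDeg j y) = 0 →
      E (inDeg j y * a) = c j • (AdtF φ (inDeg j y) * E a) := by
    intro j y a hy
    induction a using forms_induction with
    | zero => simp
    | add a b ha hb => rw [mul_add, map_add, ha, hb, map_add, mul_add, smul_add]
    | hdeg k z => rw [hE, hy, zero_mul, zero_add]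
  -- Vanishing on functions makes `E` semilinear along `φ`, so its kernel is an `A`-submodule;
  -- vanishing on `1`-forms puts every decomposable into it.
  have hsmul : ∀ (f : A) (a : Forms φ), E (f • a) = φ f • E a := by
    intro f a
    rw [← func_mul, func_eq, hmul 0 _ _ (h0 f), hc, one_smul, ← func_eq, AdtF_func, func_mul]
  let N : Submodule A (Forms φ) :=
    { carrier := {a | E a = 0}
      add_mem' := fun {a b} ha hb => by
        change E (a + b) = 0
        rw [map_add, show E a = 0 from ha, show E b = 0 from hb, add_zero]
      zero_mem' := map_zero E
      smul_mem' := fun f a ha => by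
        change E (f • a) = 0
        rw [hsmul, show E a = 0 from ha, smul_zero] }
  have hN : ∀ k, decomposables φ k ≤ N := by
    intro k
    induction k with
    | zero => exact decomposables_zero_le h0
    | succ k ih =>
      refine decomposables_succ_le fun f a ha => ?_
      change E (dF (func f) * a) = 0
      rw [func_eq, dF_inDeg, hmul 1 _ _ (h1 _), show E a = 0 from ih ha, mul_zero, smul_zero]
  refine LinearMap.ext fun a => ?_
  induction a using forms_induction with
  | zero => simp
  | add a b ha hb => rw [map_add, ha, hb]; simp
  | hdeg k Ξ =>
    -- By semilinearity it is `φ(χ)^k` that kills `E Ξ`. Applying `(Ad^†)⁻¹` turns this into `χ^k`,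
    -- as the localization principle requires.
    rw [LinearMap.zero_apply, ← AdtF_AdtInvF (E (inDeg k Ξ))]
    suffices h : AdtInvF φ (E (inDeg k Ξ)) = 0 by rw [h, map_zero]
    refine H.form_eq_zero fun χ x e hf => ⟨k, ?_⟩
    have h2 : E (χ ^ k • inDeg k Ξ) = 0 := hN k (hf.smul_mem_decomposables Ξ)
    rw [hsmul] at h2
    rw [← AdtInvF_AdtF (χ ^ k • AdtInvF φ (E (inDeg k Ξ))), AdtF_smul, AdtF_AdtInvF, h2, map_zero]

end LocalCoordinates

section Poisson

variable {A : Type*} [CommRing A] [Algebra ℝ A] {φ : A ≃ₐ[ℝ] A}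

/-! ### The untwisted Poisson bracket -/

theorem dF_func_eq (f : A) : dF (func f : Forms φ) = inDeg 1 (dk 0 (fn φ f)) := by
  rw [func_eq, dF_inDeg]

/-- The untwisted bracket `(f, g) ↦ π^♯(df)[g]` of functions. -/
def untwistedBr (π : Bivec φ) (f g : A) : A := der (sharp φ π (dk 0 (fn φ f))) g

theorem contract_apply_one (X : Vec φ) (ξ : Form φ 1) :
    ξ (fun _ => X) = value (contract X (inDeg 1 ξ)) := by
  rw [contract_inDeg_one, value_func]

theorem dk_fn_apply (X : Vec φ) (f : A) : dk 0 (fn φ f) (fun _ => X) = der X f := by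
  rw [contract_apply_one, ← dF_func_eq, contract_dF_func, value_func]

theorem fn_eq_of_inDeg {k : ℕ} {Ξ Θ : Form φ k} (h : (inDeg k Ξ : Forms φ) = inDeg k Θ) :
    Ξ = Θ := by
  have := congrArg (fun a : Forms φ => a k) h
  rwa [inDeg_apply_self, inDeg_apply_self] at this

theorem extD_fn (f : A) : extD φ 0 (fn φ f) = dk 0 (fn φ (φ f)) := by
  refine fn_eq_of_inDeg ?_
  rw [inDeg_extD, ← AdtF_inDeg, ← func_eq, AdtF_func, dF_func_eq]

/-- On functions the twisted differential is the untwisted one of `φ f`, which places one `φ` on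
each argument. -/
theorem poissonBr_eq (π : Bivec φ) (f g : A) :
    poissonBr φ π f g = untwistedBr π (φ f) (φ g) := by
  change pairing φ π (wedge 1 1 (extD φ 0 (fn φ f)) (extD φ 0 (fn φ g))) = _
  rw [← sharp_spec, extD_fn, extD_fn, dk_fn_apply]
  rfl

theorem untwistedBr_skew (π : Bivec φ) (f g : A) : untwistedBr π f g = -untwistedBr π g f := by
  have key : ∀ X Y : Vec φ, ∀ ξ η : Form φ 1, wedge 1 1 ξ η = -wedge 1 1 η ξ := by
    intro _ _ ξ η
    refine fn_eq_of_inDeg ?_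
    have h := mul_comm_of_hasParity (hasParity_inDeg 1 ξ) (hasParity_inDeg 1 η)
    rw [← wedgeF_eq_mul, ← wedgeF_eq_mul, wedgeF_inDeg, wedgeF_inDeg, mul_one, pow_one,
      neg_one_smul] at h
    rw [h]
    exact ((DirectSum.lof ℝ ℕ (Form φ) _).map_neg _).symm
  rw [untwistedBr, untwistedBr, ← dk_fn_apply, ← dk_fn_apply, sharp_spec, sharp_spec,
    key 0 0, map_neg]

section HomPoissonFacts

variable {π : Bivec φ} (hπ : IsHomPoisson φ π)
include hπ

theorem map_untwistedBr (f g : A) : φ (untwistedBr π f g) = untwistedBr π (φ f) (φ g) := by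
  obtain ⟨f, rfl⟩ := φ.surjective f
  obtain ⟨g, rfl⟩ := φ.surjective g
  have h := hπ.map_bracket f g
  simpa [poissonBr_eq] using h

/-- In the hom-Jacobi identity at `f, g, h` every argument ends up under `φ²`: the outer one through
the twist and the outer bracket, the inner ones through the two brackets. Surjectivity of `φ²`
removes it. -/
theorem untwistedBr_jacobi (f g h : A) :
    untwistedBr π f (untwistedBr π g h) + untwistedBr π g (untwistedBr π h f) +
      untwistedBr π h (untwistedBr π f g) = 0 := by
  obtain ⟨f, rfl⟩ := (φ.trans φ).surjective f
  obtain ⟨g, rfl⟩ := (φ.trans φ).surjective g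
  obtain ⟨h, rfl⟩ := (φ.trans φ).surjective h
  have := hπ.hom_jacobi f g h
  simpa [poissonBr_eq, map_untwistedBr hπ] using this

end HomPoissonFacts

theorem contractBi_dF_mul (π : Bivec φ) (f : A) (a : Forms φ) :
    contractBi π (dF (func f) * a) =
      contract (sharp φ π (dk 0 (fn φ f))) a + dF (func f) * contractBi π a := by
  rw [dF_func_eq, contractBi_one_form_mul]

theorem contractBi_dF_func (π : Bivec φ) (f : A) : contractBi π (dF (func f)) = 0 := by
  rw [dF_func_eq, contractBi_inDeg_one]

theorem contract_sharp_dF (π : Bivec φ) (f g : A) :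
    contract (sharp φ π (dk 0 (fn φ f))) (dF (func g)) = func (untwistedBr π f g) := by
  rw [contract_dF_func]; rfl

theorem contractBi_dF_dF (π : Bivec φ) (f g : A) :
    contractBi π (dF (func f) * dF (func g)) = func (untwistedBr π f g) := by
  rw [contractBi_dF_mul, contractBi_dF_func, mul_zero, add_zero, contract_sharp_dF]

theorem parity_dF_func (f : A) : parity (dF (func f) : Forms φ) = -dF (func f) := by
  rw [parity_dF, parity_func]

theorem koszul_dF (π : Bivec φ) (a : Forms φ) : koszul π (dF a) = -dF (koszul π a) := by
  simp [koszul_apply]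

theorem dF_smul (f : A) (a : Forms φ) : dF (f • a) = dF (func f) * a + f • dF a := by
  rw [← func_mul, dF_mul, parity_func, func_mul]

theorem koszul_smul (π : Bivec φ) (f : A) (a : Forms φ) :
    koszul π (f • a) = f • koszul π a + contract (sharp φ π (dk 0 (fn φ f))) a := by
  rw [koszul_apply, dF_smul, map_add, contractBi_dF_mul, map_smul, map_smul, dF_smul,
    koszul_apply, smul_sub]
  abel

/-- Invariance of the bivector under the diffeomorphism. The difference of `i_π` and its conjugate
by `Ad^†` is linear over functions and commutes with contractions, so it suffices to test it on `df
∧ dg`, where it measures whether `φ` preserves the bracket of functions. -/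
theorem AdtF_contractBi {n : ℕ} (H : HasLocalFrames φ n) {π : Bivec φ} (hπ : IsHomPoisson φ π)
    (a : Forms φ) : AdtF φ (contractBi π a) = contractBi π (AdtF φ a) := by
  obtain ⟨T, hTdef⟩ : ∃ T : Forms φ →ₗ[A] Forms φ,
      ∀ a, T a = AdtF φ (contractBi π (AdtInvF φ a)) - contractBi π a := ⟨
    { toFun := fun a => AdtF φ (contractBi π (AdtInvF φ a)) - contractBi π a
      map_add' := fun a b => by simp only [map_add]; abel
      map_smul' := fun f a => by
        have h : AdtInvF φ (f • a) = φ.symm f • AdtInvF φ a := by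
          conv_lhs => rw [← AdtF_AdtInvF a, ← φ.apply_symm_apply f, ← AdtF_smul, AdtInvF_AdtF]
        rw [h, map_smul, AdtF_smul, map_smul, φ.apply_symm_apply, RingHom.id_apply, smul_sub] },
    fun _ => rfl⟩
  have hT : T (AdtF φ a) = 0 := by
    refine H.operator_eq_zero T 2 ?_ ?_ ?_ _
    · intro X a h
      rw [← h]
      have h2 : AdtInvF φ (contract X a) = contract ((Ad φ).symm X) (AdtInvF φ a) := by
        rw [← AdtInvF_AdtF (contract _ (AdtInvF φ a)), AdtF_contract, AdtF_AdtInvF,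
          LinearEquiv.apply_symm_apply]
      rw [hTdef, hTdef, map_sub, contract_contractBi, h2, contract_AdtF, contract_contractBi]
    · intro k hk Ξ
      rw [hTdef, map_sub, AdtInvF_inDeg, value_AdtF]
      rcases k with _ | _ | _ | k
      · simp
      · simp
      · exact absurd rfl hk
      · rw [contractBi_inDeg_add_two, contractBi_inDeg_add_two]; simp
    · refine decomposables_two_le fun f g => ?_
      rw [LinearMap.mem_ker, hTdef, contractBi_dF_dF]
      have h3 : AdtInvF φ (dF (func f) * dF (func g)) =
          dF (func (φ.symm f)) * dF (func (φ.symm g)) := by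
        rw [← AdtInvF_AdtF (dF (func (φ.symm f)) * dF (func (φ.symm g))), AdtF_mul, AdtF_dF,
          AdtF_dF, AdtF_func, AdtF_func, φ.apply_symm_apply, φ.apply_symm_apply]
      rw [h3, contractBi_dF_dF, AdtF_func, map_untwistedBr hπ, φ.apply_symm_apply,
        φ.apply_symm_apply, sub_self]
  rw [hTdef, AdtInvF_AdtF, sub_eq_zero] at hT
  exact hT

theorem AdtF_koszul {n : ℕ} (H : HasLocalFrames φ n) {π : Bivec φ} (hπ : IsHomPoisson φ π)
    (a : Forms φ) : AdtF φ (koszul π a) = koszul π (AdtF φ a) := by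
  rw [koszul_apply, map_sub, AdtF_contractBi H hπ, AdtF_dF, AdtF_dF, AdtF_contractBi H hπ]; rfl

/-- The commutator of `i_π` and `L_Z` is contraction with a bivector, namely a Lie derivative of `π`
up to sign, and contractions with bivectors commute. The form of the statement avoids constructing
that bivector. -/
theorem contractBi_lie_commutator (π π' : Bivec φ) (Z : Vec φ) (a : Forms φ) :
    contractBi π' (contractBi π (lie Z a) - lie Z (contractBi π a)) =
      contractBi π (lie Z (contractBi π' a)) - lie Z (contractBi π (contractBi π' a)) := by
  induction π using bivec_induction with
  | zero => simp [contractBi_zero]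
  | hdec X Y =>
    have h : ∀ b : Forms φ, contract Y (contract X (lie Z b)) - lie Z (contract Y (contract X b)) =
        -contract (comm Z Y) (contract X b) - contract Y (contract (comm Z X) b) := by
      intro b
      rw [contract_lie, map_sub, contract_lie]; abel
    simp only [contractBi_ιMulti, h]
    simp only [map_sub, map_neg, contract_contractBi]
  | add π₁ π₂ h h' =>
    simp only [contractBi_add, map_add, map_sub] at h h' ⊢
    have h2 := congrArg₂ (· + ·) h h'
    rw [← sub_eq_zero] at h2 ⊢
    refine Eq.trans ?_ h2
    abel

theorem contract_koszul (π : Bivec φ) (X : Vec φ) (a : Forms φ) :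
    contract X (koszul π a) =
      contractBi π (lie X a) - lie X (contractBi π a) - koszul π (contract X a) := by
  rw [koszul_apply, map_sub, contract_contractBi, contract_dF, contract_dF, map_sub,
    contract_contractBi, koszul_apply]
  abel

/-- The commutator `T` of `Δ` and `i_π` plays the role of contraction with the trivector `[π, π]`.
The derivative terms of `koszul_smul` cancel, so `T` is linear over functions; it anticommutes with
contractions by `contractBi_lie_commutator`; and it lowers degrees by three. Hence it is enough to
compute it on `df ∧ dg ∧ dh`. -/
theorem koszul_contractBi {n : ℕ} (H : HasLocalFrames φ n) {π : Bivec φ}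
    (hπ : IsHomPoisson φ π) (a : Forms φ) :
    koszul π (contractBi π a) = contractBi π (koszul π a) := by
  obtain ⟨T, hTdef⟩ : ∃ T : Forms φ →ₗ[A] Forms φ,
      ∀ a, T a = koszul π (contractBi π a) - contractBi π (koszul π a) := ⟨
    { toFun := fun a => koszul π (contractBi π a) - contractBi π (koszul π a)
      map_add' := fun a b => by simp only [map_add]; abel
      map_smul' := fun f a => by
        rw [map_smul, koszul_smul, koszul_smul, map_add, map_smul, contract_contractBi,
          RingHom.id_apply, smul_sub]
        abel },
    fun _ => rfl⟩
  have hT : T a = 0 := by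
    refine H.operator_eq_zero T 3 ?_ ?_ ?_ _
    · intro X a h
      rw [hTdef] at h ⊢
      rw [map_sub, contract_koszul, contract_contractBi, contract_contractBi, contract_koszul,
        map_sub (contractBi π), contractBi_lie_commutator, sub_sub_sub_cancel_left, ← neg_sub, h,
        neg_zero]
    · intro k hk Ξ
      rw [hTdef, map_sub]
      rcases k with _ | _ | _ | k
      · rw [contractBi_inDeg_zero, koszul_inDeg_zero]; simp
      · obtain ⟨Θ, hΘ⟩ := exists_koszul_inDeg_succ π Ξ
        rw [contractBi_inDeg_one, hΘ]; simp
      · obtain ⟨Θ, hΘ⟩ := exists_koszul_inDeg_succ π Ξ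
        rw [contractBi_inDeg_add_two, koszul_inDeg_zero, hΘ]; simp
      · obtain ⟨Θ, hΘ⟩ := exists_koszul_inDeg_succ π Ξ
        obtain ⟨Θ', hΘ'⟩ := exists_koszul_inDeg_succ π (contr φ (k + 1) π Ξ)
        rw [contractBi_inDeg_add_two, hΘ, hΘ', contractBi_inDeg_add_two]
        rcases k with _ | k
        · exact absurd rfl hk
        · simp
    · refine decomposables_three_le fun f g h => ?_
      rw [LinearMap.mem_ker, hTdef]
      have h1 : contractBi π (dF (func f) * (dF (func g) * dF (func h))) =
          untwistedBr π f g • dF (func h) - untwistedBr π f h • dF (func g) +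
            untwistedBr π g h • dF (func f) := by
        rw [contractBi_dF_mul, contractBi_dF_dF, contract_mul, contract_sharp_dF,
          contract_sharp_dF, parity_dF_func, func_mul, mul_func, mul_func, smul_neg]
        abel
      have h2 : ∀ u v : A, koszul π (u • dF (func v)) = func (untwistedBr π u v) := by
        intro u v
        rw [koszul_smul, koszul_dF, koszul_func, map_zero, neg_zero, smul_zero, zero_add,
          contract_sharp_dF]
      have h3 : ∀ u v : A, dF (u • dF (func v) : Forms φ) = dF (func u) * dF (func v) := by
        intro u v
        rw [← func_mul, dF_mul, dF_dF, mul_zero, add_zero]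
      -- Products of exact forms are closed, so only the term `-d i_π` of `Δ` remains.
      have h4 : koszul π (dF (func f) * (dF (func g) * dF (func h))) =
          -dF (contractBi π (dF (func f) * (dF (func g) * dF (func h)))) := by
        rw [koszul_apply, dF_mul, dF_mul, dF_dF, dF_dF, dF_dF]
        simp
      have h5 := untwistedBr_jacobi hπ f g h
      rw [h4, h1]
      simp only [map_add, map_sub, map_neg, h2, h3, contractBi_dF_dF]
      simp only [← map_add, ← map_sub, ← map_neg]
      -- Both halves of the commutator give the same cyclic sum, hence the doubled expression;
      -- skew-symmetry identifies it with `-2` times the Jacobiator.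
      rw [show untwistedBr π (untwistedBr π f g) h - untwistedBr π (untwistedBr π f h) g +
        untwistedBr π (untwistedBr π g h) f - -(untwistedBr π (untwistedBr π f g) h -
        untwistedBr π (untwistedBr π f h) g + untwistedBr π (untwistedBr π g h) f) = 0 from ?_,
        map_zero]
      have h6 : untwistedBr π (untwistedBr π f h) g =
          -untwistedBr π g (untwistedBr π f h) := untwistedBr_skew π _ _
      have h7 : untwistedBr π g (untwistedBr π f h) = -untwistedBr π g (untwistedBr π h f) := by
        rw [untwistedBr_skew π f h, untwistedBr, map_neg]; rfl
      rw [h6, h7, untwistedBr_skew π (untwistedBr π f g), untwistedBr_skew π (untwistedBr π g h)]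
      linear_combination (-2 : A) * h5
  rwa [hTdef, sub_eq_zero] at hT

/-- `Δ` commutes with `i_π` and anticommutes with `d`, hence anticommutes with their commutator,
which is `Δ` itself; and `2` is invertible. -/
theorem koszul_koszul {n : ℕ} (H : HasLocalFrames φ n) {π : Bivec φ} (hπ : IsHomPoisson φ π)
    (a : Forms φ) : koszul π (koszul π a) = 0 := by
  have h : koszul π (koszul π a) = -koszul π (koszul π a) := by
    conv_lhs => rw [koszul_apply π a, map_sub, koszul_contractBi H hπ, koszul_dF, koszul_dF,
      koszul_contractBi H hπ, map_neg]
    rw [koszul_apply π (koszul π a)]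
    abel
  have h2 : (2 : ℝ) • koszul π (koszul π a) = 0 := by
    rw [two_smul]; nth_rewrite 1 [h]; rw [neg_add_cancel]
  have h3 := congrArg (fun x => (2⁻¹ : ℝ) • x) h2
  simpa [smul_smul] using h3

end Poisson

section Gerstenhaber

variable {A : Type*} [CommRing A] [Algebra ℝ A] {φ : A ≃ₐ[ℝ] A}

/-! ### Hom-Gerstenhaber identities from `koszul² = 0` -/

theorem HasParity.koszulBr {i j : ℕ} {a b : Forms φ} (ha : HasParity i a) (hb : HasParity j b)
    (π : Bivec φ) : HasParity (i + j + 1) (koszulBr π a b) := by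
  have h1 := (ha.mul hb).koszul π
  have h2 := (ha.koszul π).mul hb
  have h3 := ha.mul (hb.koszul π)
  rw [show i + 1 + j = i + j + 1 by ring] at h2
  rw [← add_assoc] at h3
  rw [koszulBr_apply, ha.neg_one_pow, smul_mul_assoc, map_smul, map_smul, smul_mul_assoc]
  rw [HasParity] at *
  simp only [map_sub, LinearMap.map_smul_of_tower, h1, h2, h3, smul_sub]
  rw [smul_comm, smul_comm ((-1 : ℝ) ^ i)]

/-- Apply `Δ` to the product formula `koszul_mul`. The terms with `Δ²` vanish and the products `Δa ·
Δb` cancel, leaving brackets only. -/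
theorem koszul_koszulBr {n : ℕ} (H : HasLocalFrames φ n) {π : Bivec φ} (hπ : IsHomPoisson φ π)
    {i : ℕ} {a : Forms φ} (ha : HasParity i a) (b : Forms φ) :
    koszul π (koszulBr π a b) =
      koszulBr π (koszul π a) b - (-1 : ℝ) ^ i • koszulBr π a (koszul π b) := by
  have h := congrArg (koszul π) (koszul_mul ha π b)
  rw [koszul_koszul H hπ] at h
  simp only [map_add, map_smul, koszul_mul (ha.koszul π), koszul_mul ha, koszul_koszul H hπ,
    mul_zero, zero_mul, add_zero, smul_add, smul_zero] at h
  rcases Nat.even_or_odd i with hi | hi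
  · simp only [hi.neg_one_pow, pow_succ] at h ⊢
    linear_combination (norm := module) -h
  · simp only [hi.neg_one_pow, pow_succ] at h ⊢
    linear_combination (norm := module) h

/-- Apply `Δ` to the Leibniz rule of the bracket and expand both sides with `koszul_mul` and
`koszul_koszulBr`. Everything containing `Δa`, `Δb` or `Δc` cancels and the three double brackets
remain; the four parity cases only settle signs. -/
theorem koszulBr_jacobi {n : ℕ} (H : HasLocalFrames φ n) {π : Bivec φ} (hπ : IsHomPoisson φ π)
    {i j : ℕ} {a b : Forms φ} (ha : HasParity i a) (hb : HasParity j b) (c : Forms φ) :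
    koszulBr π a (koszulBr π b c) = koszulBr π (koszulBr π a b) c +
      (-1 : ℝ) ^ ((i + 1) * (j + 1)) • koszulBr π b (koszulBr π a c) := by
  have h := congrArg (koszul π) (koszulBr_mul ha hb π c)
  have hD := koszul_koszulBr H hπ ha
  rw [hD] at h
  simp only [map_add, map_smul, koszul_mul hb, koszul_mul (ha.koszulBr hb π), hD,
    koszulBr_mul ha hb, koszulBr_mul (ha.koszul π) hb, koszulBr_mul ha (hb.koszul π)] at h
  rcases Nat.even_or_odd i with hi | hi <;> rcases Nat.even_or_odd j with hj | hj
  all_goals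
    simp only [pow_add, pow_mul, hi.neg_one_pow, hj.neg_one_pow, pow_one, one_pow, mul_one,
      mul_neg, neg_neg, sub_mul, mul_sub, smul_mul_assoc, mul_smul_comm] at h ⊢
  · linear_combination (norm := module) -h
  · linear_combination (norm := module) h
  · linear_combination (norm := module) h
  · linear_combination (norm := module) -h

/-! ### Agreement with the cotangent bracket -/

theorem lie_smul_one_form (f : A) (X : Vec φ) (η : Form φ 1) :
    lie (f • X) (inDeg 1 η) = f • lie X (inDeg 1 η) + (η fun _ => X) • dF (func f) := by
  rw [lie_apply, contract_smul, contract_smul, dF_smul, lie_apply, contract_inDeg_one, mul_func,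
    smul_add]
  abel

theorem func_mul_eq_smul (f g : A) : (func (f * g) : Forms φ) = f • func g := by
  rw [← smul_eq_mul, map_smul]

theorem lie_add (X Y : Vec φ) (a : Forms φ) : lie (X + Y) a = lie X a + lie Y a := by
  simp only [lie_apply, contract_add, map_add]; abel

theorem lie_zero (a : Forms φ) : lie 0 a = 0 := by
  have h := lie_add 0 0 a
  rwa [add_zero, left_eq_add] at h

theorem pairing_wedge_ιMulti (X Y : Vec φ) (ξ η : Form φ 1) :
    pairing φ (exteriorPower.ιMulti A 2 ![X, Y]) (wedge 1 1 ξ η) =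
      (ξ fun _ => X) * (η fun _ => Y) - (ξ fun _ => Y) * (η fun _ => X) := by
  rw [pairing_decomposable, wedge_one_one]

/-- By additivity take `π = X ∧ Y`. The coefficients of `π^♯ ξ` and `π^♯ η` depend on the forms, so
the Lie derivatives along them contain differentials such as `d(ξ(X))`; the exact term removes
precisely these. -/
theorem koszulBr_one_forms (π : Bivec φ) (ξ η : Form φ 1) :
    koszulBr π (inDeg 1 ξ) (inDeg 1 η) =
      lie (sharp φ π ξ) (inDeg 1 η) - lie (sharp φ π η) (inDeg 1 ξ) -
        dF (func (pairing φ π (wedge 1 1 ξ η))) := by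
  induction π using bivec_induction with
  | zero =>
    have h (ζ : Form φ 1) : sharp φ 0 ζ = 0 := by simp [sharp]
    rw [koszulBr_zero, h, h, lie_zero, lie_zero]
    simp [pairing]
  | add π₁ π₂ h h' =>
    have hs (ζ : Form φ 1) : sharp φ (π₁ + π₂) ζ = sharp φ π₁ ζ + sharp φ π₂ ζ := by
      simp [sharp]
    have hp (Θ : Form φ 2) : pairing φ (π₁ + π₂) Θ = pairing φ π₁ Θ + pairing φ π₂ Θ := by
      simp [pairing]
    rw [koszulBr_add, h, h', hs, hs, hp, lie_add, lie_add, map_add, map_add]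
    abel
  | hdec X Y =>
    have h1 : parity (inDeg 1 ξ : Forms φ) = -inDeg 1 ξ := by
      rw [parity_inDeg, pow_one, neg_one_smul]
    have hs (ζ : Form φ 1) : sharp φ (exteriorPower.ιMulti A 2 ![X, Y]) ζ =
        (ζ fun _ => X) • Y + (-(ζ fun _ => Y)) • X := by
      rw [sharp_ιMulti, neg_smul, sub_eq_add_neg]
    have hd (f g : A) : dF (func (f * g) : Forms φ) = f • dF (func g) + g • dF (func f) := by
      rw [func_mul_eq_smul, dF_smul,
        mul_func, add_comm]
    rw [koszulBr_ιMulti, h1, hs, hs, lie_add, lie_add, lie_smul_one_form, lie_smul_one_form,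
      lie_smul_one_form, lie_smul_one_form, pairing_wedge_ιMulti, map_sub, map_sub, hd, hd,
      map_neg, map_neg, contract_inDeg_one, contract_inDeg_one, contract_inDeg_one,
      contract_inDeg_one, mul_func, mul_func, neg_mul, neg_mul, func_mul, func_mul]
    simp only [map_neg, smul_neg, neg_smul]
    abel

theorem koszulBr_one_func (π : Bivec φ) (ξ : Form φ 1) (f : A) :
    koszulBr π (inDeg 1 ξ) (func f) = func (der (sharp φ π ξ) f) := by
  induction π using bivec_induction with
  | zero =>
    have h : sharp φ 0 ξ = (0 : A) • 0 := by simp [sharp]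
    rw [koszulBr_zero, h, der_smul]
    simp
  | add π₁ π₂ h h' =>
    have hs : sharp φ (π₁ + π₂) ξ = sharp φ π₁ ξ + sharp φ π₂ ξ := by simp [sharp]
    rw [koszulBr_add, h, h', hs, der_add, map_add]
  | hdec X Y =>
    have h1 : parity (inDeg 1 ξ : Forms φ) = -inDeg 1 ξ := by
      rw [parity_inDeg, pow_one, neg_one_smul]
    rw [koszulBr_ιMulti, h1, sharp_ιMulti, sub_eq_add_neg (G := Vec φ), ← neg_smul, der_add, der_smul,
      der_smul, map_neg, map_neg, contract_inDeg_one, contract_inDeg_one, lie_func, lie_func,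
      contract_func, contract_func, neg_mul, neg_mul, func_mul, func_mul, map_add, neg_mul,
      map_neg, func_mul_eq_smul, func_mul_eq_smul]
    simp
    abel

/-- The hom-Gerstenhaber bracket on forms. -/
def cotangentBr (π : Bivec φ) : Forms φ →ₗ[ℝ] Forms φ →ₗ[ℝ] Forms φ :=
  (koszulBr π).compr₂ (AdtF φ)

theorem cotangentBr_apply (π : Bivec φ) (a b : Forms φ) :
    cotangentBr π a b = AdtF φ (koszulBr π a b) := rfl

/-- In both terms of the definition the inverse `Ad^†` cancels the one hidden in `d` or in the
contraction, and one outer `Ad^†` is left over. -/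
theorem lieD_eq (X : Vec φ) (η : Form φ 1) :
    (inDeg 1 (lieD φ 0 X η) : Forms φ) = AdtF φ (lie X (inDeg 1 η)) := by
  have e1 : (inDeg 1 (lieD φ 0 X η) : Forms φ) =
      inDeg 1 (inner φ 1 X (extD φ 1 ((Adt φ 1).symm η))) +
      inDeg 1 (extD φ 0 (inner φ 0 ((Ad φ).symm X) ((Adt φ 1).symm η))) := inDeg_add _ _ _
  have e2 : ∀ (k : ℕ) (Z : Vec φ) (Ξ : Form φ (k + 1)), (inDeg k (inner φ k Z Ξ) : Forms φ) =
      AdtF φ (contract Z (inDeg (k + 1) Ξ)) := by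
    intro k Z Ξ
    rw [AdtF_contract, AdtF_inDeg, contract_inDeg_succ]; rfl
  have e3 : ∀ (k : ℕ) (Ξ : Form φ k), (inDeg (k + 1) (extD φ k Ξ) : Forms φ) =
      dF (AdtF φ (inDeg k Ξ)) := by
    intro k Ξ
    rw [inDeg_extD, AdtF_inDeg]
  have e4 : (inDeg 1 ((Adt φ 1).symm η) : Forms φ) = AdtInvF φ (inDeg 1 η) :=
    (AdtInvF_inDeg η).symm
  rw [e1, e2, e3, e3, e2, e4, AdtF_AdtInvF, ← contract_AdtF, AdtF_AdtInvF, lie_apply, map_add,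
    AdtF_dF (contract X _)]

theorem cotangentBr_one_forms (π : Bivec φ) (ξ η : Form φ 1) :
    cotangentBr π (inDeg 1 ξ) (inDeg 1 η) = inDeg 1 (cotBr φ π ξ η) := by
  have h1 : (inDeg 1 (cotBr φ π ξ η) : Forms φ) = inDeg 1 (lieD φ 0 (sharp φ π ξ) η) -
      inDeg 1 (lieD φ 0 (sharp φ π η) ξ) -
      inDeg 1 (extD φ 0 (fn φ (pairing φ π (wedge 1 1 ξ η)))) := by
    rw [← (DirectSum.lof ℝ ℕ (Form φ) 1).map_sub, ← (DirectSum.lof ℝ ℕ (Form φ) 1).map_sub]; rfl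
  rw [h1, lieD_eq, lieD_eq, extD_fn, ← dF_func_eq, cotangentBr_apply, koszulBr_one_forms, map_sub,
    map_sub, AdtF_dF, AdtF_func]

/-- Invariance of `π` in terms of `π^♯`: pair both sides with an exact form `dg`, using `i_π(ζ ∧ dg)
= π^♯ζ(g)`. -/
theorem Ad_sharp {n : ℕ} (H : HasLocalFrames φ n) {π : Bivec φ} (hπ : IsHomPoisson φ π)
    (ξ : Form φ 1) : Ad φ (sharp φ π ξ) = sharp φ π (Adt φ 1 ξ) := by
  refine der_ext fun f => ?_
  have h1 : ∀ (ζ : Form φ 1) (g : A),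
      contractBi π (inDeg 1 ζ * dF (func g)) = func (der (sharp φ π ζ) g) := by
    intro ζ g
    rw [contractBi_one_form_mul, contract_dF_func, contractBi_dF_func, mul_zero, add_zero]
  obtain ⟨g, rfl⟩ := φ.surjective f
  have h2 := congrArg (AdtF φ) (h1 ξ g)
  rw [AdtF_contractBi H hπ, AdtF_mul, AdtF_inDeg, AdtF_dF, AdtF_func, h1, AdtF_func,
    ← der_Ad] at h2
  have := congrArg value h2
  rw [value_func, value_func] at this
  exact this.symm

end Gerstenhaber

section Main

variable {A : Type*} [CommRing A] [Algebra ℝ A] {φ : A ≃ₐ[ℝ] A}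

/-! ### The hom-Gerstenhaber algebra of forms -/

theorem AdtF_koszulBr {n : ℕ} (H : HasLocalFrames φ n) {π : Bivec φ} (hπ : IsHomPoisson φ π)
    (a b : Forms φ) : AdtF φ (koszulBr π a b) = koszulBr π (AdtF φ a) (AdtF φ b) := by
  simp only [koszulBr_apply, map_sub, AdtF_koszul H hπ, AdtF_mul, parity_AdtF]

theorem homPoissonOp_eq {n : ℕ} (H : HasLocalFrames φ n) {π : Bivec φ} (hπ : IsHomPoisson φ π)
    (a : Forms φ) : homPoissonOp φ π a = AdtF φ (koszul π a) := by
  change AdtF φ (innerF φ π (AdtInvF φ (extDF φ (AdtInvF φ a)))) -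
      AdtF φ (extDF φ (AdtInvF φ (innerF φ π (AdtInvF φ a)))) = _
  have h (b : Forms φ) : AdtF φ (contractBi π (AdtInvF φ b)) = contractBi π b := by
    rw [AdtF_contractBi H hπ, AdtF_AdtInvF]
  rw [extDF_eq, extDF_eq, AdtF_AdtInvF, AdtF_AdtInvF, innerF_eq, innerF_eq, h, h, koszul_apply,
    map_sub]

theorem cotangentBr_func {n : ℕ} (H : HasLocalFrames φ n) {π : Bivec φ} (hπ : IsHomPoisson φ π)
    (ξ : Form φ 1) (f : A) :
    cotangentBr π (inDeg 1 ξ) (func f) = func (act (cotAnchor φ π ξ) f) := by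
  rw [cotangentBr_apply, koszulBr_one_func, AdtF_func, act_eq_der, ← der_Ad, Ad_sharp H hπ]
  rfl

theorem cotangentBr_degree (π : Bivec φ) (i j : ℕ) (x : Form φ i) (y : Form φ j) (k : ℕ)
    (hk : k + 1 ≠ i + j) : cotangentBr π (inDeg i x) (inDeg j y) k = 0 := by
  have hD : ∀ l (z : Form φ l), k + 1 ≠ l → koszul π (inDeg l z) k = 0 := by
    intro l z hl
    rcases l with _ | l
    · rw [koszul_inDeg_zero]; rfl
    · obtain ⟨Θ, hΘ⟩ := exists_koszul_inDeg_succ π z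
      rw [hΘ, inDeg_apply_ne (by omega)]
  have h1 : koszul π (inDeg i x * inDeg j y) k = 0 := by
    rw [← wedgeF_eq_mul, wedgeF_inDeg]; exact hD _ _ hk
  have h2 : (koszul π (inDeg i x) * inDeg j y) k = 0 := by
    rcases i with _ | i
    · rw [koszul_inDeg_zero, zero_mul]; rfl
    · obtain ⟨Θ, hΘ⟩ := exists_koszul_inDeg_succ π x
      rw [hΘ, ← wedgeF_eq_mul, wedgeF_inDeg, inDeg_apply_ne (by omega)]
  have h3 : (inDeg i x * koszul π (inDeg j y)) k = 0 := by
    rcases j with _ | j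
    · rw [koszul_inDeg_zero, mul_zero]; rfl
    · obtain ⟨Θ, hΘ⟩ := exists_koszul_inDeg_succ π y
      rw [hΘ, ← wedgeF_eq_mul, wedgeF_inDeg, inDeg_apply_ne (by omega)]
  have h4 : ∀ a : Forms φ, a k = 0 → AdtF φ a k = 0 := by
    intro a ha
    change DirectSum.lmap (fun k => (Adt φ k).toLinearMap) a k = 0
    rw [DirectSum.lmap_apply, ha, map_zero]
  rw [cotangentBr_apply]
  refine h4 _ ?_
  rw [koszulBr_apply, (hasParity_inDeg i x).neg_one_pow, smul_mul_assoc, map_smul, map_smul,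
    smul_mul_assoc, DirectSum.sub_apply, DirectSum.sub_apply, DirectSum.smul_apply,
    DirectSum.smul_apply, h1, h2, h3, smul_zero, sub_zero, sub_zero]

theorem koszulBr_jacobi_cyclic {n : ℕ} (H : HasLocalFrames φ n) {π : Bivec φ}
    (hπ : IsHomPoisson φ π) {i j k : ℕ} {a b c : Forms φ} (ha : HasParity i a)
    (hb : HasParity j b) (hc : HasParity k c) :
    (-1 : ℝ) ^ ((i + 1) * (k + 1)) • koszulBr π a (koszulBr π b c) +
      (-1 : ℝ) ^ ((j + 1) * (i + 1)) • koszulBr π b (koszulBr π c a) +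
      (-1 : ℝ) ^ ((k + 1) * (j + 1)) • koszulBr π c (koszulBr π a b) = 0 := by
  rw [koszulBr_jacobi H hπ ha hb c, koszul_mul_comm hc ha π,
    koszul_mul_comm hc (ha.koszulBr hb π), map_neg, map_smul]
  have e : (-1 : ℝ) ^ ((k + 1) * (i + j + 1 + 1)) =
      (-1) ^ ((k + 1) * (i + 1)) * (-1) ^ ((k + 1) * (j + 1)) := by rw [← pow_add]; congr 1; ring
  have e2 : (-1 : ℝ) ^ ((i + 1) * (k + 1)) = (-1) ^ ((k + 1) * (i + 1)) := by rw [mul_comm]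
  have e3 : (-1 : ℝ) ^ ((j + 1) * (i + 1)) = (-1) ^ ((i + 1) * (j + 1)) := by rw [mul_comm]
  have e4 : (-1 : ℝ) ^ ((k + 1) * (j + 1)) * (-1) ^ ((k + 1) * (j + 1)) = 1 := by
    rw [← mul_pow]; simp
  rw [e, e2, e3]
  match_scalars
  · linear_combination (-(-1 : ℝ) ^ ((k + 1) * (i + 1))) * e4
  · ring

/-- `Ad^†` is an automorphism of both the product and the untwisted bracket. The hom-Leibniz rule is
therefore `Ad^†` applied to the ordinary one, and the hom-Jacobi identity is `Ad^†` applied twice.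
-/
theorem isHomGerstenhaber_forms {n : ℕ} (H : HasLocalFrames φ n) {π : Bivec φ}
    (hπ : IsHomPoisson φ π) :
    IsHomGerstenhaber (oneForm φ) (wedgeF φ) (cotangentBr π) (AdtF φ) where
  algebra := isGradedCommAlgebra_forms
  map_degree i x k hk := by rw [AdtF_inDeg, inDeg_apply_ne hk]
  map_one := AdtF_one
  map_mul := AdtF_mul
  map_bracket a b := by
    simp only [cotangentBr_apply, AdtF_koszulBr H hπ]
  degree := cotangentBr_degree π
  skew i j x y := by
    rw [cotangentBr_apply, koszul_mul_comm (hasParity_inDeg i x) (hasParity_inDeg j y), map_neg,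
      map_smul]
    rfl
  hom_jacobi i j k x y z := by
    have h := koszulBr_jacobi_cyclic H hπ (hasParity_inDeg i x) (hasParity_inDeg j y)
      (hasParity_inDeg k z)
    simp only [cotangentBr_apply, ← AdtF_koszulBr H hπ]
    rw [← map_smul (AdtF φ), ← map_smul (AdtF φ), ← map_smul (AdtF φ), ← map_smul (AdtF φ),
      ← map_smul (AdtF φ), ← map_smul (AdtF φ), ← map_add, ← map_add, ← map_add, ← map_add, h,
      map_zero, map_zero]
  hom_leibniz i j k x y z := by
    have h := koszulBr_mul (hasParity_inDeg i x) (hasParity_inDeg j y) π (inDeg k z)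
    simp only [wedgeF_eq_mul, cotangentBr_apply]
    rw [h, map_add, map_smul, AdtF_mul, AdtF_mul]

theorem isCotangentGerstenhaber_cotangentBr {n : ℕ} (H : HasLocalFrames φ n) {π : Bivec φ}
    (hπ : IsHomPoisson φ π) : IsCotangentGerstenhaber φ π (cotangentBr π) where
  gerstenhaber := isHomGerstenhaber_forms H hπ
  extends_bracket := cotangentBr_one_forms π
  extends_anchor := cotangentBr_func H hπ

/-- For a fixed first entry the difference of two such brackets is a twisted derivation in the
second, so agreement on functions and `1`-forms suffices (`key`). Prescribed values, vanishing on
pairs of functions and skew-symmetry give agreement for first entries of degree `1` and `0`;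
skew-symmetry then reaches every degree. -/
theorem cotangentBr_unique {n : ℕ} (H : HasLocalFrames φ n) {π : Bivec φ}
    {br br' : Forms φ →ₗ[ℝ] Forms φ →ₗ[ℝ] Forms φ} (h : IsCotangentGerstenhaber φ π br)
    (h' : IsCotangentGerstenhaber φ π br') : br' = br := by
  have key : ∀ i (x : Form φ i), (∀ f, br' (inDeg i x) (func f) = br (inDeg i x) (func f)) →
      (∀ ξ : Form φ 1, br' (inDeg i x) (inDeg 1 ξ) = br (inDeg i x) (inDeg 1 ξ)) →
      br' (inDeg i x) = br (inDeg i x) := by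
    intro i x h0 h1
    rw [← sub_eq_zero]
    refine H.derivation_eq_zero _ (fun j => (-1 : ℝ) ^ ((i + 1) * j)) (by simp) ?_ ?_ ?_
    · intro j k y z
      have e := h.gerstenhaber.hom_leibniz i j k x y z
      have e' := h'.gerstenhaber.hom_leibniz i j k x y z
      simp only [wedgeF_eq_mul] at e e'
      simp only [LinearMap.sub_apply, e, e', sub_mul, mul_sub, smul_sub]
      abel
    · intro f; rw [LinearMap.sub_apply, h0, sub_self]
    · intro ξ; rw [LinearMap.sub_apply, h1, sub_self]
  have b11 : ∀ ξ η : Form φ 1, br' (inDeg 1 ξ) (inDeg 1 η) = br (inDeg 1 ξ) (inDeg 1 η) := by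
    intro ξ η; rw [h.extends_bracket, h'.extends_bracket]
  have b10 : ∀ (ξ : Form φ 1) (f : A), br' (inDeg 1 ξ) (func f) = br (inDeg 1 ξ) (func f) := by
    intro ξ f; rw [func_eq, h.extends_anchor, h'.extends_anchor]
  -- The bracket of two functions would have degree `-1`.
  have b00 : ∀ f g : A, br' (func f) (func g) = br (func f) (func g) := by
    intro f g
    have e : ∀ b, IsCotangentGerstenhaber φ π b → b (func f) (func g) = 0 := by
      intro b hb
      exact DFinsupp.ext fun k => hb.gerstenhaber.degree 0 0 _ _ k (by omega)
    rw [e _ h, e _ h']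
  have swap : ∀ i j (x : Form φ i) (y : Form φ j), br' (inDeg i x) (inDeg j y) =
      br (inDeg i x) (inDeg j y) → br' (inDeg j y) (inDeg i x) = br (inDeg j y) (inDeg i x) := by
    intro i j x y e
    rw [h.gerstenhaber.skew, h'.gerstenhaber.skew, e]
  have B1 : ∀ ξ : Form φ 1, br' (inDeg 1 ξ) = br (inDeg 1 ξ) := fun ξ =>
    key 1 ξ (b10 ξ) (b11 ξ)
  have B0 : ∀ f : A, br' (func f) = br (func f) := fun f =>
    key 0 _ (b00 f) fun ξ => swap 1 0 ξ _ (b10 ξ f)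
  refine LinearMap.ext fun a => ?_
  induction a using forms_induction with
  | zero => simp
  | add a b ha hb => rw [map_add, map_add, ha, hb]
  | hdeg i x =>
    refine key i x (fun f => ?_) (fun ξ => ?_)
    · exact swap 0 i _ x (by rw [← func_eq, B0])
    · exact swap 1 i ξ x (by rw [B1])

end Main

section TopDegree

variable {A : Type*} [CommRing A] [Algebra ℝ A] {φ : A ≃ₐ[ℝ] A}

/-! ### The cotangent hom-Lie algebroid -/

theorem inDeg_neg {k : ℕ} (Ξ : Form φ k) : (inDeg k (-Ξ) : Forms φ) = -inDeg k Ξ := map_neg _ _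

theorem inDeg_sub {k : ℕ} (Ξ Θ : Form φ k) :
    (inDeg k (Ξ - Θ) : Forms φ) = inDeg k Ξ - inDeg k Θ := map_sub _ _ _

theorem inDeg_zero (k : ℕ) : (inDeg k (0 : Form φ k) : Forms φ) = 0 := map_zero _

theorem func_injective {f g : A} (h : (func f : Forms φ) = func g) : f = g := by
  rw [← value_func (φ := φ) f, h, value_func]

/-- The algebroid axioms involving the bracket are low-degree cases of the Gerstenhaber identities:
Jacobi in degrees `1, 1, 1`, the anchor representation in degrees `1, 1, 0`, and the Leibniz rule in
degrees `1, 0, 1`. -/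
theorem IsCotangentGerstenhaber.isHomLieAlgebroid {π : Bivec φ}
    {br : Forms φ →ₗ[ℝ] Forms φ →ₗ[ℝ] Forms φ} (h : IsCotangentGerstenhaber φ π br) :
    IsHomLieAlgebroid φ (cotBr φ π) (cotAnchor φ π) (Adt φ 1).toLinearMap where
  map_smul f x := Adt_smul f x
  homLie :=
    { skew := fun x y => fn_eq_of_inDeg <| by
        rw [inDeg_neg, ← h.extends_bracket, ← h.extends_bracket, h.gerstenhaber.skew]
        norm_num
      map_bracket := fun x y => fn_eq_of_inDeg <| by
        have e := h.gerstenhaber.map_bracket (inDeg 1 x) (inDeg 1 y)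
        rw [h.extends_bracket, AdtF_inDeg, AdtF_inDeg, AdtF_inDeg, h.extends_bracket] at e
        exact e
      hom_jacobi := fun x y z => fn_eq_of_inDeg <| by
        have e := h.gerstenhaber.hom_jacobi 1 1 1 x y z
        have e4 : (-1 : ℝ) ^ ((1 + 1) * (1 + 1)) = 1 := by norm_num
        simp only [e4, one_smul, AdtF_inDeg, h.extends_bracket] at e
        rw [inDeg_zero, inDeg_add, inDeg_add, ← e]
        rfl }
  leibniz x f y := fn_eq_of_inDeg <| by
    have e := h.gerstenhaber.hom_leibniz 1 0 1 x (fn φ f) y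
    rw [h.extends_anchor] at e
    simp only [wedgeF_eq_mul, ← func_eq, func_mul, AdtF_func] at e
    rw [smul_inDeg, h.extends_bracket, h.extends_bracket] at e
    rw [e, inDeg_add, ← smul_inDeg, ← smul_inDeg, mul_zero, pow_zero, one_smul, add_comm,
      AdtF_inDeg]
    rfl
  anchor_smul f x := by
    change sharp φ π (Adt φ 1 (f • x)) = φ f • sharp φ π (Adt φ 1 x)
    rw [Adt_smul, map_smul]
  anchor_rep :=
    { equivariant := fun x f => func_injective (φ := φ) <| by
        have e := h.gerstenhaber.map_bracket (inDeg 1 x) (inDeg 0 (fn φ f))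
        rw [h.extends_anchor, ← func_eq, ← func_eq, AdtF_func, AdtF_func, AdtF_inDeg,
          func_eq (φ f), h.extends_anchor] at e
        exact e.symm
      bracket := fun x y f => func_injective (φ := φ) <| by
        have e := h.gerstenhaber.hom_jacobi 1 1 0 x y (fn φ f)
        have skew : ∀ (ξ : Form φ 1) (g : A), br (func g) (inDeg 1 ξ) =
            -br (inDeg 1 ξ) (func g) := by
          intro ξ g
          rw [func_eq, h.gerstenhaber.skew]
          norm_num
        have anchor : ∀ (ξ : Form φ 1) (g : A), br (inDeg 1 ξ) (func g) =
            func (act (cotAnchor φ π ξ) g) := h.extends_anchor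
        have e2 : (-1 : ℝ) ^ ((1 + 1) * (0 + 1)) = 1 := by norm_num
        have e4 : (-1 : ℝ) ^ ((1 + 1) * (1 + 1)) = 1 := by norm_num
        simp only [← func_eq, e2, e4, one_smul, AdtF_inDeg, AdtF_func, h.extends_bracket, skew,
          anchor, map_neg] at e
        change func (act (cotAnchor φ π (cotBr φ π x y)) (φ f)) =
          func (act (cotAnchor φ π (Adt φ 1 x)) (act (cotAnchor φ π y) f) -
            act (cotAnchor φ π (Adt φ 1 y)) (act (cotAnchor φ π x) f))
        rw [map_sub]
        linear_combination (norm := module) -e }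

/-! ### Forms of top degree -/

/-- Multiplying all `k` arguments by `χ` expands them in the `n` fields `e`; since `k > n`, some
field is repeated in every term. -/
theorem HasLocalFrames.form_eq_zero_of_lt {n : ℕ} (H : HasLocalFrames φ n) {k : ℕ} (hk : n < k)
    (Ξ : Form φ k) : Ξ = 0 := by
  ext v
  refine H.eq_zero fun χ x e hf => ⟨k, ?_⟩
  have h1 : χ ^ k * Ξ v = Ξ fun i => χ • v i := by
    have := Ξ.map_smul_univ (fun _ => χ) v
    rw [this]; simp
  rw [h1]
  simp only [hf.expand]
  have h2 := Ξ.toMultilinearMap.map_sum (fun (i : Fin k) (j : Fin n) => der (v i) (x j) • e j)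
  refine h2.trans (Finset.sum_eq_zero fun r _ => ?_)
  have h3 := Ξ.map_smul_univ (fun i => der (v i) (x (r i))) (fun i => e (r i))
  refine h3.trans ?_
  rw [Ξ.map_eq_zero_of_not_injective, smul_zero]
  intro hr
  have := Fintype.card_le_of_injective r fun a b hab => hr (by simp [hab])
  simp at this
  omega

variable (φ) in
/-- The `n`-form `dx₁ ∧ ⋯ ∧ dx_n`. -/
def coordForm {n : ℕ} (x : Fin n → A) : Form φ n :=
  Matrix.detRowAlternating.compLinearMap
    { toFun := fun X i => der X (x i)
      map_add' := fun X Y => funext fun _ => der_add X Y _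
      map_smul' := fun f X => funext fun _ => der_smul f X _ }

theorem IsLocalFrame.coordForm_apply {n : ℕ} {χ : A} {x : Fin n → A} {e : Fin n → Vec φ}
    (hf : IsLocalFrame χ x e) : coordForm φ x e = χ ^ n := by
  change Matrix.det (fun i j => der (e i) (x j)) = χ ^ n
  have : (fun i j => der (e i) (x j)) = Matrix.diagonal fun _ : Fin n => χ := by
    ext i j; rw [hf.dual, Matrix.diagonal_apply]
  rw [this, Matrix.det_diagonal]
  simp

/-- The local volume form evaluated on its own frame is `χ^n`, so top forms detect functions. -/
theorem HasLocalFrames.eq_zero_of_smul_top {n : ℕ} (H : HasLocalFrames φ n) {f : A}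
    (h : ∀ μ : Form φ n, f • μ = 0) : f = 0 := by
  refine H.eq_zero fun χ x e hf => ⟨n, ?_⟩
  have := congrArg (fun μ : Form φ n => μ e) (h (coordForm φ x))
  rw [mul_comm, ← hf.coordForm_apply]
  exact this

/-! ### Exact generators -/

theorem eq_func_value {a : Forms φ} (h : ∀ k, k ≠ 0 → a k = 0) : a = func (value a) := by
  have : a = inDeg 0 (a 0) := DFinsupp.ext fun k => by
    by_cases hk : k = 0
    · subst hk; exact (inDeg_apply_self 0 (a 0)).symm
    · rw [h k hk]; exact (inDeg_apply_ne hk (a 0)).symm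
  rw [this, inDeg_zero_eq_func, value_func]

theorem isExactGenerator_homPoissonOp {n : ℕ} (H : HasLocalFrames φ n) {π : Bivec φ}
    (hπ : IsHomPoisson φ π) :
    IsExactGenerator (wedgeF φ) (cotangentBr π) (AdtF φ) (homPoissonOp φ π) where
  degree i x k hk := by
    rw [homPoissonOp_eq H hπ]
    rcases i with _ | i
    · rw [koszul_inDeg_zero, map_zero]; rfl
    · obtain ⟨Θ, hΘ⟩ := exists_koszul_inDeg_succ π x
      rw [hΘ, AdtF_inDeg, inDeg_apply_ne (by omega)]
  comm a := by rw [homPoissonOp_eq H hπ, homPoissonOp_eq H hπ, ← AdtF_koszul H hπ a]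
  generates i j x y := by
    have e : (-1 : ℝ) ^ i * (-1) ^ i = 1 := by rw [← mul_pow]; simp
    rw [homPoissonOp_eq H hπ, homPoissonOp_eq H hπ, homPoissonOp_eq H hπ, cotangentBr_apply]
    simp only [wedgeF_eq_mul]
    rw [koszul_mul (hasParity_inDeg i x), ← AdtF_mul, ← AdtF_mul, map_add, map_add, map_smul,
      map_smul]
    match_scalars <;> first | ring1 | linear_combination e | linear_combination -e
  sq_zero a := by
    rw [homPoissonOp_eq H hπ, homPoissonOp_eq H hπ, ← AdtF_koszul H hπ, koszul_koszul H hπ,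
      map_zero, map_zero]

theorem homPoissonOp_one_form {n : ℕ} (H : HasLocalFrames φ n) {π : Bivec φ}
    (hπ : IsHomPoisson φ π) (ξ : Form φ 1) :
    homPoissonOp φ π (inDeg 1 ξ) = func (pairing φ π (extD φ 1 ξ)) := by
  rw [homPoissonOp_eq H hπ, ← contractBi_two_form, inDeg_extD, ← AdtF_inDeg, ← AdtF_dF,
    ← AdtF_contractBi H hπ, koszul_apply, contractBi_inDeg_one, map_zero, sub_zero]

theorem inDeg_Dbar {n : ℕ} (π : Bivec φ) (ξ : Form φ 1) (μ : Form φ n) :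
    inDeg n (Dbar φ π (cotangentBr π) n ξ μ) = cotangentBr π (inDeg 1 ξ) (inDeg n μ) -
      func (pairing φ π (extD φ 1 ξ)) * AdtF φ (inDeg n μ) := by
  have h : inDeg n (cotangentBr π (inDeg 1 ξ) (inDeg n μ) n) =
      cotangentBr π (inDeg 1 ξ) (inDeg n μ) := by
    refine DFinsupp.ext fun k => ?_
    by_cases hk : k = n
    · subst hk; exact inDeg_apply_self _ _
    · rw [cotangentBr_degree π 1 n ξ μ k (by omega)]
      exact inDeg_apply_ne hk _
  rw [← h, AdtF_inDeg, func_mul, smul_inDeg, ← inDeg_sub]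
  rfl

/-- Two generators of the same bracket differ by a twisted derivation. It kills functions for degree
reasons, and on `1`-forms it takes values in functions, which their products with top forms
determine. -/
theorem eq_homPoissonOp_iff {n : ℕ} (H : HasLocalFrames φ n) {π : Bivec φ}
    (hπ : IsHomPoisson φ π) {D : Forms φ →ₗ[ℝ] Forms φ}
    (hD : IsExactGenerator (wedgeF φ) (cotangentBr π) (AdtF φ) D) :
    (∀ (ξ : Form φ 1) (μ : Form φ n),
      inDeg n (Dbar φ π (cotangentBr π) n ξ μ) = cotangentBr π (inDeg 1 ξ) (inDeg n μ) -
        wedgeF φ (D (inDeg 1 ξ)) (AdtF φ (inDeg n μ))) ↔ D = homPoissonOp φ π := by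
  refine ⟨fun h => ?_, fun h ξ μ => ?_⟩
  · have h0 := isExactGenerator_homPoissonOp H hπ
    rw [← sub_eq_zero]
    refine H.derivation_eq_zero _ (fun j => (-1 : ℝ) ^ j) (by simp) ?_ ?_ ?_
    · intro j k y z
      have e := (hD.generates j k y z).symm.trans (h0.generates j k y z)
      have e2 := smul_right_injective (Forms φ) (pow_ne_zero j (by norm_num : (-1 : ℝ) ≠ 0)) e
      simp only [wedgeF_eq_mul] at e2
      simp only [LinearMap.sub_apply, sub_mul, mul_sub, smul_sub]
      linear_combination (norm := module) e2
    · intro f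
      refine DFinsupp.ext fun k => ?_
      rw [func_eq, LinearMap.sub_apply, DirectSum.sub_apply, hD.degree 0 _ k (by omega),
        h0.degree 0 _ k (by omega), sub_zero]
      rfl
    · intro ξ
      have e1 : D (inDeg 1 ξ) = func (value (D (inDeg 1 ξ))) :=
        eq_func_value fun k hk => hD.degree 1 ξ k (by omega)
      rw [LinearMap.sub_apply, homPoissonOp_one_form H hπ, e1, ← map_sub]
      have : value (D (inDeg 1 ξ)) - pairing φ π (extD φ 1 ξ) = 0 := by
        refine H.eq_zero_of_smul_top fun μ => fn_eq_of_inDeg ?_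
        -- Testing on `(Ad^†)⁻¹ μ` makes the second factor an arbitrary top form.
        have e2 := h ξ ((Adt φ n).symm μ)
        rw [inDeg_Dbar, sub_right_inj, wedgeF_eq_mul, AdtF_inDeg, LinearEquiv.apply_symm_apply,
          e1, func_mul, func_mul] at e2
        rw [← smul_inDeg, sub_smul, e2, sub_self, inDeg_zero]
      rw [this, map_zero]
  · rw [inDeg_Dbar, h, homPoissonOp_one_form H hπ, wedgeF_eq_mul]

/-! ### The representation on forms of top degree -/

theorem func_pairing_extD {n : ℕ} (H : HasLocalFrames φ n) {π : Bivec φ}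
    (hπ : IsHomPoisson φ π) (ξ : Form φ 1) :
    func (pairing φ π (extD φ 1 ξ)) = AdtF φ (koszul π (inDeg 1 ξ)) := by
  rw [← homPoissonOp_one_form H hπ, homPoissonOp_eq H hπ]

/-- The connection `[ξ, a] - D(ξ) a` without the twist by `Ad^†`. -/
def koszulConn (π : Bivec φ) (a b : Forms φ) : Forms φ := koszulBr π a b - koszul π a * b

theorem inDeg_Dbar_eq {n : ℕ} (H : HasLocalFrames φ n) {π : Bivec φ} (hπ : IsHomPoisson φ π)
    (ξ : Form φ 1) (μ : Form φ n) :
    inDeg n (Dbar φ π (cotangentBr π) n ξ μ) =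
      AdtF φ (koszulConn π (inDeg 1 ξ) (inDeg n μ)) := by
  rw [inDeg_Dbar, func_pairing_extD H hπ, cotangentBr_apply, ← AdtF_mul, ← map_sub]
  rfl

theorem AdtF_koszulConn {n : ℕ} (H : HasLocalFrames φ n) {π : Bivec φ} (hπ : IsHomPoisson φ π)
    (a b : Forms φ) : AdtF φ (koszulConn π a b) = koszulConn π (AdtF φ a) (AdtF φ b) := by
  rw [koszulConn, map_sub, AdtF_koszulBr H hπ, AdtF_mul, AdtF_koszul H hπ]
  rfl

/-- Vanishing curvature: the pure bracket terms are the Jacobi identity, the terms with `Δ` of the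
bracket are `koszul_koszulBr`, and the two products of `Δξ` and `Δη` cancel. -/
theorem koszulConn_koszulBr {n : ℕ} (H : HasLocalFrames φ n) {π : Bivec φ}
    (hπ : IsHomPoisson φ π) (ξ η : Form φ 1) (b : Forms φ) :
    koszulConn π (koszulBr π (inDeg 1 ξ) (inDeg 1 η)) b =
      koszulConn π (inDeg 1 ξ) (koszulConn π (inDeg 1 η) b) -
        koszulConn π (inDeg 1 η) (koszulConn π (inDeg 1 ξ) b) := by
  have hξ := hasParity_inDeg 1 ξ
  have hη := hasParity_inDeg 1 η
  have k1 := koszul_koszulBr H hπ hξ (inDeg 1 η)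
  have j1 := koszulBr_jacobi H hπ hξ hη b
  rw [koszul_mul_comm (hξ.koszul π) hη] at k1
  -- `Δξ` and `Δη` have even parity, so they commute.
  have c1 := mul_comm_of_hasParity (hξ.koszul π) (hη.koszul π)
  have c2 := congrArg (· * b) c1
  simp only [koszulConn, map_sub, koszulBr_mul hξ (hη.koszul π), koszulBr_mul hη (hξ.koszul π), k1,
    j1]
  norm_num [mul_assoc, sub_mul, mul_sub, add_mul] at c2 ⊢
  rw [c2]
  abel

/-- `ξ ∧ μ` has degree `n + 1` and vanishes, so the product formula for `Δ(ξ ∧ μ)` collapses. The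
resulting expression shows linearity over functions in `ξ`, which fails for the bracket alone. -/
theorem koszulConn_top {n : ℕ} (H : HasLocalFrames φ n) (π : Bivec φ) (ξ : Form φ 1)
    (μ : Form φ n) :
    koszulConn π (inDeg 1 ξ) (inDeg n μ) = -(inDeg 1 ξ * koszul π (inDeg n μ)) := by
  have h := koszul_mul (hasParity_inDeg 1 ξ) π (inDeg n μ)
  rw [← wedgeF_eq_mul, wedgeF_inDeg, H.form_eq_zero_of_lt (by omega) (wedge 1 n ξ μ), inDeg_zero,
    map_zero] at h
  rw [koszulConn]
  linear_combination (norm := module) h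

theorem isRepresentation_Dbar {n : ℕ} (H : HasLocalFrames φ n) {π : Bivec φ}
    (hπ : IsHomPoisson φ π) :
    IsRepresentation φ (cotBr φ π) (cotAnchor φ π) (Adt φ 1).toLinearMap (Adt φ n).toLinearMap
      (Dbar φ π (cotangentBr π) n) where
  homBundle f μ := Adt_smul f μ
  smul_left f ξ μ := fn_eq_of_inDeg <| by
    rw [← smul_inDeg, inDeg_Dbar_eq H hπ, inDeg_Dbar_eq H hπ, koszulConn_top H, koszulConn_top H,
      ← AdtF_smul, ← smul_inDeg, smul_mul_assoc, smul_neg]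
  smul_right ξ f μ := fn_eq_of_inDeg <| by
    have e := koszulBr_mul (hasParity_inDeg 1 ξ) (hasParity_inDeg 0 (fn φ f)) π (inDeg n μ)
    have e1 := cotangentBr_func H hπ ξ f
    rw [← func_eq, mul_zero, pow_zero, one_smul, func_mul, func_mul] at e
    rw [cotangentBr_apply] at e1
    have e2 : act (cotAnchor φ π ξ) f • (inDeg n ((Adt φ n).toLinearMap μ) : Forms φ) =
        AdtF φ (koszulBr π (inDeg 1 ξ) (func f) * inDeg n μ) := by
      rw [AdtF_mul, e1, func_mul, AdtF_inDeg]
      rfl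
    rw [inDeg_add, ← smul_inDeg, ← smul_inDeg, inDeg_Dbar_eq H hπ, inDeg_Dbar_eq H hπ, e2,
      ← AdtF_smul, ← map_add, koszulConn, koszulConn, ← smul_inDeg, e, mul_smul_comm, smul_sub]
    congr 1
    abel
  rep :=
    { equivariant := fun ξ μ => fn_eq_of_inDeg <| by
        change inDeg n (Dbar φ π (cotangentBr π) n (Adt φ 1 ξ) (Adt φ n μ)) =
          inDeg n (Adt φ n (Dbar φ π (cotangentBr π) n ξ μ))
        rw [← AdtF_inDeg, inDeg_Dbar_eq H hπ, inDeg_Dbar_eq H hπ, AdtF_koszulConn H hπ (inDeg 1 ξ),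
          AdtF_inDeg, AdtF_inDeg]
      bracket := fun ξ η μ => fn_eq_of_inDeg <| by
        have e : inDeg 1 (cotBr φ π ξ η) = AdtF φ (koszulBr π (inDeg 1 ξ) (inDeg 1 η)) := by
          rw [← cotangentBr_one_forms, cotangentBr_apply]
        change inDeg n (Dbar φ π (cotangentBr π) n (cotBr φ π ξ η) (Adt φ n μ)) =
          inDeg n (Dbar φ π (cotangentBr π) n (Adt φ 1 ξ) (Dbar φ π (cotangentBr π) n η μ) -
            Dbar φ π (cotangentBr π) n (Adt φ 1 η) (Dbar φ π (cotangentBr π) n ξ μ))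
        rw [inDeg_sub]
        simp only [inDeg_Dbar_eq H hπ, e, ← AdtF_inDeg, ← AdtF_koszulConn H hπ]
        rw [koszulConn_koszulBr H hπ, ← map_sub, ← map_sub] }

/-- The cotangent hom-Lie algebroid and the hom-Gerstenhaber algebra of forms of a hom-Poisson
structure. -/
theorem hom_poisson_of_hasLocalFrames {n : ℕ} (H : HasLocalFrames φ n) {π : Bivec φ}
    (hπ : IsHomPoisson φ π) :
    IsHomLieAlgebroid φ (cotBr φ π) (cotAnchor φ π) (Adt φ 1).toLinearMap ∧
    ∃ br : Forms φ →ₗ[ℝ] Forms φ →ₗ[ℝ] Forms φ,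
      IsCotangentGerstenhaber φ π br ∧
      (∀ br', IsCotangentGerstenhaber φ π br' → br' = br) ∧
      IsRepresentation φ (cotBr φ π) (cotAnchor φ π)
        (Adt φ 1).toLinearMap (Adt φ n).toLinearMap (Dbar φ π br n) ∧
      IsExactGenerator (wedgeF φ) br (AdtF φ) (homPoissonOp φ π) ∧
      ∀ D, IsExactGenerator (wedgeF φ) br (AdtF φ) D →
        ((∀ (ξ : Form φ 1) (μ : Form φ n),
            inDeg n (Dbar φ π br n ξ μ) = br (inDeg 1 ξ) (inDeg n μ) -
                wedgeF φ (D (inDeg 1 ξ)) (AdtF φ (inDeg n μ))) ↔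
          D = homPoissonOp φ π) :=
  have h := isCotangentGerstenhaber_cotangentBr H hπ
  ⟨h.isHomLieAlgebroid, cotangentBr π, h, fun _ => cotangentBr_unique H h,
    isRepresentation_Dbar H hπ, isExactGenerator_homPoissonOp H hπ,
    fun _ => eq_homPoissonOp_iff H hπ⟩

end TopDegree

section Hadamard

open MeasureTheory

/-! ### Hadamard's lemma -/

/-- The integral is the value at `0` of a convolution with the indicator of `(0, 1]`, and a
convolution depends smoothly on parameters when one factor is smooth with uniformly compact support.
-/
theorem contDiff_unitInterval_integral {E : Type*} [NormedAddCommGroup E] [NormedSpace ℝ E]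
    {h : E → ℝ → ℝ} (hh : ContDiff ℝ ∞ (Function.uncurry h)) :
    ContDiff ℝ ∞ fun u => ∫ t in (0 : ℝ)..1, h u t := by
  -- `b` is `1` on `[-1, 1]`, hence does not change the integral, and cuts `h` off outside `[-2,
  -- 2]`. The sign in `g` compensates for the `0 - t` in the convolution.
  let b : ContDiffBump (0 : ℝ) := ⟨1, 2, by norm_num, by norm_num⟩
  let g : E → ℝ → ℝ := fun u t => b t * h u (-t)
  have hg : ContDiff ℝ ∞ (Function.uncurry g) := by
    have h2 : ContDiff ℝ ∞ fun q : E × ℝ => Function.uncurry h (q.1, -q.2) :=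
      hh.comp (contDiff_fst.prodMk contDiff_snd.neg)
    exact (b.contDiff.comp contDiff_snd).mul h2
  have key := contDiffOn_convolution_right_with_param (μ := (volume : Measure ℝ)) (n := (⊤ : ℕ∞))
    (f := Set.indicator (Set.Ioc (0 : ℝ) 1) fun _ => (1 : ℝ)) (ContinuousLinearMap.mul ℝ ℝ)
    (g := g) (s := Set.univ) (k := Metric.closedBall 0 2) isOpen_univ
    (isCompact_closedBall _ _) (fun u t _ ht => by
      have : b t = 0 := b.zero_of_le_dist (by
        rw [Metric.mem_closedBall, not_le] at ht; exact ht.le)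
      simp [g, this])
    (((integrable_indicator_iff measurableSet_Ioc).mpr
      (integrableOn_const (by simp))).locallyIntegrable) hg.contDiffOn
  rw [Set.univ_prod_univ, contDiffOn_univ] at key
  have := key.comp (contDiff_id.prodMk (contDiff_const (c := (0 : ℝ))))
  suffices h : (fun u => ∫ t in (0 : ℝ)..1, h u t) = _ from h ▸ this
  ext u
  simp only [Function.comp_apply, id, convolution_def, ContinuousLinearMap.mul_apply']
  rw [intervalIntegral.integral_of_le zero_le_one, ← integral_indicator measurableSet_Ioc]
  congr 1
  ext t
  by_cases ht : t ∈ Set.Ioc (0 : ℝ) 1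
  · have : b (0 - t) = 1 := b.one_of_mem_closedBall (by
      simp only [zero_sub, Metric.mem_closedBall, dist_zero_right, norm_neg, Real.norm_eq_abs]
      rw [abs_of_pos ht.1]; exact ht.2)
    simp_all [g]
  · simp [ht]

/-- Integrate the derivative of `F` along the segment from `u₀` to `u`; the `G i` are the averaged
partial derivatives. -/
theorem exists_contDiff_eq_add_sum {n : ℕ} {F : EuclideanSpace ℝ (Fin n) → ℝ}
    (hF : ContDiff ℝ ∞ F) (u₀ : EuclideanSpace ℝ (Fin n)) :
    ∃ G : Fin n → EuclideanSpace ℝ (Fin n) → ℝ, (∀ i, ContDiff ℝ ∞ (G i)) ∧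
      (∀ u, F u = F u₀ + ∑ i, (u i - u₀ i) * G i u) ∧
      ∀ i, G i u₀ = fderiv ℝ F u₀ (EuclideanSpace.single i 1) := by
  have hF' : ContDiff ℝ ∞ (fderiv ℝ F) := hF.fderiv_right (by simp)
  have hl : ∀ i, ContDiff ℝ ∞ (Function.uncurry fun (u : EuclideanSpace ℝ (Fin n)) (t : ℝ) =>
      fderiv ℝ F (u₀ + t • (u - u₀)) (EuclideanSpace.single i 1)) := by
    intro i
    refine ContDiff.clm_apply (hF'.comp ?_) contDiff_const
    exact contDiff_const.add (contDiff_snd.smul (contDiff_fst.sub contDiff_const))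
  refine ⟨fun i u => ∫ t in (0 : ℝ)..1, fderiv ℝ F (u₀ + t • (u - u₀)) (EuclideanSpace.single i 1),
    fun i => contDiff_unitInterval_integral (hl i), fun u => ?_, fun i => by simp⟩
  have hd : ∀ t : ℝ, HasDerivAt (fun t : ℝ => F (u₀ + t • (u - u₀)))
      (∑ i, (u i - u₀ i) * fderiv ℝ F (u₀ + t • (u - u₀)) (EuclideanSpace.single i 1)) t := by
    intro t
    have h1 : HasDerivAt (fun t : ℝ => u₀ + t • (u - u₀)) (u - u₀) t := by
      simpa using ((hasDerivAt_id t).smul_const (u - u₀)).const_add u₀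
    have h2 := ((hF.differentiable (by simp)) (u₀ + t • (u - u₀))).hasFDerivAt.comp_hasDerivAt t h1
    have h3 : ∀ L : EuclideanSpace ℝ (Fin n) →L[ℝ] ℝ, L (u - u₀) =
        ∑ i, (u i - u₀ i) * L (EuclideanSpace.single i 1) := fun L => by
      conv_lhs => rw [← (EuclideanSpace.basisFun (Fin n) ℝ).sum_repr (u - u₀), map_sum]
      simp
    exact h3 _ ▸ h2
  have hc : ∀ i, Continuous fun t : ℝ =>
      (u i - u₀ i) * fderiv ℝ F (u₀ + t • (u - u₀)) (EuclideanSpace.single i 1) := fun i =>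
    continuous_const.mul ((hl i).continuous.comp (Continuous.prodMk_right u))
  have h3 := intervalIntegral.integral_eq_sub_of_hasDerivAt (a := 0) (b := 1) (fun t _ => hd t)
    ((continuous_finsetSum _ fun i _ => hc i).intervalIntegrable _ _)
  rw [intervalIntegral.integral_finsetSum fun i _ => (hc i).intervalIntegrable _ _] at h3
  simp only [intervalIntegral.integral_const_mul] at h3
  rw [h3]
  simp

end Hadamard

section Charts

open Set Filter Topology Metric

variable {n : ℕ} {M : Type*} [TopologicalSpace M] [ChartedSpace (EuclideanSpace ℝ (Fin n)) M]

/-! ### Local frames on a manifold -/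

/-- The product of a bump function and a function that is smooth on the domain of the chart. -/
def bumpSMul [T2Space M] [IsManifold (𝓡 n) ∞ M] {c : M} (b : SmoothBumpFunction (𝓡 n) c)
    (g : M → ℝ) (hg : ContMDiffOn (𝓡 n) 𝓘(ℝ, ℝ) ∞ g (chartAt (EuclideanSpace ℝ (Fin n)) c).source) :
    C^∞⟮𝓡 n, M; ℝ⟯ :=
  ⟨fun p => b p • g p, b.contMDiff_smul hg⟩

/-- The `i`-th partial derivative in the chart at `c`. -/
def chartPartial (c : M) (i : Fin n) (f : M → ℝ) (p : M) : ℝ :=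
  fderiv ℝ (f ∘ (extChartAt (𝓡 n) c).symm) (extChartAt (𝓡 n) c p) (EuclideanSpace.single i 1)

theorem bump_eq_zero {c p : M} (b : SmoothBumpFunction (𝓡 n) c)
    (hp : p ∉ (extChartAt (𝓡 n) c).source) : b p = 0 := by
  by_contra h
  rw [extChartAt_source] at hp
  exact hp (b.support_subset_source h)

variable [IsManifold (𝓡 n) ∞ M]

theorem contDiffOn_comp_extChartAt_symm (c : M) (f : C^∞⟮𝓡 n, M; ℝ⟯) :
    ContDiffOn ℝ ∞ (f ∘ (extChartAt (𝓡 n) c).symm) (extChartAt (𝓡 n) c).target :=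
  contMDiffOn_iff_contDiffOn.mp (f.contMDiff.comp_contMDiffOn (contMDiffOn_extChartAt_symm c))

theorem differentiableAt_comp_extChartAt_symm {c p : M} (f : C^∞⟮𝓡 n, M; ℝ⟯)
    (hp : p ∈ (extChartAt (𝓡 n) c).source) :
    DifferentiableAt ℝ (f ∘ (extChartAt (𝓡 n) c).symm) (extChartAt (𝓡 n) c p) :=
  ((contDiffOn_comp_extChartAt_symm c f).contDiffAt
    ((isOpen_extChartAt_target c).mem_nhds ((extChartAt (𝓡 n) c).map_source hp))).differentiableAt
    (by simp)

theorem contMDiffOn_chartPartial (c : M) (i : Fin n) (f : C^∞⟮𝓡 n, M; ℝ⟯) :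
    ContMDiffOn (𝓡 n) 𝓘(ℝ, ℝ) ∞ (chartPartial c i f)
      (chartAt (EuclideanSpace ℝ (Fin n)) c).source := by
  have h1 : ContDiffOn ℝ ∞ (fun u => fderiv ℝ (f ∘ (extChartAt (𝓡 n) c).symm) u
      (EuclideanSpace.single i 1)) (extChartAt (𝓡 n) c).target :=
    ((contDiffOn_comp_extChartAt_symm c f).fderiv_of_isOpen (isOpen_extChartAt_target c)
      (by simp)).clm_apply contDiffOn_const
  refine h1.contMDiffOn.comp contMDiffOn_extChartAt fun p hp => ?_
  exact (extChartAt (𝓡 n) c).map_source (by rwa [extChartAt_source])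

theorem chartPartial_mul {c p : M} (i : Fin n) (f g : C^∞⟮𝓡 n, M; ℝ⟯)
    (hp : p ∈ (extChartAt (𝓡 n) c).source) :
    chartPartial c i (f * g : C^∞⟮𝓡 n, M; ℝ⟯) p =
      f p * chartPartial c i g p + g p * chartPartial c i f p := by
  have h := fderiv_mul (differentiableAt_comp_extChartAt_symm f hp)
    (differentiableAt_comp_extChartAt_symm g hp)
  have h2 : chartPartial c i (f * g : C^∞⟮𝓡 n, M; ℝ⟯) p =
      f ((extChartAt (𝓡 n) c).symm (extChartAt (𝓡 n) c p)) * chartPartial c i g p +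
        g ((extChartAt (𝓡 n) c).symm (extChartAt (𝓡 n) c p)) * chartPartial c i f p :=
    congrArg (fun L => L (EuclideanSpace.single i 1)) h
  rwa [(extChartAt (𝓡 n) c).left_inv hp] at h2

theorem chartPartial_add {c p : M} (i : Fin n) (f g : C^∞⟮𝓡 n, M; ℝ⟯)
    (hp : p ∈ (extChartAt (𝓡 n) c).source) :
    chartPartial c i (f + g : C^∞⟮𝓡 n, M; ℝ⟯) p = chartPartial c i f p + chartPartial c i g p := by
  have h := fderiv_add (differentiableAt_comp_extChartAt_symm f hp)
    (differentiableAt_comp_extChartAt_symm g hp)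
  exact congrArg (fun L => L (EuclideanSpace.single i 1)) h

theorem chartPartial_smul {c p : M} (i : Fin n) (r : ℝ) (f : C^∞⟮𝓡 n, M; ℝ⟯)
    (hp : p ∈ (extChartAt (𝓡 n) c).source) :
    chartPartial c i (r • f : C^∞⟮𝓡 n, M; ℝ⟯) p = r * chartPartial c i f p := by
  have h := fderiv_const_smul (differentiableAt_comp_extChartAt_symm f hp) r
  exact congrArg (fun L => L (EuclideanSpace.single i 1)) h

/-- The closed ball containing the support of the bump lies in the chart's target; off that ball the
product is locally zero, so junk values of the inverse chart do not matter. -/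
theorem contDiff_bump_mul {c : M} (b : SmoothBumpFunction (𝓡 n) c) (f : C^∞⟮𝓡 n, M; ℝ⟯) :
    ContDiff ℝ ∞ fun u => b.toContDiffBump u * f ((extChartAt (𝓡 n) c).symm u) := by
  rw [contDiff_iff_contDiffAt]
  intro u
  by_cases hu : u ∈ closedBall (extChartAt (𝓡 n) c c) b.rOut
  · have ht : u ∈ (extChartAt (𝓡 n) c).target := b.closedBall_subset ⟨hu, by simp⟩
    exact b.contDiffAt.mul ((contDiffOn_comp_extChartAt_symm c f).contDiffAt
      ((isOpen_extChartAt_target c).mem_nhds ht))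
  · have h0 : (fun u => b.toContDiffBump u * f ((extChartAt (𝓡 n) c).symm u)) =ᶠ[𝓝 u]
        fun _ => (0 : ℝ) := by
      filter_upwards [isClosed_closedBall.isOpen_compl.mem_nhds hu] with v hv
      rw [b.zero_of_le_dist (not_le.mp fun h => hv (mem_closedBall.mpr h)).le, zero_mul]
    exact contDiffAt_const.congr_of_eventuallyEq h0

variable [T2Space M]

variable (φ : C^∞⟮𝓡 n, M; ℝ⟯ ≃ₐ[ℝ] C^∞⟮𝓡 n, M; ℝ⟯)

/-- The coordinate vector field `∂ / ∂ xᵢ`, multiplied by a bump function and composed with `φ`. -/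
def coordField {c : M} (b : SmoothBumpFunction (𝓡 n) c) (i : Fin n) : Vec φ :=
  mkVec
    ({ toFun := fun f : C^∞⟮𝓡 n, M; ℝ⟯ => bumpSMul b (chartPartial c i f) (contMDiffOn_chartPartial c i f)
       map_add' := fun f g : C^∞⟮𝓡 n, M; ℝ⟯ => by
        ext p
        change b p * chartPartial c i (f + g : C^∞⟮𝓡 n, M; ℝ⟯) p =
          b p * chartPartial c i f p + b p * chartPartial c i g p
        -- Off the chart's domain `chartPartial` need not be additive, but the bump function
        -- vanishes there.
        by_cases hp : p ∈ (extChartAt (𝓡 n) c).source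
        · rw [chartPartial_add i f g hp, mul_add]
        · simp [bump_eq_zero b hp]
       map_smul' := fun r (f : C^∞⟮𝓡 n, M; ℝ⟯) => by
        ext p
        change b p * chartPartial c i (r • f : C^∞⟮𝓡 n, M; ℝ⟯) p =
          r * (b p * chartPartial c i f p)
        by_cases hp : p ∈ (extChartAt (𝓡 n) c).source
        · rw [chartPartial_smul i r f hp, mul_left_comm]
        · simp [bump_eq_zero b hp] } ∘ₗ φ.toLinearMap)
    (fun f g => by
      ext p
      change b p * chartPartial c i (φ (f * g) : C^∞⟮𝓡 n, M; ℝ⟯) p =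
        φ f p * (b p * chartPartial c i (φ g) p) + φ g p * (b p * chartPartial c i (φ f) p)
      by_cases hp : p ∈ (extChartAt (𝓡 n) c).source
      · rw [map_mul, chartPartial_mul i _ _ hp]; ring
      · simp [bump_eq_zero b hp])

theorem der_coordField {c : M} (b : SmoothBumpFunction (𝓡 n) c) (i : Fin n)
    (f : C^∞⟮𝓡 n, M; ℝ⟯) (p : M) :
    der (coordField φ b i) f p = b p * chartPartial c i f p := by
  change b p * chartPartial c i (φ (φ.symm f) : C^∞⟮𝓡 n, M; ℝ⟯) p = _
  rw [φ.apply_symm_apply]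

/-- The `i`-th coordinate of the chart at `c`, multiplied by a bump function. -/
def bumpCoord {c : M} (b : SmoothBumpFunction (𝓡 n) c) (i : Fin n) : C^∞⟮𝓡 n, M; ℝ⟯ :=
  bumpSMul b (fun p => extChartAt (𝓡 n) c p i)
    ((EuclideanSpace.proj (𝕜 := ℝ) i).contMDiff.comp_contMDiffOn contMDiffOn_extChartAt)

/-- A bump function as a smooth function. -/
def bump {c : M} (b : SmoothBumpFunction (𝓡 n) c) : C^∞⟮𝓡 n, M; ℝ⟯ := ⟨b, b.contMDiff⟩

/-- A `φ`-derivation is determined by its values on the coordinates. -/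
theorem der_eq_sum {c p : M} (b : SmoothBumpFunction (𝓡 n) c)
    (hp : p ∈ (extChartAt (𝓡 n) c).source) (hb : b =ᶠ[𝓝 p] 1) (X : Vec φ)
    (h1 : der X (bump b) p = 0) (f : C^∞⟮𝓡 n, M; ℝ⟯) :
    der X f p = ∑ i, der X (bumpCoord b i) p * chartPartial c i f p := by
  let δ : C^∞⟮𝓡 n, M; ℝ⟯ →ₗ[ℝ] ℝ :=
    { toFun := fun h => der X h p
      map_add' := fun g h => by
        change act X (φ.symm (g + h)) p = _
        rw [map_add, map_add]; rfl
      map_smul' := fun r h => by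
        change act X (φ.symm (r • h)) p = _
        rw [map_smul, map_smul]; rfl }
  have hδ : ∀ g h, δ (g * h) = g p * δ h + h p * δ g := fun g h => by
    change der X (g * h) p = _
    rw [der_mul]
    rfl
  have hbp : b p = 1 := hb.eq_of_nhds
  set ϕ := extChartAt (𝓡 n) c with hϕ
  obtain ⟨G, hG, hFG, hGd⟩ := exists_contDiff_eq_add_sum (contDiff_bump_mul b f) (ϕ p)
  let g : Fin n → C^∞⟮𝓡 n, M; ℝ⟯ := fun i =>
    bumpSMul b (G i ∘ ϕ) ((hG i).contMDiff.comp_contMDiffOn contMDiffOn_extChartAt)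
  have hβ : ∀ q ∈ ϕ.source, b.toContDiffBump (ϕ q) = b q := fun q hq =>
    (b.eqOn_source (by rwa [hϕ, extChartAt_source] at hq)).symm
  -- Hadamard's expansion at `p`, multiplied by enough bump functions to make every factor globally
  -- smooth. Under the point derivation `δ` the bumps act as constants, since `b p = 1` and `δ b =
  -- 0`. The coordinate differences vanish at `p`, so only their derivatives times `g i p` survive.
  have key : bump b * (bump b * (bump b * f)) =
      f p • (bump b * bump b) + ∑ i, (bumpCoord b i - ϕ p i • bump b) * g i := by
    ext q
    have e : (∑ i, (bumpCoord b i - ϕ p i • bump b) * g i) q =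
        ∑ i, (b q * ϕ q i - ϕ p i * b q) * (b q * G i (ϕ q)) := by
      exact map_sum (ContMDiffMap.evalRingHom q) _ _
    change b q * (b q * (b q * f q)) =
      f p * (b q * b q) + (∑ i, (bumpCoord b i - ϕ p i • bump b) * g i) q
    rw [e]
    by_cases hq : q ∈ ϕ.source
    · have h2 := hFG (ϕ q)
      rw [hβ q hq, hβ p hp, hbp, ϕ.left_inv hq, ϕ.left_inv hp, one_mul] at h2
      rw [h2, mul_add, mul_add, Finset.mul_sum, Finset.mul_sum]
      congr 1
      · ring
      · exact Finset.sum_congr rfl fun i _ => by ring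
    · simp [bump_eq_zero b hq]
  have h3 := congrArg δ key
  have hδb : δ (bump b) = 0 := h1
  have hbp' : bump b p = 1 := hbp
  have hx : ∀ i, (bumpCoord b i - ϕ p i • bump b) p = 0 := fun i => by
    change b p * ϕ p i - ϕ p i * b p = 0
    ring
  have hg : ∀ i, g i p = chartPartial c i f p := fun i => by
    change b p * G i (ϕ p) = _
    rw [hbp, one_mul, hGd, chartPartial]
    congr 1
    refine Filter.EventuallyEq.fderiv_eq ?_
    have h2 := (continuousAt_extChartAt_symm' hp).eventually
      (by rw [ϕ.left_inv hp]; exact hb)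
    filter_upwards [h2, (isOpen_extChartAt_target c).mem_nhds (ϕ.map_source hp)] with u hu hu'
    rw [← ϕ.right_inv hu', hβ _ (ϕ.map_target hu'), hu, ϕ.right_inv hu']
    simp
  simp only [hδ, map_add, map_sub, map_smul, map_sum, hδb, hbp', hx, hg, smul_zero, mul_zero,
    zero_mul, add_zero, zero_add, sub_zero, one_mul] at h3
  refine h3.trans (Finset.sum_congr rfl fun i _ => mul_comm _ _)

/-- Two nested bump functions: coordinates are cut off by `b`, fields by the smaller `b'`, and `χ =
b'`. Wherever `b'` is nonzero, `b` is identically `1` nearby, so the cut-off coordinates are genuine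
ones there. -/
theorem exists_isLocalFrame (c : M) : ∃ (χ : C^∞⟮𝓡 n, M; ℝ⟯) (x : Fin n → C^∞⟮𝓡 n, M; ℝ⟯)
    (e : Fin n → Vec φ), IsLocalFrame χ x e ∧ χ c = 1 := by
  obtain ⟨b⟩ : Nonempty (SmoothBumpFunction (𝓡 n) c) := inferInstance
  let b' : SmoothBumpFunction (𝓡 n) c :=
    { rIn := b.rIn / 2
      rOut := b.rIn
      rIn_pos := half_pos b.rIn_pos
      rIn_lt_rOut := half_lt_self b.rIn_pos
      closedBall_subset := fun u hu =>
        b.closedBall_subset ⟨closedBall_subset_closedBall b.rIn_lt_rOut.le hu.1, hu.2⟩ }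
  have hsupp : ∀ p, b' p ≠ 0 → p ∈ (extChartAt (𝓡 n) c).source ∧ b =ᶠ[𝓝 p] 1 := by
    intro p hp
    have hp' : p ∈ Function.support b' := hp
    rw [b'.support_eq_inter_preimage] at hp'
    exact ⟨by rw [extChartAt_source]; exact hp'.1, b.eventuallyEq_one_of_dist_lt hp'.1 hp'.2⟩
  refine ⟨bump b', bumpCoord b, coordField φ b', ⟨fun X => der_ext fun f => ?_, fun i j => ?_⟩,
    b'.eq_one⟩
  · ext p
    have e : der (∑ i, der X (bumpCoord b i) • coordField φ b' i) f p =
        ∑ i, der X (bumpCoord b i) p * (b' p * chartPartial c i f p) := by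
      have e1 : ∀ s : Finset (Fin n), der (∑ i ∈ s, der X (bumpCoord b i) • coordField φ b' i) f p =
          ∑ i ∈ s, der X (bumpCoord b i) p * (b' p * chartPartial c i f p) := by
        intro s
        induction s using Finset.cons_induction with
        | empty => simp [der_apply]
        | cons i s hi ih =>
          rw [Finset.sum_cons, Finset.sum_cons, der_add, der_smul, ← ih, ← der_coordField]
          rfl
      exact e1 _
    rw [e, der_smul]
    change b' p * der X f p = _
    by_cases hp : b' p = 0
    · simp [hp]
    obtain ⟨hs, hb⟩ := hsupp p hp
    -- Locality of `X` is not needed: differentiating `b' b = b'` and using `b p = 1` gives `b' p ·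
    -- X(b)(p) = 0`.
    have hb0 : der X (bump b) p = 0 := by
      have h0 : bump b' * bump b = bump b' := by
        ext q
        change b' q * b q = b' q
        by_cases hq : b' q = 0
        · rw [hq, zero_mul]
        · rw [(hsupp q hq).2.eq_of_nhds, Pi.one_apply, mul_one]
      have h2 := congrArg (fun h => der X h p) h0
      simp only [der_mul] at h2
      change b' p * der X (bump b) p + b p * der X (bump b') p = der X (bump b') p at h2
      rw [hb.eq_of_nhds, Pi.one_apply, one_mul, add_eq_right] at h2
      exact (mul_eq_zero.mp h2).resolve_left hp
    rw [der_eq_sum φ b hs hb X hb0 f, Finset.mul_sum]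
    exact Finset.sum_congr rfl fun i _ => by ring
  · ext p
    rw [der_coordField]
    by_cases hp : b' p = 0
    · rw [hp, zero_mul]
      split_ifs
      · exact hp.symm
      · rfl
    obtain ⟨hs, hb⟩ := hsupp p hp
    have h1 : (bumpCoord b j ∘ (extChartAt (𝓡 n) c).symm) =ᶠ[𝓝 (extChartAt (𝓡 n) c p)]
        EuclideanSpace.proj (𝕜 := ℝ) j := by
      have h2 := (continuousAt_extChartAt_symm' hs).eventually
        (by rw [(extChartAt (𝓡 n) c).left_inv hs]; exact hb)
      filter_upwards [h2, (isOpen_extChartAt_target c).mem_nhds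
        ((extChartAt (𝓡 n) c).map_source hs)] with u hu hu'
      change b ((extChartAt (𝓡 n) c).symm u) *
        extChartAt (𝓡 n) c ((extChartAt (𝓡 n) c).symm u) j = u j
      rw [hu, (extChartAt (𝓡 n) c).right_inv hu', Pi.one_apply, one_mul]
    rw [chartPartial, h1.fderiv_eq, ContinuousLinearMap.fderiv]
    by_cases hij : i = j
    · subst hij; simp [bump]
    · simp [hij, Ne.symm hij]

theorem hasLocalFrames : HasLocalFrames φ n := by
  intro a ha
  obtain ⟨c, hc⟩ : ∃ c, a c ≠ 0 := by
    by_contra! h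
    exact ha (ContMDiffMap.ext h)
  obtain ⟨χ, x, e, hf, h1⟩ := exists_isLocalFrame φ c
  exact ⟨ContMDiffMap.evalRingHom c, χ, x, e, hf, hc, h1⟩

end Charts

end HomPoisson

end

/-! ### The theorem for hom-Poisson manifolds -/

theorem mainTheorem9 {n : ℕ} {M : Type*} [TopologicalSpace M] [T2Space M]
    [SecondCountableTopology M] [ChartedSpace (EuclideanSpace ℝ (Fin n)) M] [IsManifold (𝓡 n) ∞ M]
    (ψ : M ≃ₘ^∞⟮𝓡 n, 𝓡 n⟯ M) (π : HomPoisson.Bivec (HomPoisson.pullback ψ))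
    (hπ : HomPoisson.IsHomPoisson (HomPoisson.pullback ψ) π) :
    let φ := HomPoisson.pullback ψ
    HomPoisson.IsHomLieAlgebroid φ (HomPoisson.cotBr φ π) (HomPoisson.cotAnchor φ π)
      (HomPoisson.Adt φ 1).toLinearMap ∧
    ∃ br : HomPoisson.Forms φ →ₗ[ℝ] HomPoisson.Forms φ →ₗ[ℝ] HomPoisson.Forms φ,
      HomPoisson.IsCotangentGerstenhaber φ π br ∧
      (∀ br', HomPoisson.IsCotangentGerstenhaber φ π br' → br' = br) ∧
      HomPoisson.IsRepresentation φ (HomPoisson.cotBr φ π) (HomPoisson.cotAnchor φ π)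
        (HomPoisson.Adt φ 1).toLinearMap (HomPoisson.Adt φ n).toLinearMap
        (HomPoisson.Dbar φ π br n) ∧
      HomPoisson.IsExactGenerator (HomPoisson.wedgeF φ) br (HomPoisson.AdtF φ)
        (HomPoisson.homPoissonOp φ π) ∧
      ∀ D, HomPoisson.IsExactGenerator (HomPoisson.wedgeF φ) br (HomPoisson.AdtF φ) D →
        ((∀ (ξ : HomPoisson.Form φ 1) (μ : HomPoisson.Form φ n),
            HomPoisson.inDeg n (HomPoisson.Dbar φ π br n ξ μ) =
              br (HomPoisson.inDeg 1 ξ) (HomPoisson.inDeg n μ) -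
                HomPoisson.wedgeF φ (D (HomPoisson.inDeg 1 ξ))
                  (HomPoisson.AdtF φ (HomPoisson.inDeg n μ))) ↔
          D = HomPoisson.homPoissonOp φ π) := by
  exact HomPoisson.hom_poisson_of_hasLocalFrames
    (HomPoisson.hasLocalFrames (HomPoisson.pullback ψ)) hπ
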